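/- **Theorem (degenerate parametric oscillator).** *Model.* Let $\mathscr H=\ell^2(\mathbb N)\otimes\ell^2(\mathbb N)$ with canonical orthonormal basis $e_{n,m}=e_n\otimes e_m$, $n,m\ge 0$, and write $u_{n,m}=\langle e_{n,m}|u\rangle$, with $u_{n,m}=0$ if $n<0$ or $m<0$. Let $a,a^\dagger$ have the common domain $\{u:\sum n|u_{n,m}|^2<\infty\}$ and act by $a\,e_{n,m}=\sqrt n\,e_{n-1,m}$ (zero for $n=0$), $a^\dagger e_{n,m}=\sqrt{n+1}\,e_{n+1,m}$; let $a^\dagger a$ have domain $\{u:\sum n^2|u_{n,m}|^2<\infty\}$ and act by $a^\dagger a\,e_{n,m}=n\,e_{n,m}$. Define $b,b^\dagger,b^\dagger b$ likewise with respect to the second index $m$. Let $\omega_C>0$, $g\in\mathbb R\setminus\{0\}$, $\kappa>0$, $\overline n\ge0$, $\kappa_p>0$, $\overline n_p\ge0$, and let $\alpha_1,\dots,\alpha_4,\beta_1,\dots,\beta_4\in\mathbb C$ satisfy $$|\alpha_1|^2+|\alpha_2|^2+|\alpha_3|^2=2\kappa(\overline n+1),\quad |\alpha_4|^2=2\kappa\overline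 n,\quad |\beta_1|^2+|\beta_2|^2+|\beta_3|^2=2\kappa_p(\overline n_p+1),\quad |\beta_4|^2=2\kappa_p\overline n_p .$$ Let $d=8$, $S_{ij}=\delta_{ij}\mathbb 1$, and $$R_1=\beta_1 b,\ R_2=\alpha_1a,\ R_3=\alpha_2a,\ R_4=\beta_2b,\ R_5=\beta_3b,\ R_6=\alpha_3a,\ R_7=\beta_4b^\dagger,\ R_8=\alpha_4a^\dagger,$$ where the product of the scalar $0$ with an unbounded operator means the everywhere defined zero operator. Let $Ku=\sum_{n,m}k_u(n,m)e_{n,m}$ on $\mathrm{Dom}(K)=\{u:\sum_{n,m}|k_u(n,m)|^2<\infty\}$, with $$k_u(n,m)=\tfrac g2\sqrt{n(n-1)(m+1)}\,u_{n-2,m+1}-\tfrac g2\sqrt{m(n+1)(n+2)}\,u_{n+2,m-1}-\big[\kappa\overline n+\kappa_p\overline n_p+\mathrm i\omega_Cn+\kappa(2\overline n+1)n+2\mathrm i\omega_Cm+\kappa_p(2\overline n_p+1)m\big]u_{n,m}.$$ Let $F=(F_{ij})_{0\le i,j\le 8}$ with $F_{00}=K$, $F_{i0}=R_i$, $F_{0j}=N_j:=-R_j^*$,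 $F_{ij}=0$ for $i,j\ge1$, and put $\mathrm{Dom}(F)=\bigcap_{i,j\ge0}\mathrm{Dom}(F_{ij})$. Let $D=\widetilde D$ be the linear span of $\{e_{n,m}\}$, let $N=a^\dagger a+2b^\dagger b$ on $\mathrm{Dom}(a^\dagger a)\cap\mathrm{Dom}(b^\dagger b)$, and let $C=N^4$ on its natural domain. *Conclusion.* All of the following hold. 1. Every $F_{ij}$ is closed. 2. $F_{ij}=S_{ij}-\delta_{ij}\mathbb 1$ for $i,j\ge1$, and $\sum_kS_{ki}^*S_{kj}=\sum_kS_{ik}S_{jk}^*=\delta_{ij}\mathbb 1$. 3. $D$ is dense and is a core for $K,R_i,N_i$; $\widetilde D$ is dense and is a core for $K^*,R_i^*,N_i^*$ ($i=1,\dots,8$). 4. $\mathrm{Dom}(N_i^*)\supset D\cup\widetilde D$, $\mathrm{Dom}(R_i)\supset D\cup\widetilde D$, $\mathrm{Dom}(N_i)\supset\mathrm{Dom}(K)$ for all $i\ge1$. 5. $S_{ki}u\in\mathrm{Dom}(R_k^*)$ for all $u\in\mathrm{Dom}(K)$ and $i,k\ge1$. 6. $K$ and $K^*$ are the infinitesimal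 generators of strongly continuous contraction semigroups on $\mathscr H$, and for all $u\in D$, $v\in\widetilde D$: $2\,\mathrm{Re}\langle Ku|u\rangle=-\sum_k\|R_ku\|^2$ and $2\,\mathrm{Re}\langle K^*v|v\rangle=-\sum_k\|N_k^*v\|^2$. 7. $N_i^*u=-\sum_kS_{ki}^*R_ku$ for all $u\in D\cup\widetilde D$, $i\ge1$. 8. $C$ is positive and self-adjoint, $\mathrm{Dom}(C^{1/2})\subset\mathrm{Dom}(F)$, and there are constants $\delta>0$, $b_1,b_2\ge0$ such that for every $\epsilon\in(0,\delta)$, with $C_\epsilon=C(1+\epsilon C)^{-2}$: (a) there is a dense subspace $D_\epsilon\subset\widetilde D$ with $C_\epsilon^{1/2}D_\epsilon\subset\widetilde D$ such that every $F_{ij}^*C_\epsilon^{1/2}|_{D_\epsilon}$ ($0\le i,j\le8$) is everywhere defined on $D_\epsilon$ and bounded; (b) for all $u_0,\dots,u_8\in\mathrm{Dom}(F)$, $$\sum_{i,j\ge0}\Big(\langle u_i|C_\epsilon F_{ij}u_j\rangle+\langle F_{ji}u_i|C_\epsilon u_j\rangle+\sum_{k\ge1}\langle F_{ki}u_i|C_\epsilon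 F_{kj}u_j\rangle\Big)\le\sum_{i\ge0}\big(b_1\langle u_i|C_\epsilon u_i\rangle+b_2\|u_i\|^2\big).$$ -/

import Mathlib

open scoped InnerProductSpace TensorProduct

noncomputable section

namespace ParamOsc

section General

variable {H : Type*} [NormedAddCommGroup H] [InnerProductSpace ℂ H]

open Classical in
/-- The value `T u` of a partially defined operator at a vector `u`. It is only ever used at
vectors of the domain of `T`; outside of the domain it is zero by convention. -/
def ap (T : H →ₗ.[ℂ] H) (u : H) : H :=
  if h : u ∈ T.domain then T ⟨u, h⟩ else 0

/-- The scalar multiple `c T` of an unbounded operator, with the convention that the zero multiple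
is the everywhere defined zero operator. -/
def scal (c : ℂ) (T : H →ₗ.[ℂ] H) : H →ₗ.[ℂ] H :=
  open Classical in if c = 0 then 0 else c • T

/-- The product `S T` of unbounded operators on its natural domain
`{u ∈ Dom T : T u ∈ Dom S}`. -/
def prodOp (S T : H →ₗ.[ℂ] H) : H →ₗ.[ℂ] H where
  domain := (S.domain.comap T.toFun).map T.domain.subtype
  toFun :=
    { toFun := fun u => S ⟨T ⟨u, by
          obtain ⟨v, -, hv⟩ := u.2
          exact hv ▸ v.2⟩, by
          obtain ⟨u, v, hv, rfl⟩ := u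
          exact hv⟩
      map_add' := by
        intro u v
        rw [← S.map_add]
        congr 1
        exact Subtype.ext (T.map_add ⟨u, _⟩ ⟨v, _⟩)
      map_smul' := by
        intro c u
        rw [RingHom.id_apply, ← S.map_smul]
        congr 1
        exact Subtype.ext (T.map_smul c ⟨u, _⟩) }

/-- The powers of an unbounded operator, on their natural domains. -/
def powOp (T : H →ₗ.[ℂ] H) : ℕ → (H →ₗ.[ℂ] H)
  | 0 => (LinearMap.id : H →ₗ[ℂ] H).toPMap ⊤
  | k + 1 => prodOp T (powOp T k)

/-- Positivity (in the sense of quadratic forms) of an unbounded operator. -/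
def IsPositiveOp (T : H →ₗ.[ℂ] H) : Prop :=
  ∀ u : T.domain, 0 ≤ (⟪(u : H), T u⟫_ℂ).re

/-- `K` is the infinitesimal generator of a strongly continuous contraction semigroup: there is
such a semigroup `T` for which `u ∈ Dom K` and `K u = v` hold if and only if
`(T t u - u) / t → v` as `t ↓ 0`. -/
def GeneratesContractionSemigroup (K : H →ₗ.[ℂ] H) : Prop :=
  ∃ T : ℝ → (H →L[ℂ] H),
    T 0 = 1 ∧
    (∀ s t, 0 ≤ s → 0 ≤ t → T (s + t) = T s * T t) ∧
    (∀ t, 0 ≤ t → ‖T t‖ ≤ 1) ∧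
    (∀ u, ContinuousOn (fun t => T t u) (Set.Ici 0)) ∧
    (∀ u v, (u, v) ∈ K.graph ↔
      Filter.Tendsto (fun t : ℝ => ((t : ℂ))⁻¹ • (T t u - u)) (nhdsWithin 0 (Set.Ioi 0)) (nhds v))

/-- The domain `Dom F = ⋂ Dom F_{ij}` of a matrix of operators. -/
def matrixDomain {ι : Type*} (F : ι → ι → (H →ₗ.[ℂ] H)) : Submodule ℂ H :=
  ⨅ i, ⨅ j, (F i j).domain

/-- The `(1+d) × (1+d)` matrix with blocks `K`, `R`, `N`, `G`:
`F₀₀ = K`, `F_{i0} = R_i`, `F_{0j} = N_j`, `F_{ij} = G_{ij}` for `i, j ≥ 1`. -/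
def blockMatrix {d : ℕ} (K : H →ₗ.[ℂ] H) (R N : Fin d → (H →ₗ.[ℂ] H))
    (G : Fin d → Fin d → (H →ₗ.[ℂ] H)) : Fin (d + 1) → Fin (d + 1) → (H →ₗ.[ℂ] H) :=
  Fin.cons (Fin.cons K N) (fun i => Fin.cons (R i) (G i))

/-- A bounded operator as an everywhere defined element of the set of unbounded operators. -/
def ofBounded (B : H →L[ℂ] H) : H →ₗ.[ℂ] H := (B : H →ₗ[ℂ] H).toPMap ⊤

variable [CompleteSpace H]

/-- `B` is the positive self-adjoint square root of the operator `C`, that is `B` is positive and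
self-adjoint and `B B = C` with equality of domains. -/
def IsSquareRoot (C B : H →ₗ.[ℂ] H) : Prop :=
  IsSelfAdjoint B ∧ IsPositiveOp B ∧ prodOp B B = C

/-- `B` is the bounded operator `C (1 + ε C)⁻²`: every vector `u` is of the form
`u = (1 + ε C)² x` with `x ∈ Dom C²`, and `B u = C x`. -/
def IsRegularization (C : H →ₗ.[ℂ] H) (ε : ℝ) (B : H →L[ℂ] H) : Prop :=
  ∀ u, ∃ x y z : H, (x, y) ∈ C.graph ∧ (y, z) ∈ C.graph ∧
    u = x + ((2 * ε : ℝ) : ℂ) • y + ((ε ^ 2 : ℝ) : ℂ) • z ∧ B u = y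

/-- The hypotheses on the matrix `F` of coefficients (index `0` is the time index, the indices
`i.succ` are the `d` channels) with the witnesses `S`, `D`, `Dt` (for the second core) and `C`. -/
structure HypothesisC {d : ℕ} (F : Fin (d + 1) → Fin (d + 1) → (H →ₗ.[ℂ] H))
    (S : Fin d → Fin d → (H →L[ℂ] H)) (D Dt : Submodule ℂ H) (C : H →ₗ.[ℂ] H) : Prop where
  /-- (i) -/
  closed : ∀ i j, (F i j).IsClosed
  /-- (ii) -/
  scattering : ∀ i j : Fin d, F i.succ j.succ = ofBounded (S i j - if i = j then 1 else 0)
  unitary_left : ∀ i j, ∑ k, (S k i).adjoint * S k j = if i = j then 1 else 0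
  unitary_right : ∀ i j, ∑ k, S i k * (S j k).adjoint = if i = j then 1 else 0
  /-- (iii) -/
  dense_D : Dense (D : Set H)
  core_K : (F 0 0).HasCore D
  core_R : ∀ i : Fin d, (F i.succ 0).HasCore D
  core_N : ∀ i : Fin d, (F 0 i.succ).HasCore D
  dense_Dt : Dense (Dt : Set H)
  core_K_adj : ((F 0 0).adjoint).HasCore Dt
  core_R_adj : ∀ i : Fin d, ((F i.succ 0).adjoint).HasCore Dt
  core_N_adj : ∀ i : Fin d, ((F 0 i.succ).adjoint).HasCore Dt
  /-- (iv) -/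
  dom_N_adj : ∀ i : Fin d, (D : Set H) ∪ Dt ⊆ ((F 0 i.succ).adjoint).domain
  dom_R : ∀ i : Fin d, (D : Set H) ∪ Dt ⊆ (F i.succ 0).domain
  dom_N : ∀ i : Fin d, (F 0 0).domain ≤ (F 0 i.succ).domain
  /-- (v) -/
  dom_S : ∀ k : Fin d, ∀ u ∈ (F 0 0).domain, ∀ i : Fin d, S k i u ∈ ((F k.succ 0).adjoint).domain
  /-- (vi) -/
  generator : GeneratesContractionSemigroup (F 0 0)
  generator_adj : GeneratesContractionSemigroup ((F 0 0).adjoint)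
  dissipative : ∀ u ∈ D, 2 * (⟪ap (F 0 0) u, u⟫_ℂ).re = - ∑ k : Fin d, ‖ap (F k.succ 0) u‖ ^ 2
  dissipative_adj : ∀ v ∈ Dt, 2 * (⟪ap ((F 0 0).adjoint) v, v⟫_ℂ).re
    = - ∑ k : Fin d, ‖ap ((F 0 k.succ).adjoint) v‖ ^ 2
  /-- (vii) -/
  N_adj_eq : ∀ u ∈ (D : Set H) ∪ Dt, ∀ i : Fin d,
    ap ((F 0 i.succ).adjoint) u = - ∑ k : Fin d, (S k i).adjoint (ap (F k.succ 0) u)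
  /-- (viii) -/
  selfAdjoint_C : IsSelfAdjoint C
  positive_C : IsPositiveOp C
  dom_sqrt_C : ∃ Q, IsSquareRoot C Q ∧ Q.domain ≤ matrixDomain F
  fagnola_wills : ∃ δ b₁ b₂ : ℝ, 0 < δ ∧ 0 ≤ b₁ ∧ 0 ≤ b₂ ∧
    ∀ ε : ℝ, 0 < ε → ε < δ → ∃ Cε : H →L[ℂ] H, IsRegularization C ε Cε ∧ 0 ≤ Cε ∧
      -- (a)
      (∃ Dε : Submodule ℂ H, Dense (Dε : Set H) ∧ Dε ≤ Dt ∧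
        (∀ u ∈ Dε, CFC.sqrt Cε u ∈ Dt) ∧
        ∀ i j, ∃ M : ℝ, ∀ u ∈ Dε,
          CFC.sqrt Cε u ∈ ((F i j).adjoint).domain ∧
            ‖ap ((F i j).adjoint) (CFC.sqrt Cε u)‖ ≤ M * ‖u‖) ∧
      -- (b)
      (∀ u : Fin (d + 1) → H, (∀ i, u i ∈ matrixDomain F) →
        (∑ i, ∑ j, (⟪u i, Cε (ap (F i j) (u j))⟫_ℂ + ⟪ap (F j i) (u i), Cε (u j)⟫_ℂ
          + ∑ k : Fin d, ⟪ap (F k.succ i) (u i), Cε (ap (F k.succ j) (u j))⟫_ℂ)).re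
        ≤ ∑ i, (b₁ * (⟪u i, Cε (u i)⟫_ℂ).re + b₂ * ‖u i‖ ^ 2))

end General

section Oscillator

variable {H : Type*} [NormedAddCommGroup H] [InnerProductSpace ℂ H]
  (e : HilbertBasis (ℕ × ℕ) ℂ H)

lemma memlp_two_iff {f : ℕ × ℕ → ℂ} : Memℓp f 2 ↔ Summable fun p => ‖f p‖ ^ 2 := by
  rw [memℓp_gen_iff (by norm_num)]
  norm_num

/-- `{u : ∑_{n,m} w(n,m) |u_{n,m}|² < ∞}`, for a nonnegative weight `w`. -/
def weightDom (w : ℕ × ℕ → ℕ) : Submodule ℂ H where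
  carrier := {u | Summable fun p => (w p : ℝ) * ‖e.repr u p‖ ^ 2}
  zero_mem' := by simp
  add_mem' := by
    intro u v hu hv
    refine Summable.of_nonneg_of_le (fun p => by positivity) (fun p => ?_)
      ((hu.mul_left 2).add (hv.mul_left 2))
    have h1 : ‖e.repr (u + v) p‖ ≤ ‖e.repr u p‖ + ‖e.repr v p‖ := by
      rw [map_add, lp.coeFn_add, Pi.add_apply]
      exact norm_add_le _ _
    have h2 : ‖e.repr (u + v) p‖ ^ 2 ≤ 2 * ‖e.repr u p‖ ^ 2 + 2 * ‖e.repr v p‖ ^ 2 := by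
      nlinarith [norm_nonneg (e.repr (u + v) p), sq_nonneg (‖e.repr u p‖ - ‖e.repr v p‖)]
    calc (w p : ℝ) * ‖e.repr (u + v) p‖ ^ 2
        ≤ w p * (2 * ‖e.repr u p‖ ^ 2 + 2 * ‖e.repr v p‖ ^ 2) := by gcongr
      _ = _ := by ring
  smul_mem' := by
    intro c u hu
    refine (hu.mul_left (‖c‖ ^ 2)).congr (fun p => ?_)
    rw [map_smul, lp.coeFn_smul, Pi.smul_apply, norm_smul]
    ring

/-- The operator `u ↦ ∑_{n,m} (L u)_{n,m} e_{n,m}` with a prescribed domain, where `L` is a linear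
map of the coefficients. -/
def coeffOp (L : (ℕ × ℕ → ℂ) →ₗ[ℂ] (ℕ × ℕ → ℂ)) (dom : Submodule ℂ H)
    (h : ∀ u ∈ dom, Memℓp (L (e.repr u)) 2) : H →ₗ.[ℂ] H where
  domain := dom
  toFun :=
    { toFun := fun u => e.repr.symm ⟨L (e.repr u), h u u.2⟩
      map_add' := by
        intro u v
        rw [← map_add]
        refine congrArg e.repr.symm (Subtype.ext ?_)
        change L (e.repr ((u : H) + v)) = L (e.repr u) + L (e.repr v)
        rw [map_add, lp.coeFn_add, map_add]
      map_smul' := by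
        intro c u
        rw [RingHom.id_apply, ← map_smul]
        refine congrArg e.repr.symm (Subtype.ext ?_)
        change L (e.repr (c • (u : H))) = c • L (e.repr u)
        rw [map_smul, lp.coeFn_smul, map_smul] }

/-- `(a u)_{n,m} = √(n+1) u_{n+1,m}`. -/
def coeffA : (ℕ × ℕ → ℂ) →ₗ[ℂ] (ℕ × ℕ → ℂ) where
  toFun u p := (Real.sqrt (p.1 + 1) : ℂ) * u (p.1 + 1, p.2)
  map_add' u v := by ext p; simp [mul_add]
  map_smul' c u := by ext p; simp [mul_left_comm]

/-- `(a† u)_{n,m} = √n u_{n-1,m}`, which is `0` for `n = 0`. -/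
def coeffAdag : (ℕ × ℕ → ℂ) →ₗ[ℂ] (ℕ × ℕ → ℂ) where
  toFun u p := (Real.sqrt p.1 : ℂ) * u (p.1 - 1, p.2)
  map_add' u v := by ext p; simp [mul_add]
  map_smul' c u := by ext p; simp [mul_left_comm]

/-- `(b u)_{n,m} = √(m+1) u_{n,m+1}`. -/
def coeffB : (ℕ × ℕ → ℂ) →ₗ[ℂ] (ℕ × ℕ → ℂ) where
  toFun u p := (Real.sqrt (p.2 + 1) : ℂ) * u (p.1, p.2 + 1)
  map_add' u v := by ext p; simp [mul_add]
  map_smul' c u := by ext p; simp [mul_left_comm]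

/-- `(b† u)_{n,m} = √m u_{n,m-1}`, which is `0` for `m = 0`. -/
def coeffBdag : (ℕ × ℕ → ℂ) →ₗ[ℂ] (ℕ × ℕ → ℂ) where
  toFun u p := (Real.sqrt p.2 : ℂ) * u (p.1, p.2 - 1)
  map_add' u v := by ext p; simp [mul_add]
  map_smul' c u := by ext p; simp [mul_left_comm]

/-- Multiplication of the coefficients by `w(n,m)`. -/
def coeffDiag (w : ℕ × ℕ → ℕ) : (ℕ × ℕ → ℂ) →ₗ[ℂ] (ℕ × ℕ → ℂ) where
  toFun u p := (w p : ℂ) * u p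
  map_add' u v := by ext p; simp [mul_add]
  map_smul' c u := by ext p; simp [mul_left_comm]

lemma summable_sq (u : H) : Summable fun p => ‖e.repr u p‖ ^ 2 :=
  memlp_two_iff.1 (lp.memℓp (e.repr u))

lemma memlp_coeffA (u : H) (hu : u ∈ weightDom e (fun p => p.1)) :
    Memℓp (coeffA (e.repr u)) 2 := by
  rw [memlp_two_iff]
  have hi : Function.Injective fun p : ℕ × ℕ => (p.1 + 1, p.2) := by
    rintro ⟨a, b⟩ ⟨c, d⟩ h; simpa using h
  refine (hu.comp_injective hi).congr (fun p => ?_)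
  have h0 : (0 : ℝ) ≤ (p.1 : ℝ) + 1 := by positivity
  simp [coeffA, mul_pow, Real.sq_sqrt h0]

lemma memlp_coeffB (u : H) (hu : u ∈ weightDom e (fun p => p.2)) :
    Memℓp (coeffB (e.repr u)) 2 := by
  rw [memlp_two_iff]
  have hi : Function.Injective fun p : ℕ × ℕ => (p.1, p.2 + 1) := by
    rintro ⟨a, b⟩ ⟨c, d⟩ h; simpa using h
  refine (hu.comp_injective hi).congr (fun p => ?_)
  have h0 : (0 : ℝ) ≤ (p.2 : ℝ) + 1 := by positivity
  simp [coeffB, mul_pow, Real.sq_sqrt h0]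

lemma memlp_coeffAdag (u : H) (hu : u ∈ weightDom e (fun p => p.1)) :
    Memℓp (coeffAdag (e.repr u)) 2 := by
  rw [memlp_two_iff]
  have hi : Function.Injective fun p : ℕ × ℕ => (p.1 + 1, p.2) := by
    rintro ⟨a, b⟩ ⟨c, d⟩ h; simpa using h
  rw [← hi.summable_iff]
  · refine (hu.add (summable_sq e u)).congr (fun p => ?_)
    simp [coeffAdag, mul_pow]
    ring
  · rintro ⟨n, m⟩ hp
    cases n with
    | zero => simp [coeffAdag]
    | succ n => exact absurd ⟨(n, m), rfl⟩ hp

lemma memlp_coeffBdag (u : H) (hu : u ∈ weightDom e (fun p => p.2)) :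
    Memℓp (coeffBdag (e.repr u)) 2 := by
  rw [memlp_two_iff]
  have hi : Function.Injective fun p : ℕ × ℕ => (p.1, p.2 + 1) := by
    rintro ⟨a, b⟩ ⟨c, d⟩ h; simpa using h
  rw [← hi.summable_iff]
  · refine (hu.add (summable_sq e u)).congr (fun p => ?_)
    simp [coeffBdag, mul_pow]
    ring
  · rintro ⟨n, m⟩ hp
    cases m with
    | zero => simp [coeffBdag]
    | succ m => exact absurd ⟨(n, m), rfl⟩ hp

lemma memlp_coeffDiag (w : ℕ × ℕ → ℕ) (u : H) (hu : u ∈ weightDom e (fun p => w p ^ 2)) :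
    Memℓp (coeffDiag w (e.repr u)) 2 := by
  rw [memlp_two_iff]
  refine hu.congr (fun p => ?_)
  simp [coeffDiag, mul_pow]

/-- The annihilation operator `a` of the first mode. -/
def opA : H →ₗ.[ℂ] H := coeffOp e coeffA (weightDom e fun p => p.1) (memlp_coeffA e)

/-- The creation operator `a†` of the first mode. -/
def opAdag : H →ₗ.[ℂ] H := coeffOp e coeffAdag (weightDom e fun p => p.1) (memlp_coeffAdag e)

/-- The annihilation operator `b` of the second mode. -/
def opB : H →ₗ.[ℂ] H := coeffOp e coeffB (weightDom e fun p => p.2) (memlp_coeffB e)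

/-- The creation operator `b†` of the second mode. -/
def opBdag : H →ₗ.[ℂ] H := coeffOp e coeffBdag (weightDom e fun p => p.2) (memlp_coeffBdag e)

/-- The number operator `a†a`. -/
def numA : H →ₗ.[ℂ] H :=
  coeffOp e (coeffDiag fun p => p.1) (weightDom e fun p => p.1 ^ 2)
    (memlp_coeffDiag e fun p => p.1)

/-- The number operator `b†b`. -/
def numB : H →ₗ.[ℂ] H :=
  coeffOp e (coeffDiag fun p => p.2) (weightDom e fun p => p.2 ^ 2)
    (memlp_coeffDiag e fun p => p.2)

/-- `N = a†a + 2 b†b`. -/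
def opN : H →ₗ.[ℂ] H := numA e + (2 : ℂ) • numB e

/-- The linear span of the basis. -/
def spanBasis : Submodule ℂ H := Submodule.span ℂ (Set.range e)

/-- The real parameters `ω_C, g, κ, n̄, κ_p, n̄_p` and the channel amplitudes `α₁, …, α₄`,
`β₁, …, β₄` (indexed from `0`), with their constraints. -/
structure Params where
  ω : ℝ
  g : ℝ
  κ : ℝ
  nbar : ℝ
  κp : ℝ
  nbarp : ℝ
  α : Fin 4 → ℂ
  β : Fin 4 → ℂ
  ω_pos : 0 < ω
  g_ne : g ≠ 0
  κ_pos : 0 < κ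
  nbar_nonneg : 0 ≤ nbar
  κp_pos : 0 < κp
  nbarp_nonneg : 0 ≤ nbarp
  α_loss : ‖α 0‖ ^ 2 + ‖α 1‖ ^ 2 + ‖α 2‖ ^ 2 = 2 * κ * (nbar + 1)
  α_gain : ‖α 3‖ ^ 2 = 2 * κ * nbar
  β_loss : ‖β 0‖ ^ 2 + ‖β 1‖ ^ 2 + ‖β 2‖ ^ 2 = 2 * κp * (nbarp + 1)
  β_gain : ‖β 3‖ ^ 2 = 2 * κp * nbarp

variable (P : Params)

/-- The coefficients `k_u(n,m)` of `K u`. A coefficient of `u` with a truncated (formally negative)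
index is always multiplied by `√0`. -/
def coeffK : (ℕ × ℕ → ℂ) →ₗ[ℂ] (ℕ × ℕ → ℂ) where
  toFun u p :=
    (P.g / 2 : ℂ) * (Real.sqrt ((p.1 : ℝ) * ((p.1 : ℝ) - 1) * ((p.2 : ℝ) + 1)) : ℂ)
        * u (p.1 - 2, p.2 + 1)
      - (P.g / 2 : ℂ) * (Real.sqrt ((p.2 : ℝ) * ((p.1 : ℝ) + 1) * ((p.1 : ℝ) + 2)) : ℂ)
        * u (p.1 + 2, p.2 - 1)
      - ((P.κ * P.nbar + P.κp * P.nbarp : ℂ) + Complex.I * P.ω * p.1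
          + P.κ * (2 * P.nbar + 1) * p.1 + 2 * Complex.I * P.ω * p.2
          + P.κp * (2 * P.nbarp + 1) * p.2) * u p
  map_add' u v := by ext p; simp only [Pi.add_apply]; ring
  map_smul' c u := by ext p; simp only [Pi.smul_apply, smul_eq_mul, RingHom.id_apply]; ring

/-- The maximal domain `{u : ∑_{n,m} |k_u(n,m)|² < ∞}`. -/
def domK : Submodule ℂ H where
  carrier := {u | Memℓp (coeffK P (e.repr u)) 2}
  zero_mem' := by
    change Memℓp (coeffK P (e.repr (0 : H))) 2
    rw [map_zero, lp.coeFn_zero, map_zero]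
    exact zero_memℓp
  add_mem' := by
    intro u v hu hv
    change Memℓp (coeffK P (e.repr (u + v))) 2
    rw [map_add, lp.coeFn_add, map_add]
    exact hu.add hv
  smul_mem' := by
    intro c u hu
    change Memℓp (coeffK P (e.repr (c • u))) 2
    rw [map_smul, lp.coeFn_smul, map_smul]
    exact hu.const_smul c

/-- The operator `K` on its maximal domain. -/
def opK : H →ₗ.[ℂ] H := coeffOp e (coeffK P) (domK e P) (fun _ h => h)

/-- The eight channel operators. -/
def opR : Fin 8 → (H →ₗ.[ℂ] H) :=
  ![scal (P.β 0) (opB e), scal (P.α 0) (opA e), scal (P.α 1) (opA e), scal (P.β 1) (opB e),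
    scal (P.β 2) (opB e), scal (P.α 2) (opA e), scal (P.β 3) (opBdag e), scal (P.α 3) (opAdag e)]

/-- The matrix `F` of the model: `F₀₀ = K`, `F_{i0} = R_i`, `F_{0j} = -R_j*` and `F_{ij} = 0`. -/
def oscMatrix [CompleteSpace H] : Fin (8 + 1) → Fin (8 + 1) → (H →ₗ.[ℂ] H) :=
  blockMatrix (opK e P) (opR e P) (fun j => -(opR e P j).adjoint) (fun _ _ => 0)

end Oscillator

section ModelSpace

/-- The Hilbert space `ℓ²(ℕ)`. -/
abbrev Ell2 : Type := lp (fun _ : ℕ => ℂ) 2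

/-- The Hilbert space `ℓ²(ℕ) ⊗ ℓ²(ℕ)` (completed tensor product). -/
abbrev ModelSpace : Type := UniformSpace.Completion (Ell2 ⊗[ℂ] Ell2)

/-- The canonical basis `e_n` of `ℓ²(ℕ)`. -/
def ell2Basis : HilbertBasis ℕ ℂ Ell2 := ⟨LinearIsometryEquiv.refl ℂ Ell2⟩

/-- The vectors `e_{n,m} = e_n ⊗ e_m`. -/
def tensorVec (p : ℕ × ℕ) : ModelSpace :=
  ((ell2Basis p.1 ⊗ₜ[ℂ] ell2Basis p.2 : Ell2 ⊗[ℂ] Ell2) : ModelSpace)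

lemma orthonormal_tensorVec : Orthonormal ℂ tensorVec := by
  rw [orthonormal_iff_ite]
  rintro ⟨n, m⟩ ⟨n', m'⟩
  rw [tensorVec, tensorVec, UniformSpace.Completion.inner_coe, TensorProduct.inner_tmul,
    orthonormal_iff_ite.1 ell2Basis.orthonormal, orthonormal_iff_ite.1 ell2Basis.orthonormal]
  by_cases h1 : n = n' <;> by_cases h2 : m = m' <;> simp [h1, h2]

lemma orthogonal_span_tensorVec : (Submodule.span ℂ (Set.range tensorVec))ᗮ = ⊥ := by
  rw [Submodule.eq_bot_iff]
  intro z hz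
  rw [Submodule.mem_orthogonal'] at hz
  have hz' : ∀ n m, ⟪z, tensorVec (n, m)⟫_ℂ = 0 := fun n m =>
    hz _ (Submodule.subset_span ⟨_, rfl⟩)
  let φ : (Ell2 ⊗[ℂ] Ell2) →L[ℂ] ℂ := (innerSL ℂ z).comp UniformSpace.Completion.toComplL
  have key : ∀ (f : Ell2 →L[ℂ] ℂ), (∀ n, f (ell2Basis n) = 0) → ∀ x, f x = 0 := by
    intro f hf x
    have h := (ell2Basis.hasSum_repr x).mapL f
    simp only [map_smul, hf, smul_zero] at h
    exact h.unique hasSum_zero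
  have h1 : ∀ n y, φ (ell2Basis n ⊗ₜ[ℂ] y) = 0 := fun n y =>
    key (φ.comp (TensorProduct.mkL ℂ Ell2 Ell2 (ell2Basis n))) (fun m => hz' n m) y
  have h2 : ∀ x y, φ (x ⊗ₜ[ℂ] y) = 0 := fun x y =>
    key (φ.comp ((TensorProduct.mkL ℂ Ell2 Ell2).flip y)) (fun n => h1 n y) x
  have h3 : ∀ t, φ t = 0 := by
    intro t
    induction t with
    | zero => exact map_zero φ
    | tmul x y => exact h2 x y
    | add x y hx hy => rw [map_add, hx, hy, add_zero]
  have h4 : ∀ w : ModelSpace, ⟪z, w⟫_ℂ = 0 := by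
    intro w
    induction w using UniformSpace.Completion.induction_on with
    | hp => exact isClosed_eq (by fun_prop) continuous_const
    | ih t => exact h3 t
  exact inner_self_eq_zero.1 (h4 z)

/-- The canonical orthonormal basis `e_{n,m} = e_n ⊗ e_m` of `ℓ²(ℕ) ⊗ ℓ²(ℕ)`. -/
def tensorBasis : HilbertBasis (ℕ × ℕ) ℂ ModelSpace :=
  HilbertBasis.mkOfOrthogonalEqBot orthonormal_tensorVec orthogonal_span_tensorVec

end ModelSpace

end ParamOsc

end

/-! Everything rests on the weight n + 2m. The interaction trades two quanta of the first mode for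
one of the second, so K preserves the weight, while a ladder operator shifts it by 1 or 2; and only
finitely many indices have a given weight. Every entry of the matrix F is the maximal operator
`maxOp` of an infinite matrix with finite columns, and a cut-off in the weight passes through it up
to a fixed offset (`IntertwinesCut`). Hence the truncations of a vector of the domain converge to it
in graph norm (`tendsto_ap_trunc`). This gives the cores, and it shows that the adjoint is the
maximal operator of the conjugate transpose (`maxOp_adjoint`), whence closedness.

K is block diagonal with finite-dimensional dissipative blocks. The exponentials of the blocks are
compatible contractions, and their strong limit is a semigroup whose generator can be read off level
by level; it is therefore the maximal operator (`generates_maxOp`). The same applies to K*.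

The interaction is skew-adjoint and commutes with functions of the weight, and the constraints on
the amplitudes say that the diagonal part of K has real part -½ ∑ R_k* R_k (`sum_occupation`). This
is the dissipation identity. Since κ and κ_p are positive, it also bounds the mean occupation
numbers on Dom K (`maxDom_coeffK_le`), which gives the domain inclusions.

For the last item, C_ε multiplies by f(weight) with f(k) = k⁴ / (1 + ε k⁴)². The loss in K and the
gain in R_k* C_ε R_k cancel, except for differences of f at weights at most 2 apart multiplied by a
factor linear in the weight. The decisive estimate is that k |f(k + d) - f(k)| is O(f + 1) uniformly
in ε (`mul_abs_reg_sub_le`). The off-diagonal terms combine to commutators of C_ε with R_k, which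
obey the same estimate after Cauchy–Schwarz (`commutator_le`). The inequality is proved on the span
and passes to Dom F by truncation (`form_le`). -/

noncomputable section

namespace ParamOsc

open Filter Topology

/-! ### Infinite matrices: transposes and cut-offs in the weight. -/

section Coefficients

/-- Linear maps of families of coefficients. -/
abbrev CoeffMap : Type := (ℕ × ℕ → ℂ) →ₗ[ℂ] (ℕ × ℕ → ℂ)

/-- The conserved weight `n + 2 m`. -/
def wt (p : ℕ × ℕ) : ℕ := p.1 + 2 * p.2

/-- Cut-off of a family of coefficients to the indices of weight at most `n`. -/
def cut (n : ℕ) (u : ℕ × ℕ → ℂ) : ℕ × ℕ → ℂ := fun p => if wt p ≤ n then u p else 0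

/-- `L` has finite columns, and `L'` is its conjugate transpose. -/
def FormalAdj (L L' : CoeffMap) : Prop :=
  ∀ p, ∃ c : ℕ × ℕ →₀ ℂ, L (Pi.single p 1) = c ∧
    ∀ v, L' v p = c.sum fun q z => (starRingEnd ℂ) z * v q

/-- `L` intertwines cut-offs up to fixed offsets. -/
def IntertwinesCut (L : CoeffMap) (s t : ℕ) : Prop :=
  ∀ n u, L (cut (n + s) u) = cut (n + t) (L u)

lemma FormalAdj.add {L M L' M' : CoeffMap} (h : FormalAdj L L') (k : FormalAdj M M') :
    FormalAdj (L + M) (L' + M') := by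
  intro p
  obtain ⟨c, hc, hc'⟩ := h p
  obtain ⟨d, hd, hd'⟩ := k p
  refine ⟨c + d, by simp [hc, hd], fun v => ?_⟩
  rw [Finsupp.sum_add_index' (by simp) (by intros; simp [add_mul]), ← hc', ← hd']
  rfl

lemma FormalAdj.smul {L L' : CoeffMap} (h : FormalAdj L L') (z : ℂ) :
    FormalAdj (z • L) ((starRingEnd ℂ) z • L') := by
  intro p
  obtain ⟨c, hc, hc'⟩ := h p
  refine ⟨z • c, by simp [hc], fun v => ?_⟩
  rw [Finsupp.sum_smul_index (by simp), LinearMap.smul_apply, Pi.smul_apply, hc', Finsupp.smul_sum]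
  simp [mul_assoc]

lemma neg_one_smul_coeffMap (L : CoeffMap) : (-1 : ℂ) • L = -L :=
  LinearMap.ext fun u => funext fun p => by
    simp only [LinearMap.smul_apply, LinearMap.neg_apply, Pi.smul_apply, Pi.neg_apply, smul_eq_mul,
      neg_one_mul]

lemma FormalAdj.neg {L L' : CoeffMap} (h : FormalAdj L L') : FormalAdj (-L) (-L') := by
  have := h.smul (-1)
  rwa [map_neg, map_one, neg_one_smul_coeffMap, neg_one_smul_coeffMap] at this

lemma IntertwinesCut.smul {L : CoeffMap} {s t : ℕ} (h : IntertwinesCut L s t) (z : ℂ) :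
    IntertwinesCut (z • L) s t := by
  intro n u
  ext p
  have := congrFun (h n u) p
  simp only [LinearMap.smul_apply, Pi.smul_apply, this]
  simp [cut]

lemma IntertwinesCut.neg {L : CoeffMap} {s t : ℕ} (h : IntertwinesCut L s t) :
    IntertwinesCut (-L) s t := by
  have := h.smul (-1)
  rwa [neg_one_smul_coeffMap] at this

lemma IntertwinesCut.add {L M : CoeffMap} {s t : ℕ} (h : IntertwinesCut L s t)
    (k : IntertwinesCut M s t) : IntertwinesCut (L + M) s t := by
  intro n u
  ext p
  simp only [LinearMap.add_apply, Pi.add_apply, h n u, k n u]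
  by_cases hp : wt p ≤ n + t <;> simp [cut, hp]

/-- The weighted shift `(L u)_p = w_p u_{σ p}`. -/
def shiftMap (w : ℕ × ℕ → ℝ) (σ : ℕ × ℕ → ℕ × ℕ) : CoeffMap where
  toFun u p := (w p : ℂ) * u (σ p)
  map_add' u v := by ext p; simp [mul_add]
  map_smul' c u := by ext p; simp [mul_left_comm]

/-- Multiplication of the coefficients by a complex weight. -/
def diagMap (d : ℕ × ℕ → ℂ) : CoeffMap where
  toFun u p := d p * u p
  map_add' u v := by ext p; simp [mul_add]
  map_smul' c u := by ext p; simp [mul_left_comm]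

lemma shiftMap_apply (w : ℕ × ℕ → ℝ) (σ : ℕ × ℕ → ℕ × ℕ) (u : ℕ × ℕ → ℂ) (p : ℕ × ℕ) :
    shiftMap w σ u p = (w p : ℂ) * u (σ p) := rfl

lemma diagMap_apply (d : ℕ × ℕ → ℂ) (u : ℕ × ℕ → ℂ) (p : ℕ × ℕ) :
    diagMap d u p = d p * u p := rfl

/-- The hypothesis equates the (q, p) entry of the first matrix with the (p, q) entry of the second;
the weights are real, so no conjugation appears. -/
lemma formalAdj_shiftMap {w w' : ℕ × ℕ → ℝ} {σ σ' : ℕ × ℕ → ℕ × ℕ}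
    (h : ∀ p q, (if σ q = p then w q else 0) = if σ' p = q then w' p else 0) :
    FormalAdj (shiftMap w σ) (shiftMap w' σ') := by
  intro p
  refine ⟨Finsupp.single (σ' p) (w' p : ℂ), ?_, fun v => ?_⟩
  · ext q
    have := h p q
    rw [shiftMap_apply, Finsupp.single_apply, Pi.single_apply]
    rw [mul_ite, mul_one, mul_zero]
    simpa only [apply_ite Complex.ofReal, Complex.ofReal_zero] using congrArg Complex.ofReal this
  · rw [Finsupp.sum_single_index (by simp), shiftMap_apply, Complex.conj_ofReal]

lemma formalAdj_diagMap (d : ℕ × ℕ → ℂ) :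
    FormalAdj (diagMap d) (diagMap fun p => (starRingEnd ℂ) (d p)) := by
  intro p
  refine ⟨Finsupp.single p (d p), ?_, fun v => ?_⟩
  · ext q
    rw [diagMap_apply, Finsupp.single_apply, Pi.single_apply]
    by_cases h1 : p = q
    · simp [h1]
    · simp [h1, Ne.symm h1]
  · rw [Finsupp.sum_single_index (by simp), diagMap_apply]

/-- Only indices with nonzero weight factor matter, so the values of σ at truncated indices (where a
square root vanishes) are irrelevant. The two offsets `s`, `t` avoid a signed shift. -/
lemma intertwinesCut_shiftMap {w : ℕ × ℕ → ℝ} {σ : ℕ × ℕ → ℕ × ℕ} {s t : ℕ}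
    (h : ∀ p, w p ≠ 0 → wt (σ p) + t = wt p + s) : IntertwinesCut (shiftMap w σ) s t := by
  intro n u
  ext p
  by_cases hw : w p = 0
  · simp [shiftMap_apply, cut, hw]
  · have := h p hw
    have h2 : wt (σ p) ≤ n + s ↔ wt p ≤ n + t := by omega
    simp [shiftMap_apply, cut, h2]

lemma intertwinesCut_diagMap (d : ℕ × ℕ → ℂ) : IntertwinesCut (diagMap d) 0 0 := by
  intro n u
  ext p
  simp [diagMap_apply, cut]

end Coefficients

/-! ### Maximal operators: graph, truncation, adjoint. -/

section Operators

variable {H : Type*} [NormedAddCommGroup H] [InnerProductSpace ℂ H]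

lemma ap_of_mem {T : H →ₗ.[ℂ] H} {u : H} (h : u ∈ T.domain) : ap T u = T ⟨u, h⟩ := dif_pos h

lemma mem_graph_iff_ap {T : H →ₗ.[ℂ] H} {u v : H} :
    (u, v) ∈ T.graph ↔ u ∈ T.domain ∧ ap T u = v := by
  rw [LinearPMap.mem_graph_iff]
  constructor
  · rintro ⟨y, rfl, rfl⟩
    exact ⟨y.2, ap_of_mem y.2⟩
  · rintro ⟨h, rfl⟩
    exact ⟨⟨u, h⟩, rfl, (ap_of_mem h).symm⟩

lemma ap_neg (T : H →ₗ.[ℂ] H) (u : H) : ap (-T) u = -ap T u := by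
  by_cases h : u ∈ T.domain
  · rw [ap_of_mem h, ap_of_mem (T := -T) h]; rfl
  · rw [ap, ap, dif_neg h, dif_neg (show u ∉ (-T).domain from h), neg_zero]

lemma ap_zero (u : H) : ap (0 : H →ₗ.[ℂ] H) u = 0 := by
  rw [ap_of_mem (T := (0 : H →ₗ.[ℂ] H)) (u := u) trivial]; rfl

/-- A subspace on which a closed operator is approximated in graph norm is a core. -/
lemma hasCore_of_tendsto {T : H →ₗ.[ℂ] H} (hT : T.IsClosed) {D : Submodule ℂ H}
    (hD : D ≤ T.domain)
    (h : ∀ u ∈ T.domain, ∃ x : ℕ → H, (∀ n, x n ∈ D) ∧ Tendsto x atTop (𝓝 u) ∧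
      Tendsto (fun n => ap T (x n)) atTop (𝓝 (ap T u))) : T.HasCore D := by
  have hle : T.domRestrict D ≤ T := LinearPMap.domRestrict_le
  have hcl : (T.domRestrict D).IsClosable := hT.isClosable.leIsClosable hle
  refine ⟨hD, LinearPMap.eq_of_eq_graph ?_⟩
  rw [← hcl.graph_closure_eq_closure_graph]
  apply le_antisymm
  · exact Submodule.topologicalClosure_minimal _ (LinearPMap.le_graph_of_le hle) hT
  · rintro ⟨u, v⟩ huv
    rw [mem_graph_iff_ap] at huv
    obtain ⟨hu, rfl⟩ := huv
    obtain ⟨x, hx, h1, h2⟩ := h u hu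
    refine mem_closure_of_tendsto (h1.prodMk_nhds h2) (Eventually.of_forall fun n => ?_)
    have hm : x n ∈ (T.domRestrict D).domain := ⟨hx n, hD (hx n)⟩
    change (x n, ap T (x n)) ∈ (T.domRestrict D).graph
    rw [mem_graph_iff_ap]
    refine ⟨hm, ?_⟩
    rw [ap_of_mem hm, ap_of_mem (hD (hx n))]
    exact LinearPMap.domRestrict_apply rfl

lemma mem_adjoint_graph_iff [CompleteSpace H] {T : H →ₗ.[ℂ] H} (hT : Dense (T.domain : Set H))
    {v w : H} : (v, w) ∈ T.adjoint.graph ↔ ∀ u ∈ T.domain, ⟪ap T u, v⟫_ℂ = ⟪u, w⟫_ℂ := by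
  rw [mem_graph_iff_ap]
  constructor
  · rintro ⟨hv, rfl⟩ u hu
    rw [ap_of_mem hv, ap_of_mem hu]
    have := LinearPMap.adjoint_isFormalAdjoint hT ⟨v, hv⟩ ⟨u, hu⟩
    rw [← inner_conj_symm, ← inner_conj_symm u]
    exact congrArg _ this.symm
  · intro h
    have h' : ∀ x : T.domain, ⟪w, (x : H)⟫_ℂ = ⟪v, T x⟫_ℂ := by
      rintro ⟨u, hu⟩
      rw [← ap_of_mem hu, ← inner_conj_symm, ← inner_conj_symm v, h u hu]
    have hv := LinearPMap.mem_adjoint_domain_of_exists (T := T) v ⟨w, h'⟩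
    exact ⟨hv, (ap_of_mem hv).trans (LinearPMap.adjoint_apply_eq hT ⟨v, hv⟩ h')⟩

variable (e : HilbertBasis (ℕ × ℕ) ℂ H)

lemma spanBasis_dense : Dense (spanBasis e : Set H) := by
  have := e.dense_span
  rw [Submodule.dense_iff_topologicalClosure_eq_top]
  exact this

lemma ext_repr {u v : H} (h : ∀ p, e.repr u p = e.repr v p) : u = v :=
  e.repr.injective (Subtype.ext (funext h))

lemma basis_mem (p : ℕ × ℕ) : e p ∈ spanBasis e := Submodule.subset_span ⟨p, rfl⟩

lemma repr_basis (p : ℕ × ℕ) : (e.repr (e p) : ℕ × ℕ → ℂ) = Pi.single p 1 := by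
  classical
  rw [HilbertBasis.repr_self]
  ext q
  rw [lp.single_apply]

/-- The indices of weight at most `n`. -/
def levels (n : ℕ) : Finset (ℕ × ℕ) :=
  (Finset.range (n + 1) ×ˢ Finset.range (n + 1)).filter fun p => wt p ≤ n

lemma mem_levels {n : ℕ} {p : ℕ × ℕ} : p ∈ levels n ↔ wt p ≤ n := by
  rw [levels, Finset.mem_filter, Finset.mem_product, Finset.mem_range, Finset.mem_range, wt]
  omega

lemma tendsto_levels : Tendsto levels atTop atTop := by
  refine tendsto_atTop_finset_of_monotone (fun m n h p hp => ?_) fun p => ⟨wt p, mem_levels.2 le_rfl⟩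
  exact mem_levels.2 ((mem_levels.1 hp).trans h)

/-- The projection on the span of the basis vectors of weight at most `n`. -/
def trunc (n : ℕ) : H →L[ℂ] H := ∑ p ∈ levels n, (innerSL ℂ (e p)).smulRight (e p)

lemma trunc_apply (n : ℕ) (u : H) : trunc e n u = ∑ p ∈ levels n, e.repr u p • e p := by
  simp [trunc, HilbertBasis.repr_apply_apply]

lemma trunc_mem (n : ℕ) (u : H) : trunc e n u ∈ spanBasis e := by
  rw [trunc_apply]
  exact Submodule.sum_mem _ fun p _ => Submodule.smul_mem _ _ (basis_mem e p)

lemma tendsto_trunc (u : H) : Tendsto (fun n => trunc e n u) atTop (𝓝 u) := by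
  simp only [trunc_apply]
  exact (e.hasSum_repr u).comp tendsto_levels

lemma repr_trunc (n : ℕ) (u : H) : (e.repr (trunc e n u) : ℕ × ℕ → ℂ) = cut n (e.repr u) := by
  classical
  ext q
  rw [trunc_apply, map_sum, lp.coeFn_sum, Finset.sum_apply]
  simp only [map_smul, lp.coeFn_smul, Pi.smul_apply, repr_basis, Pi.single_apply, smul_eq_mul,
    mul_ite, mul_one, mul_zero]
  rw [Finset.sum_ite_eq]
  simp [mem_levels, cut]

/-- The maximal domain of the operator with coefficient map `L`. -/
def maxDom (L : CoeffMap) : Submodule ℂ H where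
  carrier := {u | Memℓp (L (e.repr u)) 2}
  zero_mem' := by
    change Memℓp (L (e.repr (0 : H))) 2
    rw [map_zero, lp.coeFn_zero, map_zero]
    exact zero_memℓp
  add_mem' := by
    intro u v hu hv
    change Memℓp (L (e.repr (u + v))) 2
    rw [map_add, lp.coeFn_add, map_add]
    exact hu.add hv
  smul_mem' := by
    intro c u hu
    change Memℓp (L (e.repr (c • u))) 2
    rw [map_smul, lp.coeFn_smul, map_smul]
    exact hu.const_smul c

/-- The operator with coefficient map `L` on its maximal domain. -/
def maxOp (L : CoeffMap) : H →ₗ.[ℂ] H := coeffOp e L (maxDom e L) fun _ h => h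

lemma mem_maxDom {L : CoeffMap} {u : H} : u ∈ maxDom e L ↔ Memℓp (L (e.repr u)) 2 := Iff.rfl

lemma repr_ap_maxOp {L : CoeffMap} {u : H} (hu : u ∈ maxDom e L) :
    (e.repr (ap (maxOp e L) u) : ℕ × ℕ → ℂ) = L (e.repr u) := by
  rw [ap_of_mem (T := maxOp e L) hu]
  change (e.repr (e.repr.symm ⟨L (e.repr u), hu⟩) : ℕ × ℕ → ℂ) = _
  rw [LinearIsometryEquiv.apply_symm_apply]

/-- The coefficients of `v` are square summable anyway, so the domain condition on `u` is automatic
and the graph is cut out by the coefficient equation alone. -/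
lemma mem_graph_maxOp {L : CoeffMap} {u v : H} :
    (u, v) ∈ (maxOp e L).graph ↔ (e.repr v : ℕ × ℕ → ℂ) = L (e.repr u) := by
  rw [mem_graph_iff_ap]
  constructor
  · rintro ⟨h, rfl⟩
    exact repr_ap_maxOp e h
  · intro h
    have hu : u ∈ maxDom e L := by
      rw [mem_maxDom, ← h]
      exact lp.memℓp (e.repr v)
    refine ⟨hu, ext_repr e fun p => ?_⟩
    rw [repr_ap_maxOp e hu, h]

lemma eq_maxOp {T : H →ₗ.[ℂ] H} {L : CoeffMap}
    (h : ∀ u v, (u, v) ∈ T.graph ↔ (e.repr v : ℕ × ℕ → ℂ) = L (e.repr u)) : T = maxOp e L :=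
  LinearPMap.eq_of_eq_graph (by ext ⟨u, v⟩; rw [h, mem_graph_maxOp])

lemma coeffOp_eq_maxOp {L : CoeffMap} {dom : Submodule ℂ H}
    (h : ∀ u ∈ dom, Memℓp (L (e.repr u)) 2) (hmax : maxDom e L ≤ dom) :
    coeffOp e L dom h = maxOp e L := by
  obtain rfl : dom = maxDom e L := le_antisymm h hmax
  rfl

lemma neg_maxOp (L : CoeffMap) : -maxOp e L = maxOp e (-L) := by
  refine eq_maxOp e fun u v => ?_
  have : (u, v) ∈ (-maxOp e L).graph ↔ (u, -v) ∈ (maxOp e L).graph := by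
    rw [mem_graph_iff_ap, mem_graph_iff_ap, ap_neg, neg_eq_iff_eq_neg]
    rfl
  rw [this, mem_graph_maxOp, map_neg, lp.coeFn_neg, LinearMap.neg_apply, neg_eq_iff_eq_neg]

lemma zero_eq_maxOp : (0 : H →ₗ.[ℂ] H) = maxOp e 0 := by
  refine eq_maxOp e fun u v => ?_
  rw [mem_graph_iff_ap, ap_zero, LinearMap.zero_apply]
  constructor
  · rintro ⟨-, rfl⟩
    rw [map_zero, lp.coeFn_zero]
  · intro h
    exact ⟨trivial, ext_repr e fun p => by rw [h, map_zero, lp.coeFn_zero]⟩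

/-- The convention for the scalar 0 is exactly what makes this uniform in `c`: the maximal operator
of the zero matrix is everywhere defined. -/
lemma scal_maxOp (c : ℂ) (L : CoeffMap) : scal c (maxOp e L) = maxOp e (c • L) := by
  by_cases hc : c = 0
  · rw [scal, if_pos hc, hc, zero_smul, zero_eq_maxOp e]
  rw [scal, if_neg hc]
  refine eq_maxOp e fun u v => ?_
  have : (u, v) ∈ (c • maxOp e L).graph ↔ (u, c⁻¹ • v) ∈ (maxOp e L).graph := by
    rw [LinearPMap.mem_graph_iff, LinearPMap.mem_graph_iff]
    refine exists_congr fun y => and_congr_right fun _ => ?_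
    change c • maxOp e L y = v ↔ _
    rw [eq_inv_smul_iff₀ hc]
  rw [this, mem_graph_maxOp, map_smul, lp.coeFn_smul, LinearMap.smul_apply, inv_smul_eq_iff₀ hc]

lemma spanBasis_le_maxDom {L L' : CoeffMap} (h : FormalAdj L L') : spanBasis e ≤ maxDom e L := by
  refine Submodule.span_le.2 ?_
  rintro _ ⟨p, rfl⟩
  obtain ⟨c, hc, -⟩ := h p
  change Memℓp (L (e.repr (e p))) 2
  rw [repr_basis, hc, memlp_two_iff]
  refine summable_of_hasFiniteSupport (c.hasFiniteSupport.subset fun q hq => ?_)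
  intro h0
  simp [h0] at hq

/-- A column is finite, so the image of a basis vector is a finite combination of basis vectors, and
pairing with it is one row of the conjugate transpose. -/
lemma ap_maxOp_basis_inner {L L' : CoeffMap} (h : FormalAdj L L') (p : ℕ × ℕ) (v : H) :
    ⟪ap (maxOp e L) (e p), v⟫_ℂ = L' (e.repr v) p := by
  obtain ⟨c, hc, hc'⟩ := h p
  have key : ap (maxOp e L) (e p) = c.sum fun q z => z • e q := by
    refine ext_repr e fun r => ?_
    rw [repr_ap_maxOp e (spanBasis_le_maxDom e h (basis_mem e p)), repr_basis, hc, Finsupp.sum,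
      map_sum, lp.coeFn_sum, Finset.sum_apply]
    simp [repr_basis, Pi.single_apply]
  rw [key, hc', Finsupp.sum_inner]
  simp [HilbertBasis.repr_apply_apply, inner_smul_left]

lemma trunc_mem_maxDom {L L' : CoeffMap} (h : FormalAdj L L') (n : ℕ) (u : H) :
    trunc e n u ∈ maxDom e L := spanBasis_le_maxDom e h (trunc_mem e n u)

/-- Graph-norm approximation comes from here: truncating the argument amounts to truncating the
image, at a level with a fixed offset. -/
lemma ap_trunc {L L' : CoeffMap} (h : FormalAdj L L') {s t : ℕ} (hs : IntertwinesCut L s t)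
    {u : H} (hu : u ∈ maxDom e L) (n : ℕ) :
    ap (maxOp e L) (trunc e (n + s) u) = trunc e (n + t) (ap (maxOp e L) u) := by
  refine ext_repr e fun p => ?_
  rw [repr_ap_maxOp e (trunc_mem_maxDom e h _ _), repr_trunc, hs, repr_trunc, repr_ap_maxOp e hu]

lemma tendsto_ap_trunc {L L' : CoeffMap} (h : FormalAdj L L') {s t : ℕ}
    (hs : IntertwinesCut L s t) {u : H} (hu : u ∈ maxDom e L) :
    Tendsto (fun n => ap (maxOp e L) (trunc e n u)) atTop (𝓝 (ap (maxOp e L) u)) := by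
  rw [← tendsto_add_atTop_iff_nat s]
  simp only [ap_trunc e h hs hu]
  exact (tendsto_add_atTop_iff_nat t).2 (tendsto_trunc e (ap (maxOp e L) u))

lemma maxDom_dense {L L' : CoeffMap} (h : FormalAdj L L') : Dense (maxDom e L : Set H) :=
  (spanBasis_dense e).mono (spanBasis_le_maxDom e h)

/-- Testing an element of the adjoint on basis vectors yields its coefficients. Conversely, the
adjoint relation holds on basis vectors, hence on the span, and graph-norm convergence of
truncations carries it to the whole maximal domain. -/
lemma maxOp_adjoint [CompleteSpace H] {L L' : CoeffMap} (h : FormalAdj L L') {s t : ℕ}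
    (hs : IntertwinesCut L s t) : (maxOp e L).adjoint = maxOp e L' := by
  refine eq_maxOp e fun v w => ?_
  rw [mem_adjoint_graph_iff (maxDom_dense e h)]
  have hb : ∀ p (w : H), ⟪e p, w⟫_ℂ = e.repr w p := fun p w => (e.repr_apply_apply w p).symm
  constructor
  · intro H0
    ext p
    rw [← ap_maxOp_basis_inner e h, H0 _ (spanBasis_le_maxDom e h (basis_mem e p)), hb]
  · intro H0 u hu
    refine tendsto_nhds_unique ((tendsto_ap_trunc e h hs hu).inner tendsto_const_nhds) ?_
    refine ((tendsto_trunc e u).inner tendsto_const_nhds).congr fun n => ?_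
    have : ∀ x ∈ spanBasis e, ⟪x, w⟫_ℂ = ⟪ap (maxOp e L) x, v⟫_ℂ := by
      intro x hx
      have hx' := spanBasis_le_maxDom e h hx
      induction hx using Submodule.span_induction with
      | mem x hx =>
        obtain ⟨p, rfl⟩ := hx
        rw [ap_maxOp_basis_inner e h, hb, H0]
      | zero => 
        rw [ap_of_mem (T := maxOp e L) hx', inner_zero_left, eq_comm]
        exact (congrArg (⟪·, v⟫_ℂ) (maxOp e L).map_zero).trans (inner_zero_left v)
      | add x y hx hy ihx ihy =>
        have hx := spanBasis_le_maxDom e h hx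
        have hy := spanBasis_le_maxDom e h hy
        rw [inner_add_left, ihx hx, ihy hy, ← inner_add_left, ap_of_mem (T := maxOp e L) hx,
          ap_of_mem (T := maxOp e L) hy, ap_of_mem (T := maxOp e L) hx', ← LinearPMap.map_add]
        rfl
      | smul c x hx ihx =>
        have hx := spanBasis_le_maxDom e h hx
        rw [inner_smul_left, ihx hx, ← inner_smul_left, ap_of_mem (T := maxOp e L) hx,
          ap_of_mem (T := maxOp e L) hx', ← LinearPMap.map_smul]
        rfl
    exact this _ (trunc_mem e n u)

lemma maxOp_isClosed [CompleteSpace H] {L L' : CoeffMap} (h : FormalAdj L' L) {s t : ℕ}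
    (hs : IntertwinesCut L' s t) : (maxOp e L).IsClosed := by
  rw [← maxOp_adjoint e h hs]
  exact LinearPMap.adjoint_isClosed (maxDom_dense e h)

end Operators

/-! ### Contraction semigroups generated by block diagonal operators. -/

section Generation

variable {H : Type*} [NormedAddCommGroup H] [InnerProductSpace ℂ H]
  (e : HilbertBasis (ℕ × ℕ) ℂ H) (L : CoeffMap)

/-- The restriction of `maxOp e L` to the levels of weight at most `n`. -/
def blk (n : ℕ) : H →L[ℂ] H :=
  ∑ p ∈ levels n, (innerSL ℂ (e p)).smulRight (ap (maxOp e L) (e p))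

lemma cut_cut {m n : ℕ} (h : m ≤ n) (u : ℕ × ℕ → ℂ) : cut m (cut n u) = cut m u := by
  ext p
  by_cases hp : wt p ≤ m
  · simp [cut, hp, hp.trans h]
  · simp [cut, hp]

lemma cut_cut' {m n : ℕ} (h : m ≤ n) (u : ℕ × ℕ → ℂ) : cut n (cut m u) = cut m u := by
  ext p
  by_cases hp : wt p ≤ m
  · simp [cut, hp, hp.trans h]
  · simp [cut, hp]

lemma norm_trunc_sub_tendsto (u : H) : Tendsto (fun n => ‖u - trunc e n u‖) atTop (𝓝 0) := by
  have := ((tendsto_trunc e u).const_sub u).norm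
  rwa [sub_self, norm_zero] at this

variable {L} {L' : CoeffMap}

lemma repr_blk (h : FormalAdj L L') (n : ℕ) (u : H) :
    (e.repr (blk e L n u) : ℕ × ℕ → ℂ) = L (cut n (e.repr u)) := by
  have h1 : blk e L n u = ∑ p ∈ levels n, e.repr u p • ap (maxOp e L) (e p) := by
    simp [blk, HilbertBasis.repr_apply_apply]
  have h2 : (cut n (e.repr u) : ℕ × ℕ → ℂ) = ∑ p ∈ levels n, e.repr u p • Pi.single p 1 := by
    rw [← repr_trunc, trunc_apply, map_sum, lp.coeFn_sum]
    simp [repr_basis]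
  rw [h1, h2, map_sum, map_sum, lp.coeFn_sum]
  refine Finset.sum_congr rfl fun p _ => ?_
  rw [map_smul, map_smul, lp.coeFn_smul,
    repr_ap_maxOp e (spanBasis_le_maxDom e h (basis_mem e p)), repr_basis]

lemma blk_eq (h : FormalAdj L L') (n : ℕ) (u : H) :
    blk e L n u = ap (maxOp e L) (trunc e n u) := by
  refine ext_repr e fun p => ?_
  rw [repr_blk e h, repr_ap_maxOp e (trunc_mem_maxDom e h n u), repr_trunc]

variable (h : FormalAdj L L') (hs : IntertwinesCut L 0 0)
include h hs

lemma trunc_blk {m n : ℕ} (hmn : m ≤ n) (u : H) : trunc e m (blk e L n u) = blk e L m u := by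
  refine ext_repr e fun p => ?_
  have h1 := hs m (e.repr u)
  have h2 := hs n (e.repr u)
  simp only [add_zero] at h1 h2
  rw [repr_trunc, repr_blk e h, repr_blk e h, h1, h2, cut_cut hmn]

omit hs in
lemma blk_trunc {m n : ℕ} (hmn : m ≤ n) (u : H) : blk e L n (trunc e m u) = blk e L m u := by
  refine ext_repr e fun p => ?_
  rw [repr_blk e h, repr_blk e h, repr_trunc, cut_cut' hmn]

lemma blk_blk {m n : ℕ} (hmn : m ≤ n) (u : H) :
    blk e L m (blk e L n u) = blk e L n (blk e L m u) := by
  refine ext_repr e fun p => ?_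
  have h1 := hs m (e.repr u)
  have h2 := hs n (e.repr u)
  simp only [add_zero] at h1 h2
  rw [repr_blk e h, repr_blk e h, repr_blk e h, repr_blk e h, h1, h2, cut_cut hmn, cut_cut' hmn]

/-- The block is compressed on both sides by the symmetric `trunc e n`, so its form at `u` is the
form of the operator at the truncation of `u`. -/
lemma re_inner_blk_nonpos (hd : ∀ u ∈ spanBasis e, (⟪ap (maxOp e L) u, u⟫_ℂ).re ≤ 0) (n : ℕ)
    (u : H) : (⟪blk e L n u, u⟫_ℂ).re ≤ 0 := by
  have h1 : ∀ x y : H, ⟪trunc e n x, y⟫_ℂ = ⟪x, trunc e n y⟫_ℂ := by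
    intro x y
    rw [trunc_apply, trunc_apply, sum_inner, inner_sum]
    refine Finset.sum_congr rfl fun p _ => ?_
    rw [inner_smul_left, inner_smul_right, HilbertBasis.repr_apply_apply,
      HilbertBasis.repr_apply_apply, inner_conj_symm, mul_comm]
  rw [← trunc_blk e h hs le_rfl, h1, blk_eq e h]
  exact hd _ (trunc_mem e n u)

omit h hs

variable [CompleteSpace H]

/-- The semigroup generated by a bounded operator. -/
def expOp (B : H →L[ℂ] H) (t : ℝ) : H →L[ℂ] H := NormedSpace.exp (t • B)

lemma expOp_zero (B : H →L[ℂ] H) : expOp B 0 = 1 := by simp [expOp]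

lemma expOp_add (B : H →L[ℂ] H) (s t : ℝ) : expOp B (s + t) = expOp B s * expOp B t := by
  let +nondep : NormedAlgebra ℚ (H →L[ℂ] H) := .restrictScalars ℚ ℂ _
  rw [expOp, add_smul]
  exact NormedSpace.exp_add_of_commute (((Commute.refl B).smul_left s).smul_right t)

lemma hasDerivAt_expOp (B : H →L[ℂ] H) (u : H) (t : ℝ) :
    HasDerivAt (fun t => expOp B t u) (B (expOp B t u)) t :=
  ((ContinuousLinearMap.apply ℂ H u).restrictScalars ℝ).hasFDerivAt.comp_hasDerivAt t
    (hasDerivAt_exp_smul_const' (𝕂 := ℝ) B t)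

lemma expOp_comm {B A : H →L[ℂ] H} (hc : Commute A B) (t : ℝ) (u : H) :
    A (expOp B t u) = expOp B t (A u) := by
  have : Commute A (expOp B t) := (hc.smul_right t).exp_right
  exact congrArg (fun C : H →L[ℂ] H => C u) this.eq

lemma expOp_of_apply_eq_zero {B : H →L[ℂ] H} {u : H} (hu : B u = 0) (t : ℝ) :
    expOp B t u = u := by
  have hd : ∀ s, HasDerivAt (fun t => expOp B t u) 0 s := fun s => by
    have := hasDerivAt_expOp B u s
    rwa [expOp_comm (Commute.refl B), hu, map_zero] at this
  have := is_const_of_deriv_eq_zero (fun s => (hd s).differentiableAt) (fun s => (hd s).deriv) t 0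
  simpa [expOp_zero] using this

/-- The derivative of the squared norm along the orbit is twice the real part of the form of `B`,
hence nonpositive. -/
lemma norm_expOp_le {B : H →L[ℂ] H} (hB : ∀ u, (⟪B u, u⟫_ℂ).re ≤ 0) {t : ℝ} (ht : 0 ≤ t) (u : H) :
    ‖expOp B t u‖ ≤ ‖u‖ := by
  have hd : ∀ s, HasDerivAt (fun t => ‖expOp B t u‖ ^ 2)
      (2 * (⟪B (expOp B s u), expOp B s u⟫_ℂ).re) s := fun s => by
    let : InnerProductSpace ℝ H := InnerProductSpace.complexToReal
    have := (hasDerivAt_expOp B u s).norm_sq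
    rwa [real_inner_comm] at this
  have hanti : Antitone fun t => ‖expOp B t u‖ ^ 2 :=
    antitone_of_deriv_nonpos (fun s => (hd s).differentiableAt) fun s => by
      rw [(hd s).deriv]
      linarith [hB (expOp B s u)]
  have := hanti ht
  simp only [expOp_zero, one_apply_eq_self] at this
  exact (sq_le_sq₀ (norm_nonneg _) (norm_nonneg _)).1 this

include h hs

/-- The larger block is the smaller one plus a commuting remainder that annihilates the range of
`trunc e m`; the exponential of the remainder therefore acts there as the identity. -/
lemma expOp_blk_trunc {m n : ℕ} (hmn : m ≤ n) (t : ℝ) (u : H) :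
    expOp (blk e L n) t (trunc e m u) = expOp (blk e L m) t (trunc e m u) := by
  let +nondep : NormedAlgebra ℚ (H →L[ℂ] H) := .restrictScalars ℚ ℂ _
  have hc : Commute (blk e L m) (blk e L n - blk e L m) :=
    Commute.sub_right (ContinuousLinearMap.ext fun u => blk_blk e h hs hmn u) (Commute.refl _)
  have h1 : expOp (blk e L n) t = expOp (blk e L m) t * expOp (blk e L n - blk e L m) t := by
    rw [expOp, expOp, expOp,
      ← NormedSpace.exp_add_of_commute ((hc.smul_left t).smul_right t), ← smul_add,
      add_sub_cancel]
  rw [h1, mul_apply_eq_comp, expOp_of_apply_eq_zero (u := trunc e m u)]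
  rw [sub_apply, blk_trunc e h hmn, blk_trunc e h le_rfl, sub_self]

lemma trunc_expOp_blk_of_le {m n : ℕ} (hmn : m ≤ n) (t : ℝ) (u : H) :
    trunc e m (expOp (blk e L n) t u) = expOp (blk e L m) t (trunc e m u) := by
  rw [← expOp_blk_trunc e h hs hmn]
  refine expOp_comm (ContinuousLinearMap.ext fun u => ?_) t u
  exact (trunc_blk e h hs hmn u).trans (blk_trunc e h hmn u).symm

/-- A dissipative operator which is block diagonal with respect to the levels, taken on its maximal
domain, generates a contraction semigroup. -/
theorem generates_maxOp (hd : ∀ u ∈ spanBasis e, (⟪ap (maxOp e L) u, u⟫_ℂ).re ≤ 0) :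
    GeneratesContractionSemigroup (maxOp e L) := by
  have hcon : ∀ n {t : ℝ}, 0 ≤ t → ∀ u, ‖expOp (blk e L n) t u‖ ≤ ‖u‖ := fun n t ht u =>
    norm_expOp_le (re_inner_blk_nonpos e h hs hd n) ht u
  -- The two exponentials agree on the truncation of `u` and contract the rest, so the bound is
  -- uniform in time.
  have hdiff : ∀ {m n : ℕ}, m ≤ n → ∀ {t : ℝ}, 0 ≤ t → ∀ u,
      ‖expOp (blk e L n) t u - expOp (blk e L m) t u‖ ≤ 2 * ‖u - trunc e m u‖ := by
    intro m n hmn t ht u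
    have : expOp (blk e L n) t u - expOp (blk e L m) t u
        = expOp (blk e L n) t (u - trunc e m u) - expOp (blk e L m) t (u - trunc e m u) := by
      rw [map_sub, map_sub, expOp_blk_trunc e h hs hmn]
      abel
    rw [this]
    refine (norm_sub_le _ _).trans ?_
    linarith [hcon n ht (u - trunc e m u), hcon m ht (u - trunc e m u)]
  -- Negative times are frozen at 0 so that the limit exists for every real time; only times t ≥ 0
  -- are used.
  have hlim : ∀ (t : ℝ) (u : H), ∃ x,
      Tendsto (fun n => expOp (blk e L n) (max t 0) u) atTop (𝓝 x) := by
    intro t u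
    refine cauchySeq_tendsto_of_complete (Metric.cauchySeq_iff'.2 fun ε hε => ?_)
    obtain ⟨N, hN⟩ := ((norm_trunc_sub_tendsto e u).eventually
      (gt_mem_nhds (half_pos hε))).exists
    refine ⟨N, fun n hn => ?_⟩
    rw [dist_eq_norm]
    linarith [hdiff hn (le_max_right t 0) u]
  choose G hG using hlim
  let T : ℝ → (H →L[ℂ] H) := fun t =>
    continuousLinearMapOfTendsto (fun n => expOp (blk e L n) (max t 0)) (tendsto_pi_nhds.2 (hG t))
  have hT : ∀ {t : ℝ}, 0 ≤ t → ∀ u,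
      Tendsto (fun n => expOp (blk e L n) t u) atTop (𝓝 (T t u)) := by
    intro t ht u
    have := hG t u
    rwa [max_eq_left ht] at this
  have hTcon : ∀ {t : ℝ}, 0 ≤ t → ∀ u, ‖T t u‖ ≤ ‖u‖ := fun ht u =>
    le_of_tendsto (hT ht u).norm (Eventually.of_forall fun n => hcon n ht u)
  have hTdiff : ∀ m {t : ℝ}, 0 ≤ t → ∀ u,
      ‖T t u - expOp (blk e L m) t u‖ ≤ 2 * ‖u - trunc e m u‖ := fun m t ht u =>
    le_of_tendsto ((hT ht u).sub_const _).norm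
      ((eventually_ge_atTop m).mono fun n hn => hdiff hn ht u)
  have hTtrunc : ∀ m {t : ℝ}, 0 ≤ t → ∀ u,
      T t (trunc e m u) = expOp (blk e L m) t (trunc e m u) := fun m t ht u =>
    tendsto_nhds_unique (hT ht _) (tendsto_const_nhds.congr' ((eventually_ge_atTop m).mono
      fun n hn => (expOp_blk_trunc e h hs hn t u).symm))
  have htruncT : ∀ m {t : ℝ}, 0 ≤ t → ∀ u, trunc e m (T t u) = T t (trunc e m u) := by
    intro m t ht u
    rw [hTtrunc m ht]
    exact tendsto_nhds_unique (((trunc e m).continuous.tendsto _).comp (hT ht u))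
      (tendsto_const_nhds.congr' ((eventually_ge_atTop m).mono
        fun n hn => (trunc_expOp_blk_of_le e h hs hn t u).symm))
  have hT0 : T 0 = 1 := by
    ext u
    refine tendsto_nhds_unique (hT le_rfl u) ?_
    simp only [expOp_zero]
    exact tendsto_const_nhds
  have hcont : ∀ u, ContinuousOn (fun t => T t u) (Set.Ici 0) := by
    intro u
    refine TendstoUniformlyOn.continuousOn (F := fun n t => expOp (blk e L n) t u) (p := atTop) ?_
      (Frequently.of_forall fun n => Continuous.continuousOn ?_)
    · rw [Metric.tendstoUniformlyOn_iff]
      intro ε hε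
      filter_upwards [(norm_trunc_sub_tendsto e u).eventually (gt_mem_nhds (half_pos hε))]
        with n hn t ht
      rw [dist_eq_norm]
      linarith [hTdiff n ht u]
    · exact continuous_iff_continuousAt.2 fun t => (hasDerivAt_expOp _ u t).continuousAt
  have hforward : ∀ u v, (u, v) ∈ (maxOp e L).graph →
      Tendsto (fun t : ℝ => ((t : ℂ))⁻¹ • (T t u - u)) (𝓝[>] 0) (𝓝 v) := by
    intro u v huv
    rw [mem_graph_iff_ap] at huv
    obtain ⟨hu, huv⟩ := huv
    have hblk : ∀ n, blk e L n (trunc e n u) = trunc e n v := fun n => by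
      rw [blk_trunc e h le_rfl, blk_eq e h, ← huv]
      exact ap_trunc e h hs hu n
    -- Mean value inequality on each level for s ↦ T(s) u_n - s v, whose derivative is T(s) v_n - v;
    -- then n tends to infinity.
    have hest : ∀ {η t : ℝ}, 0 < t → (∀ s, 0 ≤ s → s < t → ‖T s v - v‖ ≤ η) →
        ‖T t u - (t : ℂ) • v - u‖ ≤ η * t := by
      intro η t ht hη
      have hn : ∀ n, ‖T t (trunc e n u) - (t : ℂ) • v - trunc e n u‖
          ≤ (‖v - trunc e n v‖ + η) * t := by
        intro n
        have hder : ∀ s, HasDerivAt (fun s : ℝ => expOp (blk e L n) s (trunc e n u) - s • v)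
            (expOp (blk e L n) s (trunc e n v) - v) s := by
          intro s
          have h1 := hasDerivAt_expOp (blk e L n) (trunc e n u) s
          rw [expOp_comm (Commute.refl _), hblk] at h1
          have h2 := (hasDerivAt_id s).smul_const v
          rw [one_smul] at h2
          exact h1.sub h2
        have := norm_image_sub_le_of_norm_deriv_le_segment'
          (fun s (_ : s ∈ Set.Icc 0 t) => (hder s).hasDerivWithinAt)
          (C := ‖v - trunc e n v‖ + η) (fun s hs' => ?_) t ⟨ht.le, le_rfl⟩
        · simp only [zero_smul, sub_zero, expOp_zero, one_apply_eq_self] at this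
          rw [hTtrunc n ht.le]
          exact this
        · rw [← hTtrunc n hs'.1]
          have h3 : T s (trunc e n v) - v = (T s v - v) - T s (v - trunc e n v) := by
            rw [map_sub]; abel
          rw [h3]
          refine (norm_sub_le _ _).trans ?_
          linarith [hη s hs'.1 hs'.2, hTcon hs'.1 (v - trunc e n v)]
      have hl : Tendsto (fun n => ‖T t (trunc e n u) - (t : ℂ) • v - trunc e n u‖) atTop
          (𝓝 ‖T t u - (t : ℂ) • v - u‖) :=
        (((((T t).continuous.tendsto u).comp (tendsto_trunc e u)).sub_const _).sub
          (tendsto_trunc e u)).norm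
      have hr : Tendsto (fun n => (‖v - trunc e n v‖ + η) * t) atTop (𝓝 ((0 + η) * t)) :=
        ((norm_trunc_sub_tendsto e v).add_const η).mul_const t
      rw [zero_add] at hr
      exact le_of_tendsto_of_tendsto' hl hr hn
    rw [Metric.tendsto_nhds]
    intro ε hε
    have hc0 : Tendsto (fun t => T t v) (𝓝[Set.Ici 0] 0) (𝓝 v) := by
      have := hcont v 0 Set.self_mem_Ici
      rwa [ContinuousWithinAt, hT0, one_apply_eq_self] at this
    have hev := Metric.tendsto_nhds.1 hc0 (ε / 2) (half_pos hε)
    rw [eventually_nhdsWithin_iff, Metric.eventually_nhds_iff] at hev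
    obtain ⟨τ, hτ, hev⟩ := hev
    filter_upwards [Ioo_mem_nhdsGT hτ] with t ht
    have h1 := hest (η := ε / 2) ht.1 fun s hs0 hst => by
      rw [← dist_eq_norm]
      refine (hev ?_ hs0).le
      rw [Real.dist_eq, sub_zero, abs_of_nonneg hs0]
      exact hst.trans ht.2
    have ht0 : (t : ℂ) ≠ 0 := Complex.ofReal_ne_zero.2 ht.1.ne'
    have h2 : (t : ℂ)⁻¹ • (T t u - u) - v = (t : ℂ)⁻¹ • (T t u - (t : ℂ) • v - u) := by
      rw [sub_right_comm, smul_sub _ (T t u - u), smul_smul, inv_mul_cancel₀ ht0, one_smul]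
    rw [dist_eq_norm, h2, norm_smul, norm_inv, Complex.norm_real, Real.norm_of_nonneg ht.1.le]
    calc t⁻¹ * ‖T t u - (t : ℂ) • v - u‖ ≤ t⁻¹ * (ε / 2 * t) := by
          have := inv_nonneg.2 ht.1.le
          gcongr
      _ = ε / 2 := by field_simp [ht.1.ne']
      _ < ε := by linarith
  refine ⟨T, hT0, ?_, ?_, hcont, fun u v => ⟨hforward u v, fun huv => ?_⟩⟩
  · intro s t hs0 ht0
    ext u
    refine tendsto_nhds_unique (hT (add_nonneg hs0 ht0) u) ?_
    -- A contraction does not amplify the error of the inner limit, so the products converge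
    -- strongly to the product of the limits.
    have h1 : Tendsto (fun n => expOp (blk e L n) s (expOp (blk e L n) t u - T t u)) atTop
        (𝓝 0) := by
      refine squeeze_zero_norm (fun n => hcon n hs0 _) ?_
      have := ((hT ht0 u).sub_const (T t u)).norm
      rwa [sub_self, norm_zero] at this
    have h2 := h1.add (hT hs0 (T t u))
    rw [zero_add] at h2
    refine h2.congr fun n => ?_
    rw [map_sub, sub_add_cancel, expOp_add]
    rfl
  · exact fun t ht => ContinuousLinearMap.opNorm_le_bound _ zero_le_one fun u => by
      rw [one_mul]; exact hTcon ht u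
  -- Truncation commutes with the semigroup, and truncated vectors already lie in the domain. So
  -- each truncation of the limit `v` is the block applied to `u`, and level `wt p` determines the
  -- coefficient at `p`.
  · rw [mem_graph_maxOp]
    have key : ∀ m, trunc e m v = blk e L m u := by
      intro m
      have h1 := ((trunc e m).continuous.tendsto v).comp huv
      have h2 := hforward (trunc e m u) (blk e L m u)
        (mem_graph_iff_ap.2 ⟨trunc_mem_maxDom e h m u, (blk_eq e h m u).symm⟩)
      refine tendsto_nhds_unique h1 (h2.congr' ?_)
      filter_upwards [self_mem_nhdsWithin] with t ht
      simp only [Function.comp_apply, map_smul, map_sub]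
      rw [htruncT m (le_of_lt ht)]
    ext p
    have := congrArg (fun x => (e.repr x : ℕ × ℕ → ℂ) p) (key (wt p))
    have h1 := hs (wt p) (e.repr u)
    simp only [add_zero] at h1
    simp only [repr_trunc, repr_blk e h, h1] at this
    simpa [cut] using this

end Generation

/-! ### Difference estimates for the regularized fourth power, uniform in ε. -/

section Regularization

/-- The function `k ↦ k⁴ (1 + ε k⁴)⁻²`. -/
def reg (ε : ℝ) (k : ℕ) : ℝ := (k : ℝ) ^ 4 / (1 + ε * (k : ℝ) ^ 4) ^ 2

lemma reg_nonneg {ε : ℝ} (k : ℕ) : 0 ≤ reg ε k := by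
  unfold reg; positivity

/-- For f(x) = x / (1 + εx)² the difference f(t) - f(s) is (t - s)(1 - xy) / ((1 + x)²(1 + y)²) with
x = εs, y = εt, and |1 - xy| ≤ (1 + x)(1 + y). -/
lemma abs_reg_sub_le {ε : ℝ} (hε : 0 < ε) {j k : ℕ} (hjk : j ≤ k) :
    |reg ε k - reg ε j|
      ≤ ((k : ℝ) ^ 4 - (j : ℝ) ^ 4) / ((1 + ε * (j : ℝ) ^ 4) * (1 + ε * (k : ℝ) ^ 4)) := by
  have hst : (j : ℝ) ^ 4 ≤ (k : ℝ) ^ 4 := by gcongr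
  have hs : (0 : ℝ) ≤ (j : ℝ) ^ 4 := by positivity
  unfold reg
  generalize (j : ℝ) ^ 4 = s at *
  generalize (k : ℝ) ^ 4 = t at *
  have ht : 0 ≤ t := hs.trans hst
  have h1 : 0 < 1 + ε * s := by positivity
  have h2 : 0 < 1 + ε * t := by positivity
  have key : t / (1 + ε * t) ^ 2 - s / (1 + ε * s) ^ 2
      = (t - s) / ((1 + ε * s) * (1 + ε * t))
        * ((1 - ε * s * (ε * t)) / ((1 + ε * s) * (1 + ε * t))) := by
    field_simp
    ring
  rw [key, abs_mul, abs_of_nonneg (div_nonneg (sub_nonneg.2 hst) (by positivity))]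
  refine mul_le_of_le_one_right (div_nonneg (sub_nonneg.2 hst) (by positivity)) ?_
  rw [abs_div, abs_of_pos (mul_pos h1 h2), div_le_one (mul_pos h1 h2), abs_le]
  have : 0 ≤ ε * s := by positivity
  have : 0 ≤ ε * t := by positivity
  have : 0 ≤ ε * s * (ε * t) := by positivity
  constructor <;> nlinarith

/-- A factor linear in the weight times a difference of fourth powers is again of fourth order. Both
endpoints are needed as comparison point, since loss channels lower the weight and gain channels
raise it. -/
lemma mul_abs_reg_sub_le {ε : ℝ} (hε : 0 < ε) {k d : ℕ} (hd : d ≤ 2) :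
    ((k + d : ℕ) : ℝ) * |reg ε (k + d) - reg ε k| ≤ 20000 * reg ε (k + d) ∧
      ((k + d : ℕ) : ℝ) * |reg ε (k + d) - reg ε k| ≤ 20000 * (reg ε k + 1) := by
  have hd' : (d : ℝ) ≤ 2 := by exact_mod_cast hd
  have hd0 : (0 : ℝ) ≤ d := by positivity
  -- At k = 0 the function vanishes while its neighbours do not: this is what the `+ 1` in the
  -- second bound is for.
  rcases Nat.eq_zero_or_pos k with rfl | hk
  · have h0 : reg ε 0 = 0 := by simp [reg]
    have h1 : reg ε d ≤ 16 := by
      unfold reg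
      rw [div_le_iff₀ (by positivity)]
      have : (d : ℝ) ^ 4 ≤ 2 ^ 4 := by gcongr
      have : 0 ≤ ε * (d : ℝ) ^ 4 := by positivity
      nlinarith
    simp only [zero_add, h0, sub_zero, abs_of_nonneg (reg_nonneg d)]
    have := reg_nonneg (ε := ε) d
    constructor <;> nlinarith
  have h := abs_reg_sub_le hε (Nat.le_add_right k d)
  have hk' : (1 : ℝ) ≤ k := by exact_mod_cast hk
  have hnum : ((k + d : ℕ) : ℝ) * (((k + d : ℕ) : ℝ) ^ 4 - (k : ℝ) ^ 4) ≤ 240 * (k : ℝ) ^ 4 := by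
    push_cast
    have a1 : (k : ℝ) + d ≤ 3 * k := by linarith
    -- Since d ≤ 2, the difference is at most 8k³ + 24k² + 32k + 16, and k ≥ 1 makes this at most
    -- 80k³.
    have a2 : ((k : ℝ) + d) ^ 4 - (k : ℝ) ^ 4 ≤ 80 * (k : ℝ) ^ 3 := by
      have e1 : ((k : ℝ) + d) ^ 4 ≤ (k + 2) ^ 4 := by gcongr
      nlinarith [mul_nonneg (sub_nonneg.2 hk') (sub_nonneg.2 hk'), pow_pos (by linarith : (0:ℝ) < k) 2,
        mul_nonneg (sub_nonneg.2 hk') (sq_nonneg (k : ℝ))]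
    have a3 : 0 ≤ ((k : ℝ) + d) ^ 4 - (k : ℝ) ^ 4 := sub_nonneg.2 (by gcongr; linarith)
    calc ((k : ℝ) + d) * (((k : ℝ) + d) ^ 4 - (k : ℝ) ^ 4) ≤ 3 * k * (80 * (k : ℝ) ^ 3) := by gcongr
      _ = _ := by ring
  have ht : ((k + d : ℕ) : ℝ) ^ 4 ≤ 81 * (k : ℝ) ^ 4 := by
    push_cast
    calc ((k : ℝ) + d) ^ 4 ≤ (3 * k) ^ 4 := by gcongr; linarith
      _ = _ := by ring
  have hst : (k : ℝ) ^ 4 ≤ ((k + d : ℕ) : ℝ) ^ 4 := by gcongr; omega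
  have hs0 : (0 : ℝ) ≤ (k : ℝ) ^ 4 := by positivity
  have hmain : ((k + d : ℕ) : ℝ) * |reg ε (k + d) - reg ε k|
      ≤ 240 * (k : ℝ) ^ 4 / ((1 + ε * (k : ℝ) ^ 4) * (1 + ε * ((k + d : ℕ) : ℝ) ^ 4)) := by
    refine (mul_le_mul_of_nonneg_left h (by positivity)).trans ?_
    rw [← mul_div_assoc]
    gcongr
  have hr0 := reg_nonneg (ε := ε) k
  unfold reg at *
  generalize (k : ℝ) ^ 4 = s at *
  generalize ((k + d : ℕ) : ℝ) ^ 4 = t at *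
  have h1 : 0 < 1 + ε * s := by positivity
  have h2 : 0 < 1 + ε * t := by nlinarith
  refine ⟨hmain.trans ?_, hmain.trans ?_⟩
  -- Exchanging the denominators costs 81, because k + d ≤ 3k; the constant 20000 covers 240 · 81 =
  -- 19440.
  · have e1 : 1 + ε * t ≤ 81 * (1 + ε * s) := by nlinarith
    rw [← mul_div_assoc, div_le_div_iff₀ (by positivity) (by positivity)]
    have e2 : 240 * s * (1 + ε * t) ≤ 20000 * t * (1 + ε * s) := by
      calc 240 * s * (1 + ε * t) ≤ 240 * t * (81 * (1 + ε * s)) := by gcongr; linarith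
        _ ≤ _ := by nlinarith [mul_nonneg (hs0.trans hst) h1.le]
    nlinarith [mul_le_mul_of_nonneg_right e2 h2.le]
  · have e1 : 240 * s / ((1 + ε * s) * (1 + ε * t)) ≤ 240 * s / ((1 + ε * s) ^ 2) := by
      rw [sq]; gcongr
    have e2 : 240 * s / ((1 + ε * s) ^ 2) = 240 * (s / ((1 + ε * s) ^ 2)) := by ring
    rw [e2] at e1
    linarith

end Regularization

/-! ### Ladder operators as channels. -/

section Channels

/-- `L` is a weighted shift which changes the weight by a fixed amount and is well behaved with
respect to the regularizations; `N` are the diagonal entries of `L* L`. -/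
structure IsChannel (L L' : CoeffMap) (N : ℕ × ℕ → ℝ) (σ τ : ℕ → ℕ) (c : ℝ) : Prop where
  adj : FormalAdj L L'
  adj' : FormalAdj L' L
  cut : ∃ s t, IntertwinesCut L s t
  cut' : ∃ s t, IntertwinesCut L' s t
  square : ∀ (f : ℕ → ℝ) (u : ℕ × ℕ → ℂ) p,
    L' (fun q => f (wt q) * L u q) p = (N p * f (σ (wt p)) : ℝ) * u p
  comm : ∀ (f : ℕ → ℝ) (u : ℕ × ℕ → ℂ) p, L (fun q => f (wt q) * u q) p = f (τ (wt p)) * L u p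
  const_nonneg : 0 ≤ c
  nonneg : ∀ p, 0 ≤ N p
  -- The first bound controls the imperfect cancellation of gain against loss. The other two control
  -- the commutator with the regularization: one after moving L* L onto the time component, one on
  -- the channel component itself.
  bound_shift : ∀ ε, 0 < ε → ∀ p,
    N p * |reg ε (σ (wt p)) - reg ε (wt p)| ≤ c * (reg ε (wt p) + 1)
  bound_comm_shift : ∀ ε, 0 < ε → ∀ p,
    N p * |reg ε (σ (wt p)) - reg ε (τ (σ (wt p)))| ≤ c * (reg ε (wt p) + 1)
  bound_comm : ∀ ε, 0 < ε → ∀ k, |reg ε k - reg ε (τ k)| ≤ c * (reg ε k + 1)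

lemma IsChannel.smul {L L' : CoeffMap} {N : ℕ × ℕ → ℝ} {σ τ : ℕ → ℕ} {c : ℝ}
    (h : IsChannel L L' N σ τ c) (z : ℂ) :
    IsChannel (z • L) ((starRingEnd ℂ) z • L') (fun p => ‖z‖ ^ 2 * N p) σ τ
      ((1 + ‖z‖ ^ 2) * c) where
  adj := h.adj.smul z
  adj' := by simpa using h.adj'.smul ((starRingEnd ℂ) z)
  cut := by obtain ⟨s, t, hst⟩ := h.cut; exact ⟨s, t, hst.smul z⟩
  cut' := by obtain ⟨s, t, hst⟩ := h.cut'; exact ⟨s, t, hst.smul _⟩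
  square f u p := by
    have h1 : (fun q => (f (wt q) : ℂ) * (z • L) u q) = z • fun q => (f (wt q) : ℂ) * L u q := by
      ext q; simp; ring
    have h2 : (starRingEnd ℂ) z * z = ((‖z‖ ^ 2 : ℝ) : ℂ) := by
      rw [mul_comm, Complex.mul_conj, Complex.normSq_eq_norm_sq]
    rw [h1, LinearMap.smul_apply, map_smul, Pi.smul_apply, Pi.smul_apply, h.square, smul_eq_mul,
      smul_eq_mul, ← mul_assoc, h2]
    push_cast
    ring
  comm f u p := by
    rw [LinearMap.smul_apply, LinearMap.smul_apply, Pi.smul_apply, Pi.smul_apply, h.comm]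
    simp only [smul_eq_mul]
    ring
  const_nonneg := mul_nonneg (by positivity) h.const_nonneg
  nonneg p := mul_nonneg (by positivity) (h.nonneg p)
  bound_shift ε hε p := by
    have h1 := h.bound_shift ε hε p
    have h2 := (mul_nonneg (h.nonneg p) (abs_nonneg _)).trans h1
    nlinarith [mul_le_mul_of_nonneg_left h1 (sq_nonneg ‖z‖)]
  bound_comm_shift ε hε p := by
    have h1 := h.bound_comm_shift ε hε p
    have h2 := (mul_nonneg (h.nonneg p) (abs_nonneg _)).trans h1
    nlinarith [mul_le_mul_of_nonneg_left h1 (sq_nonneg ‖z‖)]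
  bound_comm ε hε k := by
    have h1 := h.bound_comm ε hε k
    have h2 := (abs_nonneg _).trans h1
    nlinarith [mul_nonneg (sq_nonneg ‖z‖) h2]

lemma coeffA_eq : coeffA = shiftMap (fun p => √((p.1 : ℝ) + 1)) fun p => (p.1 + 1, p.2) := rfl

lemma coeffAdag_eq : coeffAdag = shiftMap (fun p => √(p.1 : ℝ)) fun p => (p.1 - 1, p.2) := rfl

lemma coeffB_eq : coeffB = shiftMap (fun p => √((p.2 : ℝ) + 1)) fun p => (p.1, p.2 + 1) := rfl

lemma coeffBdag_eq : coeffBdag = shiftMap (fun p => √(p.2 : ℝ)) fun p => (p.1, p.2 - 1) := rfl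

lemma formalAdj_coeffA : FormalAdj coeffA coeffAdag := by
  rw [coeffA_eq, coeffAdag_eq]
  refine formalAdj_shiftMap ?_
  rintro ⟨n, m⟩ ⟨n', m'⟩
  rcases n with _ | n
  · simp
  · by_cases hn : n' = n <;> by_cases hm : m' = m <;> simp [hn, hm, eq_comm]

lemma formalAdj_coeffAdag : FormalAdj coeffAdag coeffA := by
  rw [coeffA_eq, coeffAdag_eq]
  refine formalAdj_shiftMap ?_
  rintro ⟨n', m'⟩ ⟨n, m⟩
  rcases n with _ | n
  · simp
  · by_cases hn : n' = n <;> by_cases hm : m' = m <;> simp [hn, hm, eq_comm]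

lemma formalAdj_coeffB : FormalAdj coeffB coeffBdag := by
  rw [coeffB_eq, coeffBdag_eq]
  refine formalAdj_shiftMap ?_
  rintro ⟨n, m⟩ ⟨n', m'⟩
  rcases m with _ | m
  · simp
  · by_cases hn : n' = n <;> by_cases hm : m' = m <;> simp [hn, hm, eq_comm]

lemma formalAdj_coeffBdag : FormalAdj coeffBdag coeffB := by
  rw [coeffB_eq, coeffBdag_eq]
  refine formalAdj_shiftMap ?_
  rintro ⟨n', m'⟩ ⟨n, m⟩
  rcases m with _ | m
  · simp
  · by_cases hn : n' = n <;> by_cases hm : m' = m <;> simp [hn, hm, eq_comm]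

lemma intertwinesCut_coeffA : IntertwinesCut coeffA 1 0 := by
  rw [coeffA_eq]
  exact intertwinesCut_shiftMap fun p _ => by simp only [wt]; omega

lemma intertwinesCut_coeffAdag : IntertwinesCut coeffAdag 0 1 := by
  rw [coeffAdag_eq]
  refine intertwinesCut_shiftMap fun p hp => ?_
  have : p.1 ≠ 0 := fun h => hp (by simp [h])
  simp only [wt]; omega

lemma intertwinesCut_coeffB : IntertwinesCut coeffB 2 0 := by
  rw [coeffB_eq]
  exact intertwinesCut_shiftMap fun p _ => by simp only [wt]; omega

lemma intertwinesCut_coeffBdag : IntertwinesCut coeffBdag 0 2 := by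
  rw [coeffBdag_eq]
  refine intertwinesCut_shiftMap fun p hp => ?_
  have : p.2 ≠ 0 := fun h => hp (by simp [h])
  simp only [wt]; omega

lemma sqrt_mul_sqrt_ofReal {x : ℝ} (hx : 0 ≤ x) : ((√x : ℝ) : ℂ) * ((√x : ℝ) : ℂ) = (x : ℂ) := by
  rw [← Complex.ofReal_mul, Real.mul_self_sqrt hx]

/-- The occupation number n is at most the weight, so the bound with the upper endpoint applies. For
n = 0 the weight shift may be truncated, but then its factor n vanishes. -/
lemma isChannel_coeffA : IsChannel coeffA coeffAdag (fun p => p.1) (· - 1) (· + 1) 20000 where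
  adj := formalAdj_coeffA
  adj' := formalAdj_coeffAdag
  cut := ⟨_, _, intertwinesCut_coeffA⟩
  cut' := ⟨_, _, intertwinesCut_coeffAdag⟩
  square f u := by
    rintro ⟨_ | n, m⟩
    · simp [coeffAdag_eq, shiftMap_apply]
    · have h := sqrt_mul_sqrt_ofReal (x := (n : ℝ) + 1) (by positivity)
      have hw : wt (n, m) = wt (n + 1, m) - 1 := by simp only [wt]; omega
      simp only [coeffAdag_eq, coeffA_eq, shiftMap_apply, Nat.add_sub_cancel, Nat.cast_succ,
        ← hw]
      rw [Complex.ofReal_mul]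
      linear_combination (f (wt (n, m)) : ℂ) * u (n + 1, m) * h
  comm f u p := by
    have hw : wt (p.1 + 1, p.2) = wt p + 1 := by simp only [wt]; omega
    simp only [coeffA_eq, shiftMap_apply, hw]
    ring
  const_nonneg := by norm_num
  nonneg p := by positivity
  bound_shift ε hε := by
    rintro ⟨_ | n, m⟩
    · have := reg_nonneg (ε := ε) (wt (0, m))
      simp; positivity
    · have hw : wt (n + 1, m) = wt (n, m) + 1 := by simp only [wt]; omega
      have h := (mul_abs_reg_sub_le hε (k := wt (n, m)) (d := 1) (by norm_num)).1
      simp only [hw, Nat.add_sub_cancel]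
      rw [abs_sub_comm]
      refine (mul_le_mul_of_nonneg_right ?_ (abs_nonneg _)).trans (h.trans (by linarith))
      norm_cast
      simp only [wt]; omega
  bound_comm_shift ε hε := by
    rintro ⟨_ | n, m⟩
    · have := reg_nonneg (ε := ε) (wt (0, m))
      simp; positivity
    · have hw : wt (n + 1, m) = wt (n, m) + 1 := by simp only [wt]; omega
      have h := (mul_abs_reg_sub_le hε (k := wt (n, m)) (d := 1) (by norm_num)).1
      simp only [hw, Nat.add_sub_cancel]
      rw [abs_sub_comm]
      refine (mul_le_mul_of_nonneg_right ?_ (abs_nonneg _)).trans (h.trans (by linarith))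
      norm_cast
      simp only [wt]; omega
  bound_comm ε hε k := by
    have h := (mul_abs_reg_sub_le hε (k := k) (d := 1) (by norm_num)).2
    rw [abs_sub_comm]
    refine le_trans ?_ h
    refine le_mul_of_one_le_left (abs_nonneg _) ?_
    norm_cast; omega

lemma isChannel_coeffAdag :
    IsChannel coeffAdag coeffA (fun p => p.1 + 1) (· + 1) (· - 1) 20000 where
  adj := formalAdj_coeffAdag
  adj' := formalAdj_coeffA
  cut := ⟨_, _, intertwinesCut_coeffAdag⟩
  cut' := ⟨_, _, intertwinesCut_coeffA⟩
  square f u := by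
    rintro ⟨n, m⟩
    have h := sqrt_mul_sqrt_ofReal (x := (n : ℝ) + 1) (by positivity)
    have hw : wt (n + 1, m) = wt (n, m) + 1 := by simp only [wt]; omega
    simp only [coeffAdag_eq, coeffA_eq, shiftMap_apply, Nat.add_sub_cancel, Nat.cast_succ, hw]
    rw [Complex.ofReal_mul]
    linear_combination (f (wt (n, m) + 1) : ℂ) * u (n, m) * h
  comm f u := by
    rintro ⟨_ | n, m⟩
    · simp [coeffAdag_eq, shiftMap_apply]
    · have hw : wt (n + 1, m) = wt (n, m) + 1 := by simp only [wt]; omega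
      simp only [coeffAdag_eq, shiftMap_apply, hw, Nat.add_sub_cancel]
      ring
  const_nonneg := by norm_num
  nonneg p := by positivity
  bound_shift ε hε p := by
    have h := (mul_abs_reg_sub_le hε (k := wt p) (d := 1) (by norm_num)).2
    refine (mul_le_mul_of_nonneg_right ?_ (abs_nonneg _)).trans h
    norm_cast
    simp only [wt]; omega
  bound_comm_shift ε hε p := by
    have h := (mul_abs_reg_sub_le hε (k := wt p) (d := 1) (by norm_num)).2
    refine (mul_le_mul_of_nonneg_right ?_ (abs_nonneg _)).trans h
    norm_cast
    simp only [wt]; omega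
  bound_comm ε hε k := by
    rcases k with _ | k
    · have := reg_nonneg (ε := ε) 0
      simp; positivity
    · have h := (mul_abs_reg_sub_le hε (k := k) (d := 1) (by norm_num)).1
      simp only [Nat.add_sub_cancel]
      refine (le_mul_of_one_le_left (abs_nonneg _) ?_).trans (h.trans (by linarith))
      norm_cast; omega

lemma isChannel_coeffB : IsChannel coeffB coeffBdag (fun p => p.2) (· - 2) (· + 2) 20000 where
  adj := formalAdj_coeffB
  adj' := formalAdj_coeffBdag
  cut := ⟨_, _, intertwinesCut_coeffB⟩
  cut' := ⟨_, _, intertwinesCut_coeffBdag⟩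
  square f u := by
    rintro ⟨n, _ | m⟩
    · simp [coeffBdag_eq, shiftMap_apply]
    · have h := sqrt_mul_sqrt_ofReal (x := (m : ℝ) + 1) (by positivity)
      have hw : wt (n, m) = wt (n, m + 1) - 2 := by simp only [wt]; omega
      simp only [coeffBdag_eq, coeffB_eq, shiftMap_apply, Nat.add_sub_cancel, Nat.cast_succ,
        ← hw]
      rw [Complex.ofReal_mul]
      linear_combination (f (wt (n, m)) : ℂ) * u (n, m + 1) * h
  comm f u p := by
    have hw : wt (p.1, p.2 + 1) = wt p + 2 := by simp only [wt]; omega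
    simp only [coeffB_eq, shiftMap_apply, hw]
    ring
  const_nonneg := by norm_num
  nonneg p := by positivity
  bound_shift ε hε := by
    rintro ⟨n, _ | m⟩
    · have := reg_nonneg (ε := ε) (wt (n, 0))
      simp; positivity
    · have hw : wt (n, m + 1) = wt (n, m) + 2 := by simp only [wt]; omega
      have h := (mul_abs_reg_sub_le hε (k := wt (n, m)) (d := 2) le_rfl).1
      simp only [hw, Nat.add_sub_cancel]
      rw [abs_sub_comm]
      refine (mul_le_mul_of_nonneg_right ?_ (abs_nonneg _)).trans (h.trans (by linarith))
      norm_cast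
      simp only [wt]; omega
  bound_comm_shift ε hε := by
    rintro ⟨n, _ | m⟩
    · have := reg_nonneg (ε := ε) (wt (n, 0))
      simp; positivity
    · have hw : wt (n, m + 1) = wt (n, m) + 2 := by simp only [wt]; omega
      have h := (mul_abs_reg_sub_le hε (k := wt (n, m)) (d := 2) le_rfl).1
      simp only [hw, Nat.add_sub_cancel]
      rw [abs_sub_comm]
      refine (mul_le_mul_of_nonneg_right ?_ (abs_nonneg _)).trans (h.trans (by linarith))
      norm_cast
      simp only [wt]; omega
  bound_comm ε hε k := by
    have h := (mul_abs_reg_sub_le hε (k := k) (d := 2) le_rfl).2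
    rw [abs_sub_comm]
    refine le_trans ?_ h
    refine le_mul_of_one_le_left (abs_nonneg _) ?_
    norm_cast; omega

lemma isChannel_coeffBdag :
    IsChannel coeffBdag coeffB (fun p => p.2 + 1) (· + 2) (· - 2) 20000 where
  adj := formalAdj_coeffBdag
  adj' := formalAdj_coeffB
  cut := ⟨_, _, intertwinesCut_coeffBdag⟩
  cut' := ⟨_, _, intertwinesCut_coeffB⟩
  square f u := by
    rintro ⟨n, m⟩
    have h := sqrt_mul_sqrt_ofReal (x := (m : ℝ) + 1) (by positivity)
    have hw : wt (n, m + 1) = wt (n, m) + 2 := by simp only [wt]; omega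
    simp only [coeffBdag_eq, coeffB_eq, shiftMap_apply, Nat.add_sub_cancel, Nat.cast_succ, hw]
    rw [Complex.ofReal_mul]
    linear_combination (f (wt (n, m) + 2) : ℂ) * u (n, m) * h
  comm f u := by
    rintro ⟨n, _ | m⟩
    · simp [coeffBdag_eq, shiftMap_apply]
    · have hw : wt (n, m + 1) = wt (n, m) + 2 := by simp only [wt]; omega
      simp only [coeffBdag_eq, shiftMap_apply, hw, Nat.add_sub_cancel]
      ring
  const_nonneg := by norm_num
  nonneg p := by positivity
  bound_shift ε hε p := by
    have h := (mul_abs_reg_sub_le hε (k := wt p) (d := 2) le_rfl).2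
    refine (mul_le_mul_of_nonneg_right ?_ (abs_nonneg _)).trans h
    norm_cast
    simp only [wt]; omega
  bound_comm_shift ε hε p := by
    have h := (mul_abs_reg_sub_le hε (k := wt p) (d := 2) le_rfl).2
    refine (mul_le_mul_of_nonneg_right ?_ (abs_nonneg _)).trans h
    norm_cast
    simp only [wt]; omega
  bound_comm ε hε k := by
    rcases k with _ | _ | k
    · have := reg_nonneg (ε := ε) 0
      simp; positivity
    -- Truncated subtraction sends weight 1 to 0, so the step here is 1 instead of 2.
    · have h := (mul_abs_reg_sub_le hε (k := 0) (d := 1) (by norm_num)).1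
      simp only [Nat.reduceAdd, Nat.reduceSub] at h ⊢
      simp only [Nat.cast_one, one_mul] at h
      exact h.trans (by linarith)
    · have h := (mul_abs_reg_sub_le hε (k := k) (d := 2) le_rfl).1
      simp only [Nat.add_assoc, Nat.reduceAdd, Nat.add_sub_cancel]
      refine (le_mul_of_one_le_left (abs_nonneg _) ?_).trans (h.trans (by linarith))
      norm_cast; omega

end Channels

/-! ### Weighted domains and identification of the concrete operators. -/

section Domains

variable {H : Type*} [NormedAddCommGroup H] [InnerProductSpace ℂ H]
  (e : HilbertBasis (ℕ × ℕ) ℂ H)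

lemma mem_weightDom {w : ℕ × ℕ → ℕ} {u : H} :
    u ∈ weightDom e w ↔ Summable fun p => (w p : ℝ) * ‖e.repr u p‖ ^ 2 := Iff.rfl

lemma weightDom_mono {w w' : ℕ × ℕ → ℕ} (h : ∀ p, w p ≤ w' p + 1) :
    weightDom e w' ≤ weightDom e w := by
  intro u hu
  refine Summable.of_nonneg_of_le (fun p => by positivity) (fun p => ?_)
    (((mem_weightDom e).1 hu).add (summable_sq e u))
  have : (w p : ℝ) ≤ w' p + 1 := by exact_mod_cast h p
  nlinarith [sq_nonneg ‖e.repr u p‖]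

lemma maxDom_add {L M : CoeffMap} {u : H} (h : u ∈ maxDom e L) (k : u ∈ maxDom e M) :
    u ∈ maxDom e (L + M) :=
  Memℓp.add h k

lemma maxDom_smul {L : CoeffMap} {u : H} (h : u ∈ maxDom e L) (z : ℂ) : u ∈ maxDom e (z • L) :=
  Memℓp.const_smul h z

lemma maxDom_neg {L : CoeffMap} {u : H} (h : u ∈ maxDom e L) : u ∈ maxDom e (-L) :=
  Memℓp.neg h

/-- The growth of the factor is measured at the source index σ p, because the sum is reindexed along
σ. Injectivity is asked only where the factor is nonzero, as truncated subtraction destroys it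
elsewhere. The weighted domain on the left is Dom N², that is, the domain of the square root of C.
-/
lemma weightDom_le_shiftMap {w : ℕ × ℕ → ℝ} {σ : ℕ × ℕ → ℕ × ℕ}
    (hinj : Set.InjOn σ {p | w p ≠ 0}) (C : ℝ)
    (hw : ∀ p, w p ≠ 0 → w p ^ 2 ≤ C * (1 + (wt (σ p) : ℝ) ^ 4)) :
    weightDom e (fun p => wt p ^ 4) ≤ maxDom e (shiftMap w σ) := by
  intro u hu
  rw [mem_maxDom, memlp_two_iff]
  have h1 : Summable fun p => C * (1 + (wt p : ℝ) ^ 4) * ‖e.repr u p‖ ^ 2 := by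
    refine (((summable_sq e u).add ((mem_weightDom e).1 hu)).mul_left C).congr fun p => ?_
    push_cast
    ring
  have h2 : Summable fun p : {p | w p ≠ 0} =>
      C * (1 + (wt (σ p) : ℝ) ^ 4) * ‖e.repr u (σ p)‖ ^ 2 :=
    h1.comp_injective (i := fun p : {p | w p ≠ 0} => σ p) hinj.injective
  have h3 : Summable fun p : {p | w p ≠ 0} => ‖shiftMap w σ (e.repr u) p‖ ^ 2 := by
    refine Summable.of_nonneg_of_le (fun p => by positivity) (fun p => ?_) h2
    rw [shiftMap_apply, norm_mul, mul_pow, Complex.norm_real, Real.norm_eq_abs, sq_abs]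
    exact mul_le_mul_of_nonneg_right (hw p p.2) (by positivity)
  rw [← Function.Injective.summable_iff (g := fun p : {p | w p ≠ 0} => (p : ℕ × ℕ))
    Subtype.val_injective]
  · exact h3
  · intro p hp
    have : w p = 0 := by
      by_contra h
      exact hp ⟨⟨p, h⟩, rfl⟩
    simp [shiftMap_apply, this]

lemma weightDom_le_diagMap {d : ℕ × ℕ → ℂ} {C : ℝ}
    (hd : ∀ p, ‖d p‖ ^ 2 ≤ C * (1 + (wt p : ℝ) ^ 4)) :
    weightDom e (fun p => wt p ^ 4) ≤ maxDom e (diagMap d) := by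
  intro u hu
  rw [mem_maxDom, memlp_two_iff]
  have h1 : Summable fun p => C * (1 + (wt p : ℝ) ^ 4) * ‖e.repr u p‖ ^ 2 := by
    refine (((summable_sq e u).add ((mem_weightDom e).1 hu)).mul_left C).congr fun p => ?_
    push_cast
    ring
  refine Summable.of_nonneg_of_le (fun p => by positivity) (fun p => ?_) h1
  rw [diagMap_apply, norm_mul, mul_pow]
  exact mul_le_mul_of_nonneg_right (hd p) (by positivity)

lemma opA_eq : opA e = maxOp e coeffA := by
  refine coeffOp_eq_maxOp e _ fun u hu => ?_
  rw [mem_maxDom, memlp_two_iff] at hu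
  have hi : Function.Injective fun p : ℕ × ℕ => (p.1 + 1, p.2) := by
    rintro ⟨a, b⟩ ⟨c, d⟩ h; simpa using h
  rw [mem_weightDom, ← hi.summable_iff]
  · refine hu.congr fun p => ?_
    have h0 : (0 : ℝ) ≤ (p.1 : ℝ) + 1 := by positivity
    simp [coeffA, mul_pow, Real.sq_sqrt h0]
  · rintro ⟨_ | n, m⟩ hp
    · simp
    · exact absurd ⟨(n, m), rfl⟩ hp

lemma opB_eq : opB e = maxOp e coeffB := by
  refine coeffOp_eq_maxOp e _ fun u hu => ?_
  rw [mem_maxDom, memlp_two_iff] at hu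
  have hi : Function.Injective fun p : ℕ × ℕ => (p.1, p.2 + 1) := by
    rintro ⟨a, b⟩ ⟨c, d⟩ h; simpa using h
  rw [mem_weightDom, ← hi.summable_iff]
  · refine hu.congr fun p => ?_
    have h0 : (0 : ℝ) ≤ (p.2 : ℝ) + 1 := by positivity
    simp [coeffB, mul_pow, Real.sq_sqrt h0]
  · rintro ⟨n, _ | m⟩ hp
    · simp
    · exact absurd ⟨(n, m), rfl⟩ hp

/-- The image controls the sum with weight n + 1; subtracting the square norm of `u` leaves the
weight n. -/
lemma opAdag_eq : opAdag e = maxOp e coeffAdag := by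
  refine coeffOp_eq_maxOp e _ fun u hu => ?_
  rw [mem_maxDom, memlp_two_iff] at hu
  have hi : Function.Injective fun p : ℕ × ℕ => (p.1 + 1, p.2) := by
    rintro ⟨a, b⟩ ⟨c, d⟩ h; simpa using h
  rw [mem_weightDom]
  refine ((hu.comp_injective hi).sub (summable_sq e u)).congr fun p => ?_
  have h0 : (0 : ℝ) ≤ (p.1 : ℝ) + 1 := by positivity
  simp only [coeffAdag, Function.comp_apply, LinearMap.coe_mk, AddHom.coe_mk, Nat.add_sub_cancel,
    norm_mul, mul_pow, Complex.norm_real, Real.norm_eq_abs, sq_abs, Nat.cast_succ, Real.sq_sqrt h0]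
  ring

lemma opBdag_eq : opBdag e = maxOp e coeffBdag := by
  refine coeffOp_eq_maxOp e _ fun u hu => ?_
  rw [mem_maxDom, memlp_two_iff] at hu
  have hi : Function.Injective fun p : ℕ × ℕ => (p.1, p.2 + 1) := by
    rintro ⟨a, b⟩ ⟨c, d⟩ h; simpa using h
  rw [mem_weightDom]
  refine ((hu.comp_injective hi).sub (summable_sq e u)).congr fun p => ?_
  have h0 : (0 : ℝ) ≤ (p.2 : ℝ) + 1 := by positivity
  simp only [coeffBdag, Function.comp_apply, LinearMap.coe_mk, AddHom.coe_mk, Nat.add_sub_cancel,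
    norm_mul, mul_pow, Complex.norm_real, Real.norm_eq_abs, sq_abs, Nat.cast_succ, Real.sq_sqrt h0]
  ring

lemma coeffOp_coeffDiag (w : ℕ × ℕ → ℕ) :
    coeffOp e (coeffDiag w) (weightDom e fun p => w p ^ 2) (memlp_coeffDiag e w)
      = maxOp e (diagMap fun p => w p) := by
  refine coeffOp_eq_maxOp e (L := coeffDiag w) _ fun u hu => ?_
  rw [mem_maxDom, memlp_two_iff] at hu
  refine hu.congr fun p => ?_
  simp [coeffDiag, mul_pow]

lemma mem_maxDom_diagMap_nat {w : ℕ × ℕ → ℕ} {u : H} :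
    u ∈ maxDom e (diagMap fun p => w p) ↔ u ∈ weightDom e fun p => w p ^ 2 := by
  rw [mem_maxDom, memlp_two_iff, mem_weightDom]
  refine summable_congr fun p => ?_
  simp [diagMap_apply, mul_pow]

lemma weightDom_le_coeffA : weightDom e (fun p => p.1) ≤ maxDom e coeffA := memlp_coeffA e

lemma weightDom_le_coeffAdag : weightDom e (fun p => p.1) ≤ maxDom e coeffAdag :=
  memlp_coeffAdag e

lemma weightDom_le_coeffB : weightDom e (fun p => p.2) ≤ maxDom e coeffB := memlp_coeffB e

lemma weightDom_le_coeffBdag : weightDom e (fun p => p.2) ≤ maxDom e coeffBdag :=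
  memlp_coeffBdag e

lemma weightDom_wt_le_fst : weightDom e (fun p => wt p ^ 4) ≤ weightDom e (fun p => p.1) :=
  weightDom_mono e fun p => by
    have h1 : p.1 ≤ wt p := by simp only [wt]; omega
    have h2 : wt p ≤ wt p ^ 4 := Nat.le_self_pow (by norm_num) _
    omega

lemma weightDom_wt_le_snd : weightDom e (fun p => wt p ^ 4) ≤ weightDom e (fun p => p.2) :=
  weightDom_mono e fun p => by
    have h1 : p.2 ≤ wt p := by simp only [wt]; omega
    have h2 : wt p ≤ wt p ^ 4 := Nat.le_self_pow (by norm_num) _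
    omega

end Domains

/-! ### The operator K: interaction, decay, adjoint, growth. -/

section Hamiltonian

/-- The part of the interaction which creates two quanta in the first mode. -/
def pairUp : CoeffMap :=
  shiftMap (fun p => √((p.1 : ℝ) * ((p.1 : ℝ) - 1) * ((p.2 : ℝ) + 1))) fun p => (p.1 - 2, p.2 + 1)

/-- The part of the interaction which annihilates two quanta in the first mode. -/
def pairDown : CoeffMap :=
  shiftMap (fun p => √((p.2 : ℝ) * ((p.1 : ℝ) + 1) * ((p.1 : ℝ) + 2))) fun p => (p.1 + 2, p.2 - 1)

lemma two_le_of_pairUp_ne_zero {p : ℕ × ℕ}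
    (h : √((p.1 : ℝ) * ((p.1 : ℝ) - 1) * ((p.2 : ℝ) + 1)) ≠ 0) : 2 ≤ p.1 := by
  by_contra hp
  obtain h0 | h0 : p.1 = 0 ∨ p.1 = 1 := by omega
  all_goals simp [h0] at h

lemma one_le_of_pairDown_ne_zero {p : ℕ × ℕ}
    (h : √((p.2 : ℝ) * ((p.1 : ℝ) + 1) * ((p.1 : ℝ) + 2)) ≠ 0) : 1 ≤ p.2 := by
  by_contra hp
  have h0 : p.2 = 0 := by omega
  simp [h0] at h

/-- The two processes are mutually inverse shifts wherever their factors are nonzero; the factors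
vanish exactly where natural subtraction truncates (n < 2, respectively m = 0). -/
lemma pairUp_pairDown (p q : ℕ × ℕ) :
    (if (q.1 - 2, q.2 + 1) = p then √((q.1 : ℝ) * ((q.1 : ℝ) - 1) * ((q.2 : ℝ) + 1)) else 0)
      = if (p.1 + 2, p.2 - 1) = q then √((p.2 : ℝ) * ((p.1 : ℝ) + 1) * ((p.1 : ℝ) + 2)) else 0 := by
  by_cases h1 : (q.1 - 2, q.2 + 1) = p
  · rw [if_pos h1]
    subst h1
    obtain ⟨_ | _ | n, m⟩ := q
    · simp
    · simp
    · rw [if_pos (by simp)]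
      congr 1
      push_cast [Nat.add_sub_cancel]
      ring
  · rw [if_neg h1]
    by_cases h2 : (p.1 + 2, p.2 - 1) = q
    · rw [if_pos h2]
      subst h2
      obtain ⟨n, _ | m⟩ := p
      · simp
      · simp at h1
    · rw [if_neg h2]

lemma formalAdj_pairUp : FormalAdj pairUp pairDown := formalAdj_shiftMap pairUp_pairDown

lemma formalAdj_pairDown : FormalAdj pairDown pairUp :=
  formalAdj_shiftMap fun p q => (pairUp_pairDown q p).symm

lemma wt_pairUp {p : ℕ × ℕ} (h : 2 ≤ p.1) : wt (p.1 - 2, p.2 + 1) = wt p := by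
  simp only [wt]; omega

lemma wt_pairDown {p : ℕ × ℕ} (h : 1 ≤ p.2) : wt (p.1 + 2, p.2 - 1) = wt p := by
  simp only [wt]; omega

lemma intertwinesCut_pairUp : IntertwinesCut pairUp 0 0 :=
  intertwinesCut_shiftMap fun _ hp => wt_pairUp (two_le_of_pairUp_ne_zero hp)

lemma intertwinesCut_pairDown : IntertwinesCut pairDown 0 0 :=
  intertwinesCut_shiftMap fun _ hp => wt_pairDown (one_le_of_pairDown_ne_zero hp)

lemma pairUp_mul_wt (f : ℕ → ℝ) (u : ℕ × ℕ → ℂ) (p : ℕ × ℕ) :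
    pairUp (fun q => f (wt q) * u q) p = f (wt p) * pairUp u p := by
  simp only [pairUp, shiftMap_apply]
  by_cases h : √((p.1 : ℝ) * ((p.1 : ℝ) - 1) * ((p.2 : ℝ) + 1)) = 0
  · simp [h]
  · rw [wt_pairUp (two_le_of_pairUp_ne_zero h)]
    ring

lemma pairDown_mul_wt (f : ℕ → ℝ) (u : ℕ × ℕ → ℂ) (p : ℕ × ℕ) :
    pairDown (fun q => f (wt q) * u q) p = f (wt p) * pairDown u p := by
  simp only [pairDown, shiftMap_apply]
  by_cases h : √((p.2 : ℝ) * ((p.1 : ℝ) + 1) * ((p.1 : ℝ) + 2)) = 0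
  · simp [h]
  · rw [wt_pairDown (one_le_of_pairDown_ne_zero h)]
    ring

lemma cube_le (k : ℝ) (hk : 0 ≤ k) : (k + 1) ^ 3 ≤ 8 * (1 + k ^ 4) := by
  nlinarith [sq_nonneg (k - 1), sq_nonneg (k ^ 2 - 1), sq_nonneg (k ^ 2 - k), pow_nonneg hk 3]

variable (P : Params)

/-- The diagonal part of `-K`. -/
def decay (p : ℕ × ℕ) : ℂ :=
  (P.κ * P.nbar + P.κp * P.nbarp : ℂ) + Complex.I * P.ω * p.1
    + P.κ * (2 * P.nbar + 1) * p.1 + 2 * Complex.I * P.ω * p.2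
    + P.κp * (2 * P.nbarp + 1) * p.2

/-- Twice the real part of `decay`. -/
def rate (p : ℕ × ℕ) : ℝ :=
  2 * (P.κ * P.nbar + P.κp * P.nbarp + P.κ * (2 * P.nbar + 1) * p.1
    + P.κp * (2 * P.nbarp + 1) * p.2)

lemma decay_add_conj (p : ℕ × ℕ) : decay P p + (starRingEnd ℂ) (decay P p) = (rate P p : ℂ) := by
  rw [Complex.add_conj]
  simp [decay, rate]

/-- The coefficient map of `K*`. -/
def coeffKstar : CoeffMap :=
  ((P.g / 2 : ℝ) : ℂ) • pairDown + (-((P.g / 2 : ℝ) : ℂ)) • pairUp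
    + -diagMap fun p => (starRingEnd ℂ) (decay P p)

lemma coeffK_eq : coeffK P = ((P.g / 2 : ℝ) : ℂ) • pairUp + (-((P.g / 2 : ℝ) : ℂ)) • pairDown
    + -diagMap (decay P) := by
  ext u p
  simp only [coeffK, pairUp, pairDown, shiftMap_apply, diagMap_apply, decay, LinearMap.coe_mk,
    AddHom.coe_mk, LinearMap.add_apply, LinearMap.smul_apply, LinearMap.neg_apply, Pi.add_apply,
    Pi.smul_apply, Pi.neg_apply, smul_eq_mul]
  push_cast
  ring

lemma formalAdj_coeffK : FormalAdj (coeffK P) (coeffKstar P) := by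
  rw [coeffK_eq, coeffKstar]
  have h1 := formalAdj_pairUp.smul ((P.g / 2 : ℝ) : ℂ)
  have h2 := formalAdj_pairDown.smul (-((P.g / 2 : ℝ) : ℂ))
  rw [map_neg] at h2
  rw [Complex.conj_ofReal] at h1 h2
  exact (h1.add h2).add (formalAdj_diagMap (decay P)).neg

lemma formalAdj_coeffKstar : FormalAdj (coeffKstar P) (coeffK P) := by
  rw [coeffK_eq, coeffKstar]
  have h1 := formalAdj_pairDown.smul ((P.g / 2 : ℝ) : ℂ)
  have h2 := formalAdj_pairUp.smul (-((P.g / 2 : ℝ) : ℂ))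
  have h3 := (formalAdj_diagMap fun p => (starRingEnd ℂ) (decay P p)).neg
  rw [map_neg] at h2
  rw [Complex.conj_ofReal] at h1 h2
  simp only [Complex.conj_conj] at h3
  exact (h1.add h2).add h3

lemma intertwinesCut_coeffK : IntertwinesCut (coeffK P) 0 0 := by
  rw [coeffK_eq]
  exact ((intertwinesCut_pairUp.smul _).add (intertwinesCut_pairDown.smul _)).add
    (intertwinesCut_diagMap _).neg

lemma intertwinesCut_coeffKstar : IntertwinesCut (coeffKstar P) 0 0 :=
  ((intertwinesCut_pairDown.smul _).add (intertwinesCut_pairUp.smul _)).add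
    (intertwinesCut_diagMap _).neg

/-- The interaction is skew-symmetric and commutes with functions of the weight, so it drops out of
f K + K* f and only the diagonal decay remains. -/
lemma coeffK_add_coeffKstar (f : ℕ → ℝ) (u : ℕ × ℕ → ℂ) (p : ℕ × ℕ) :
    f (wt p) * coeffK P u p + coeffKstar P (fun q => f (wt q) * u q) p
      = ((-(f (wt p) * rate P p) : ℝ) : ℂ) * u p := by
  rw [coeffK_eq, coeffKstar]
  simp only [LinearMap.add_apply, LinearMap.smul_apply, LinearMap.neg_apply, Pi.add_apply,
    Pi.smul_apply, Pi.neg_apply, smul_eq_mul, pairUp_mul_wt, pairDown_mul_wt, diagMap_apply]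
  push_cast
  linear_combination -(f (wt p) * u p : ℂ) * decay_add_conj P p

variable {H : Type*} [NormedAddCommGroup H] [InnerProductSpace ℂ H]
  (e : HilbertBasis (ℕ × ℕ) ℂ H)

/-- The squared interaction coefficient is cubic in n and m, hence dominated by the fourth power of
the weight. This is why N² suffices to control K. -/
lemma weightDom_le_pairUp : weightDom e (fun p => wt p ^ 4) ≤ maxDom e pairUp := by
  refine weightDom_le_shiftMap e ?_ 8 fun p hp => ?_
  · intro p hp q hq h
    have h1 := two_le_of_pairUp_ne_zero hp
    have h2 := two_le_of_pairUp_ne_zero hq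
    simp only [Prod.mk.injEq] at h
    exact Prod.ext (by omega) (by omega)
  · have h1 := two_le_of_pairUp_ne_zero hp
    have h1' : (2 : ℝ) ≤ p.1 := by exact_mod_cast h1
    rw [wt_pairUp h1, Real.sq_sqrt (mul_nonneg (mul_nonneg (by linarith) (by linarith))
      (by positivity))]
    refine le_trans ?_ (cube_le _ (Nat.cast_nonneg _))
    have h2 : ((p.1 : ℕ) : ℝ) ≤ wt p + 1 := by norm_cast; simp only [wt]; omega
    have h3 : (p.2 : ℝ) + 1 ≤ wt p + 1 := by norm_cast; simp only [wt]; omega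
    calc (p.1 : ℝ) * (p.1 - 1) * (p.2 + 1) ≤ (wt p + 1) * (wt p + 1) * (wt p + 1) := by
          gcongr <;> linarith
      _ = _ := by ring

lemma weightDom_le_pairDown : weightDom e (fun p => wt p ^ 4) ≤ maxDom e pairDown := by
  refine weightDom_le_shiftMap e ?_ 8 fun p hp => ?_
  · intro p hp q hq h
    have h1 := one_le_of_pairDown_ne_zero hp
    have h2 := one_le_of_pairDown_ne_zero hq
    simp only [Prod.mk.injEq] at h
    exact Prod.ext (by omega) (by omega)
  · have h1 := one_le_of_pairDown_ne_zero hp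
    rw [wt_pairDown h1, Real.sq_sqrt (by positivity)]
    refine le_trans ?_ (cube_le _ (Nat.cast_nonneg _))
    have h2 : (p.2 : ℝ) ≤ wt p + 1 := by norm_cast; simp only [wt]; omega
    have h3 : (p.1 : ℝ) + 1 ≤ wt p + 1 := by norm_cast; simp only [wt]; omega
    have h4 : (p.1 : ℝ) + 2 ≤ wt p + 1 := by norm_cast; simp only [wt]; omega
    calc (p.2 : ℝ) * (p.1 + 1) * (p.1 + 2) ≤ (wt p + 1) * (wt p + 1) * (wt p + 1) := by gcongr
      _ = _ := by ring

lemma exists_norm_decay_le : ∃ C : ℝ, ∀ p, ‖decay P p‖ ^ 2 ≤ C * (1 + (wt p : ℝ) ^ 4) := by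
  obtain ⟨c, hc0, hc⟩ : ∃ c : ℝ, 0 ≤ c ∧ ∀ p, ‖decay P p‖ ≤ c * (wt p + 1) := by
    refine ⟨‖(P.κ * P.nbar + P.κp * P.nbarp : ℂ)‖ + ‖Complex.I * P.ω‖
      + ‖(P.κ * (2 * P.nbar + 1) : ℂ)‖ + ‖2 * Complex.I * P.ω‖
      + ‖(P.κp * (2 * P.nbarp + 1) : ℂ)‖, by positivity, fun p => ?_⟩
    have h1 : (p.1 : ℝ) ≤ wt p + 1 := by norm_cast; simp only [wt]; omega
    have h2 : (p.2 : ℝ) ≤ wt p + 1 := by norm_cast; simp only [wt]; omega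
    have h3 : (1 : ℝ) ≤ wt p + 1 := by norm_cast; omega
    have hn : ∀ (z : ℂ) (n : ℕ), (n : ℝ) ≤ wt p + 1 → ‖z * n‖ ≤ ‖z‖ * (wt p + 1) := by
      intro z n h
      rw [norm_mul, Complex.norm_natCast]
      gcongr
    unfold decay
    refine (norm_add_le_of_le (norm_add_le_of_le (norm_add_le_of_le (norm_add_le_of_le
      (le_mul_of_one_le_right (norm_nonneg _) h3) (hn _ _ h1)) (hn _ _ h1)) (hn _ _ h2))
      (hn _ _ h2)).trans (le_of_eq ?_)
    ring
  refine ⟨c ^ 2 * 4, fun p => ?_⟩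
  calc ‖decay P p‖ ^ 2 ≤ (c * (wt p + 1)) ^ 2 := by
        gcongr
        exact hc p
    _ = c ^ 2 * ((wt p : ℝ) + 1) ^ 2 := by ring
    _ ≤ c ^ 2 * (4 * (1 + (wt p : ℝ) ^ 4)) := by
        gcongr
        nlinarith [sq_nonneg ((wt p : ℝ) - 1), sq_nonneg ((wt p : ℝ) ^ 2 - 1)]
    _ = _ := by ring

lemma weightDom_le_coeffK : weightDom e (fun p => wt p ^ 4) ≤ maxDom e (coeffK P) := by
  intro u hu
  obtain ⟨C, hC⟩ := exists_norm_decay_le P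
  rw [coeffK_eq]
  exact maxDom_add e (maxDom_add e (maxDom_smul e (weightDom_le_pairUp e hu) _)
    (maxDom_smul e (weightDom_le_pairDown e hu) _)) (maxDom_neg e (weightDom_le_diagMap e hC hu))

lemma weightDom_le_coeffKstar : weightDom e (fun p => wt p ^ 4) ≤ maxDom e (coeffKstar P) := by
  intro u hu
  obtain ⟨C, hC⟩ := exists_norm_decay_le P
  have hC' : ∀ p, ‖(starRingEnd ℂ) (decay P p)‖ ^ 2 ≤ C * (1 + (wt p : ℝ) ^ 4) := fun p => by
    rw [RCLike.norm_conj]; exact hC p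
  exact maxDom_add e (maxDom_add e (maxDom_smul e (weightDom_le_pairDown e hu) _)
    (maxDom_smul e (weightDom_le_pairUp e hu) _)) (maxDom_neg e (weightDom_le_diagMap e hC' hu))

lemma opK_eq : opK e P = maxOp e (coeffK P) := rfl

end Hamiltonian

/-! ### Bounded diagonal operators. -/

section Bounded

variable {H : Type*} [NormedAddCommGroup H] [InnerProductSpace ℂ H] [CompleteSpace H]

/-- A closed operator composed with a bounded operator with range in its domain is bounded. -/
lemma exists_clm_of_isClosed {T : H →ₗ.[ℂ] H} (hT : T.IsClosed) (B : H →L[ℂ] H)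
    (hB : ∀ u, B u ∈ T.domain) : ∃ A : H →L[ℂ] H, ∀ u, A u = ap T (B u) := by
  let g : H →ₗ[ℂ] H := T.toFun.comp ((B : H →ₗ[ℂ] H).codRestrict T.domain hB)
  have hg : ∀ u, g u = ap T (B u) := fun u => (ap_of_mem (hB u)).symm
  have hcl : IsClosed (g.graph : Set (H × H)) := by
    have : (g.graph : Set (H × H)) = (fun x : H × H => (B x.1, x.2)) ⁻¹' (T.graph : Set (H × H)) := by
      ext ⟨u, v⟩
      change v = g u ↔ (B u, v) ∈ T.graph
      rw [mem_graph_iff_ap, hg, eq_comm]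
      exact ⟨fun h => ⟨hB u, h⟩, fun h => h.2⟩
    rw [this]
    exact hT.preimage (by fun_prop)
  exact ⟨ContinuousLinearMap.ofIsClosedGraph hcl, fun u => hg u⟩

variable (e : HilbertBasis (ℕ × ℕ) ℂ H)

/-- `F` multiplies the coefficients by `c`. -/
def IsMul (c : ℕ × ℕ → ℝ) (F : H →L[ℂ] H) : Prop :=
  ∀ u p, (e.repr (F u) : ℕ × ℕ → ℂ) p = (c p : ℂ) * e.repr u p

/-- With bounded entries the maximal domain is everything, so the closed graph theorem supplies the
bounded operator. -/
lemma exists_isMul {c : ℕ × ℕ → ℝ} {M : ℝ} (hc : ∀ p, |c p| ≤ M) : ∃ F, IsMul e c F := by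
  have hdom : ∀ u, u ∈ maxDom e (diagMap fun p => (c p : ℂ)) := by
    intro u
    rw [mem_maxDom, memlp_two_iff]
    refine Summable.of_nonneg_of_le (fun p => by positivity) (fun p => ?_)
      ((summable_sq e u).mul_left (M ^ 2))
    rw [diagMap_apply, norm_mul, mul_pow, Complex.norm_real, Real.norm_eq_abs]
    have := hc p
    gcongr
  have hcl : (maxOp e (diagMap fun p => (c p : ℂ))).IsClosed := by
    have h := formalAdj_diagMap fun p => (c p : ℂ)
    simp only [Complex.conj_ofReal] at h
    exact maxOp_isClosed e h (intertwinesCut_diagMap _)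
  obtain ⟨F, hF⟩ := exists_clm_of_isClosed hcl 1 hdom
  refine ⟨F, fun u p => ?_⟩
  rw [hF, repr_ap_maxOp e (hdom _)]
  rfl

variable {e}

omit [CompleteSpace H] in
lemma isMul_one : IsMul e (fun _ => 1) 1 := fun u p => by simp

omit [CompleteSpace H] in
lemma IsMul.mul {c d : ℕ × ℕ → ℝ} {F G : H →L[ℂ] H} (hF : IsMul e c F) (hG : IsMul e d G) :
    IsMul e (fun p => c p * d p) (F * G) := fun u p => by
  rw [mul_apply_eq_comp, hF, hG]
  push_cast
  ring

omit [CompleteSpace H] in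
lemma IsMul.unique {c : ℕ × ℕ → ℝ} {F G : H →L[ℂ] H} (hF : IsMul e c F) (hG : IsMul e c G) :
    F = G :=
  ContinuousLinearMap.ext fun u => ext_repr e fun p => by rw [hF, hG]

omit [CompleteSpace H] in
lemma inner_eq_hasSum (u v : H) :
    HasSum (fun p => (starRingEnd ℂ) (e.repr u p) * e.repr v p) ⟪u, v⟫_ℂ := by
  refine (e.hasSum_inner_mul_inner u v).congr_fun fun p => ?_
  rw [HilbertBasis.repr_apply_apply, HilbertBasis.repr_apply_apply, inner_conj_symm]

omit [CompleteSpace H] in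
lemma hasSum_re_inner {u v : H} {g : ℕ × ℕ → ℝ} (h : ∀ p, e.repr v p = (g p : ℂ) * e.repr u p) :
    HasSum (fun p => g p * ‖e.repr u p‖ ^ 2) (⟪u, v⟫_ℂ).re := by
  refine (Complex.hasSum_re (inner_eq_hasSum (e := e) u v)).congr_fun ?_
  intro p
  rw [h p, mul_left_comm, mul_comm ((starRingEnd ℂ) _), Complex.mul_conj,
    Complex.normSq_eq_norm_sq]
  norm_cast

omit [CompleteSpace H] in
lemma hasSum_norm_sq (u : H) : HasSum (fun p => ‖e.repr u p‖ ^ 2) (‖u‖ ^ 2) := by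
  have := hasSum_re_inner (e := e) (u := u) (v := u) (g := fun _ => 1) fun p => by simp
  simp only [one_mul] at this
  rwa [show (⟪u, u⟫_ℂ).re = ‖u‖ ^ 2 from inner_self_eq_norm_sq (𝕜 := ℂ) u] at this

omit [CompleteSpace H] in
lemma IsMul.inner_left {c : ℕ × ℕ → ℝ} {F : H →L[ℂ] H} (hF : IsMul e c F) (u v : H) :
    ⟪F u, v⟫_ℂ = ⟪u, F v⟫_ℂ := by
  refine (inner_eq_hasSum (e := e) (F u) v).unique
    ((inner_eq_hasSum (e := e) u (F v)).congr_fun fun p => ?_)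
  rw [hF, hF, map_mul, Complex.conj_ofReal]
  ring

omit [CompleteSpace H] in
lemma IsMul.nonneg {c : ℕ × ℕ → ℝ} {F : H →L[ℂ] H} (hF : IsMul e c F) (hc : ∀ p, 0 ≤ c p) :
    0 ≤ F := by
  rw [ContinuousLinearMap.nonneg_iff_isPositive, ContinuousLinearMap.isPositive_def]
  refine ⟨fun u v => hF.inner_left u v, fun u => ?_⟩
  rw [ContinuousLinearMap.reApplyInnerSelf_apply, hF.inner_left]
  exact (hasSum_re_inner (e := e) (hF u)).nonneg fun p => mul_nonneg (hc p) (by positivity)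

lemma IsMul.sqrt_eq {c d : ℕ × ℕ → ℝ} {F G : H →L[ℂ] H} (hF : IsMul e c F) (hG : IsMul e d G)
    (hd : ∀ p, 0 ≤ d p) (h : ∀ p, d p * d p = c p) : CFC.sqrt F = G := by
  refine CFC.sqrt_unique ?_ (hG.nonneg hd)
  have := hG.mul hG
  simp only [h] at this
  exact this.unique hF

omit [CompleteSpace H] in
-- Levels are finite and exhaust all indices, so finite combinations are precisely the vectors of
-- bounded weight.
lemma mem_spanBasis_iff {u : H} : u ∈ spanBasis e ↔ ∃ n, trunc e n u = u := by
  constructor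
  · intro hu
    have hmono : ∀ {m n : ℕ} {x : H}, m ≤ n → trunc e m x = x → trunc e n x = x := by
      intro m n x hmn hx
      refine ext_repr e fun p => ?_
      rw [← hx, repr_trunc, repr_trunc, cut_cut' hmn]
    induction hu using Submodule.span_induction with
    | mem x hx =>
      obtain ⟨p, rfl⟩ := hx
      refine ⟨wt p, ext_repr e fun q => ?_⟩
      rw [repr_trunc, repr_basis]
      by_cases hq : q = p
      · simp [cut, hq]
      · simp [cut, hq]
    | zero => exact ⟨0, map_zero _⟩
    | add x y _ _ hx hy =>
      obtain ⟨m, hm⟩ := hx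
      obtain ⟨n, hn⟩ := hy
      refine ⟨max m n, ?_⟩
      rw [map_add, hmono (le_max_left _ _) hm, hmono (le_max_right _ _) hn]
    | smul c x _ hx =>
      obtain ⟨m, hm⟩ := hx
      exact ⟨m, by rw [map_smul, hm]⟩
  · rintro ⟨n, hn⟩
    rw [← hn]
    exact trunc_mem e n u

omit [CompleteSpace H] in
lemma IsMul.mem_spanBasis {c : ℕ × ℕ → ℝ} {F : H →L[ℂ] H} (hF : IsMul e c F) {u : H}
    (hu : u ∈ spanBasis e) : F u ∈ spanBasis e := by
  obtain ⟨n, hn⟩ := mem_spanBasis_iff.1 hu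
  refine mem_spanBasis_iff.2 ⟨n, ext_repr e fun p => ?_⟩
  have := congrFun ((repr_trunc e n u).symm.trans (by rw [hn])) p
  rw [repr_trunc, cut, hF]
  by_cases hp : wt p ≤ n
  · rw [if_pos hp]
  · simp only [cut, hp, if_false] at this
    rw [if_neg hp, ← this, mul_zero]

omit [CompleteSpace H] in
lemma ap_mem_spanBasis {L L' : CoeffMap} (h : FormalAdj L L') {s t : ℕ}
    (hs : IntertwinesCut L s t) {u : H} (hu : u ∈ spanBasis e) :
    ap (maxOp e L) u ∈ spanBasis e := by
  obtain ⟨n, hn⟩ := mem_spanBasis_iff.1 hu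
  have hn' : trunc e (n + s) u = u := by
    refine ext_repr e fun p => ?_
    rw [← hn, repr_trunc, repr_trunc, cut_cut' (Nat.le_add_right n s)]
  rw [← hn', ap_trunc e h hs (spanBasis_le_maxDom e h hu)]
  exact trunc_mem e _ _

lemma inner_ap_left {L L' : CoeffMap} (h : FormalAdj L L') {s t : ℕ}
    (hs : IntertwinesCut L s t) {u v : H} (hu : u ∈ maxDom e L) (hv : v ∈ maxDom e L') :
    ⟪ap (maxOp e L) u, v⟫_ℂ = ⟪u, ap (maxOp e L') v⟫_ℂ := by
  have hg : (v, ap (maxOp e L') v) ∈ (maxOp e L).adjoint.graph := by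
    rw [maxOp_adjoint e h hs, mem_graph_iff_ap]
    exact ⟨hv, rfl⟩
  exact (mem_adjoint_graph_iff (maxDom_dense e h)).1 hg u hu

end Bounded

/-! ### Powers of N and the regularization of C. -/

section NumberOperator

variable {H : Type*} [NormedAddCommGroup H] [InnerProductSpace ℂ H]
  (e : HilbertBasis (ℕ × ℕ) ℂ H)

lemma mem_graph_diag {w : ℕ × ℕ → ℕ} {u v : H} :
    (u, v) ∈ (maxOp e (diagMap fun p => w p)).graph ↔ ∀ p, e.repr v p = (w p : ℂ) * e.repr u p := by
  rw [mem_graph_maxOp, funext_iff]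
  rfl

lemma mem_graph_prodOp {S T : H →ₗ.[ℂ] H} {u v : H} :
    (u, v) ∈ (prodOp S T).graph ↔ ∃ y, (u, y) ∈ T.graph ∧ (y, v) ∈ S.graph := by
  constructor
  · rw [LinearPMap.mem_graph_iff]
    rintro ⟨⟨x, hx⟩, rfl, rfl⟩
    obtain ⟨y, hy, rfl⟩ := hx
    exact ⟨T y, T.mem_graph y, S.mem_graph ⟨T y, hy⟩⟩
  · rintro ⟨y, h1, h2⟩
    rw [LinearPMap.mem_graph_iff] at h1 h2 ⊢
    obtain ⟨a, rfl, rfl⟩ := h1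
    obtain ⟨b, hb, rfl⟩ := h2
    have ha : T a ∈ S.domain := by
      have := b.2
      rwa [hb] at this
    refine ⟨⟨a, a, ha, rfl⟩, rfl, ?_⟩
    change S ⟨T a, _⟩ = S b
    congr 1
    exact Subtype.ext hb.symm

/-- The hypothesis makes the natural domain of the product maximal: if the product of the weights
times `u` is square summable, so is `w'` times `u`. The `+ 1` admits indices where `w` vanishes and
`w'` does not. -/
lemma prodOp_diag {w w' : ℕ × ℕ → ℕ} (h : ∀ p, w' p ≤ w p * w' p + 1) :
    prodOp (maxOp e (diagMap fun p => w p)) (maxOp e (diagMap fun p => w' p))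
      = maxOp e (diagMap fun p => ((w p * w' p : ℕ) : ℂ)) := by
  refine LinearPMap.eq_of_eq_graph ?_
  ext ⟨u, v⟩
  rw [mem_graph_prodOp, mem_graph_diag e (w := fun p => w p * w' p)]
  constructor
  · rintro ⟨y, h1, h2⟩ p
    rw [mem_graph_diag] at h1 h2
    rw [h2, h1]
    push_cast
    ring
  · intro huv
    have hu : u ∈ maxDom e (diagMap fun p => (w' p : ℂ)) := by
      rw [mem_maxDom, memlp_two_iff]
      refine Summable.of_nonneg_of_le (fun p => by positivity) (fun p => ?_)
        (((summable_sq e v).add (summable_sq e u)).mul_left 2)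
      have h1 : (w' p : ℝ) ≤ ((w p * w' p : ℕ) : ℝ) + 1 := by exact_mod_cast h p
      rw [diagMap_apply, huv, norm_mul, norm_mul, Complex.norm_natCast, Complex.norm_natCast,
        mul_pow, mul_pow]
      have h2 : (w' p : ℝ) ^ 2 ≤ 2 * (((w p * w' p : ℕ) : ℝ) ^ 2 + 1) := by
        have : (w' p : ℝ) ^ 2 ≤ (((w p * w' p : ℕ) : ℝ) + 1) ^ 2 := by gcongr
        nlinarith [sq_nonneg (((w p * w' p : ℕ) : ℝ) - 1)]
      nlinarith [sq_nonneg ‖e.repr u p‖]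
    refine ⟨ap (maxOp e (diagMap fun p => (w' p : ℂ))) u, mem_graph_iff_ap.2 ⟨hu, rfl⟩, ?_⟩
    rw [mem_graph_diag]
    intro p
    rw [huv, repr_ap_maxOp e hu, diagMap_apply]
    push_cast
    ring

lemma opN_eq : opN e = maxOp e (diagMap fun p => (wt p : ℂ)) := by
  have hA : numA e = maxOp e (diagMap fun p => (p.1 : ℂ)) := coeffOp_coeffDiag e fun p => p.1
  have hB : numB e = maxOp e (diagMap fun p => (p.2 : ℂ)) := coeffOp_coeffDiag e fun p => p.2
  refine LinearPMap.eq_of_eq_graph ?_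
  ext ⟨u, v⟩
  rw [mem_graph_diag, opN, hA, hB]
  have hsum : ∀ (h1 : u ∈ maxDom e (diagMap fun p => (p.1 : ℂ)))
      (h2 : u ∈ maxDom e (diagMap fun p => (p.2 : ℂ))) p,
      e.repr (ap (maxOp e (diagMap fun p => (p.1 : ℂ))) u
        + (2 : ℂ) • ap (maxOp e (diagMap fun p => (p.2 : ℂ))) u) p = (wt p : ℂ) * e.repr u p := by
    intro h1 h2 p
    rw [map_add, map_smul, lp.coeFn_add, lp.coeFn_smul, Pi.add_apply, Pi.smul_apply,
      repr_ap_maxOp e h1, repr_ap_maxOp e h2, diagMap_apply, diagMap_apply]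
    simp only [wt, smul_eq_mul]
    push_cast
    ring
  constructor
  · rw [LinearPMap.mem_graph_iff]
    rintro ⟨⟨x, h1, h2⟩, rfl, rfl⟩ p
    rw [← hsum h1 h2 p, ap_of_mem (T := maxOp e (diagMap fun p => (p.1 : ℂ))) h1,
      ap_of_mem (T := maxOp e (diagMap fun p => (p.2 : ℂ))) h2]
    rfl
  · intro h
    have hu : u ∈ weightDom e fun p => wt p ^ 2 := by
      rw [← mem_maxDom_diagMap_nat, mem_maxDom]
      have : diagMap (fun p => (wt p : ℂ)) (e.repr u) = e.repr v := funext fun p => (h p).symm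
      rw [this]
      exact lp.memℓp _
    have h1 : u ∈ maxDom e (diagMap fun p => (p.1 : ℂ)) := by
      rw [mem_maxDom_diagMap_nat e (w := fun p => p.1)]
      refine weightDom_mono e (fun p => ?_) hu
      have : p.1 ≤ wt p := by simp only [wt]; omega
      exact (Nat.pow_le_pow_left this 2).trans (Nat.le_succ _)
    have h2 : u ∈ maxDom e (diagMap fun p => (p.2 : ℂ)) := by
      rw [mem_maxDom_diagMap_nat e (w := fun p => p.2)]
      refine weightDom_mono e (fun p => ?_) hu
      have : p.2 ≤ wt p := by simp only [wt]; omega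
      exact (Nat.pow_le_pow_left this 2).trans (Nat.le_succ _)
    rw [LinearPMap.mem_graph_iff]
    refine ⟨⟨u, h1, h2⟩, rfl, ext_repr e fun p => ?_⟩
    rw [h, ← hsum h1 h2 p, ap_of_mem (T := maxOp e (diagMap fun p => (p.1 : ℂ))) h1,
      ap_of_mem (T := maxOp e (diagMap fun p => (p.2 : ℂ))) h2]
    rfl

lemma powOp_opN (k : ℕ) : powOp (opN e) k = maxOp e (diagMap fun p => ((wt p ^ k : ℕ) : ℂ)) := by
  induction k with
  | zero =>
    refine LinearPMap.eq_of_eq_graph ?_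
    ext ⟨u, v⟩
    rw [mem_graph_diag e (w := fun p => wt p ^ 0), powOp, LinearPMap.mem_graph_iff]
    constructor
    · rintro ⟨y, rfl, rfl⟩ p
      rw [pow_zero, Nat.cast_one, one_mul]
      rfl
    · intro h
      exact ⟨⟨u, trivial⟩, rfl, ext_repr e fun p => by simp [h]⟩
  | succ k ih =>
    rw [powOp, ih, opN_eq, prodOp_diag e (w := wt) (w' := fun p => wt p ^ k)]
    · simp only [pow_succ']
    · intro p
      rcases Nat.eq_zero_or_pos (wt p) with h | h
      · rcases k with _ | k <;> simp [h]
      · nlinarith [Nat.zero_le (wt p ^ k)]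

lemma isPositiveOp_diag (w : ℕ × ℕ → ℕ) :
    IsPositiveOp (maxOp e (diagMap fun p => (w p : ℂ))) := by
  rintro ⟨u, hu⟩
  have hu' : u ∈ maxDom e (diagMap fun p => (w p : ℂ)) := hu
  rw [← ap_of_mem hu]
  refine (hasSum_re_inner (e := e) (g := fun p => (w p : ℝ)) fun p => ?_).nonneg fun p => by positivity
  rw [repr_ap_maxOp e hu', diagMap_apply, Complex.ofReal_natCast]

lemma isSelfAdjoint_diag (w : ℕ × ℕ → ℕ) [CompleteSpace H] :
    IsSelfAdjoint (maxOp e (diagMap fun p => (w p : ℂ))) := by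
  have h := formalAdj_diagMap fun p => (w p : ℂ)
  simp only [map_natCast] at h
  exact maxOp_adjoint e h (intertwinesCut_diagMap _)

lemma isSquareRoot_powOp [CompleteSpace H] :
    IsSquareRoot (powOp (opN e) 4) (maxOp e (diagMap fun p => ((wt p ^ 2 : ℕ) : ℂ))) := by
  refine ⟨isSelfAdjoint_diag e fun p => wt p ^ 2, isPositiveOp_diag e fun p => wt p ^ 2, ?_⟩
  rw [powOp_opN, prodOp_diag e (w := fun p => wt p ^ 2) (w' := fun p => wt p ^ 2)]
  · simp only [← pow_add]
  · intro p
    nlinarith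

/-- The coefficients of the square root of the regularization. -/
def regSqrt (ε : ℝ) (p : ℕ × ℕ) : ℝ := (wt p : ℝ) ^ 2 / (1 + ε * (wt p : ℝ) ^ 4)

lemma regSqrt_mul_self (ε : ℝ) (p : ℕ × ℕ) : regSqrt ε p * regSqrt ε p = reg ε (wt p) := by
  rw [regSqrt, reg, div_mul_div_comm, ← pow_add, ← sq]

lemma abs_div_le_of_pos {ε s : ℝ} (hε : 0 < ε) (hs : 0 ≤ s) :
    |1 / (1 + ε * s) ^ 2| ≤ 1 ∧ |s / (1 + ε * s) ^ 2| ≤ 1 / ε ∧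
      |s ^ 2 / (1 + ε * s) ^ 2| ≤ (1 / ε) ^ 2 := by
  have h0 : 0 ≤ ε * s := by positivity
  rw [abs_of_nonneg (by positivity), abs_of_nonneg (by positivity), abs_of_nonneg (by positivity)]
  refine ⟨?_, ?_, ?_⟩
  · rw [div_le_one (by positivity)]
    nlinarith
  · rw [div_le_div_iff₀ (by positivity) hε]
    nlinarith
  · rw [div_pow, div_le_div_iff₀ (by positivity) (by positivity)]
    nlinarith

lemma exists_isMul_reg [CompleteSpace H] {ε : ℝ} (hε : 0 < ε) :
    ∃ F, IsMul e (fun p => reg ε (wt p)) F ∧ IsRegularization (powOp (opN e) 4) ε F := by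
  have hb := fun p => abs_div_le_of_pos hε (s := (wt p : ℝ) ^ 4) (by positivity)
  obtain ⟨A, hA⟩ := exists_isMul e fun p => (hb p).1
  obtain ⟨F, hF⟩ := exists_isMul e fun p => (hb p).2.1
  obtain ⟨G, hG⟩ := exists_isMul e fun p => (hb p).2.2
  -- With s the fourth power of the weight, the three operators multiply by 1, s and s², each
  -- divided by (1 + εs)²; the decomposition of `u` is 1 + 2εs + (εs)² = (1 + εs)².
  refine ⟨F, hF, fun u => ⟨A u, F u, G u, ?_, ?_, ?_, rfl⟩⟩
  · rw [powOp_opN, mem_graph_diag e (w := fun p => wt p ^ 4)]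
    intro p
    rw [hA, hF]
    push_cast
    ring
  · rw [powOp_opN, mem_graph_diag e (w := fun p => wt p ^ 4)]
    intro p
    rw [hF, hG]
    push_cast
    ring
  · refine ext_repr e fun p => ?_
    rw [map_add, map_add, map_smul, map_smul, lp.coeFn_add, lp.coeFn_add, lp.coeFn_smul,
      lp.coeFn_smul, Pi.add_apply, Pi.add_apply, Pi.smul_apply, Pi.smul_apply, hA, hF, hG]
    have h0 : (1 + ε * (wt p : ℝ) ^ 4) ≠ 0 := by positivity
    have h1 : 1 / (1 + ε * (wt p : ℝ) ^ 4) ^ 2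
        + 2 * ε * ((wt p : ℝ) ^ 4 / (1 + ε * (wt p : ℝ) ^ 4) ^ 2)
        + ε ^ 2 * (((wt p : ℝ) ^ 4) ^ 2 / (1 + ε * (wt p : ℝ) ^ 4) ^ 2) = 1 := by
      field_simp
      ring
    have h2 := congrArg (fun x : ℝ => (x : ℂ)) h1
    simp only [Complex.ofReal_add, Complex.ofReal_mul, Complex.ofReal_one] at h2
    simp only [smul_eq_mul, Complex.ofReal_mul]
    linear_combination -(e.repr u p) * h2

/-- Multiplying this root by the squared weight still gives a bounded function, at most 1/ε. Its
range therefore lies in Dom N², where all entries of F and their adjoints are defined. -/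
lemma exists_isMul_regSqrt [CompleteSpace H] {ε : ℝ} (hε : 0 < ε) :
    ∃ G, IsMul e (regSqrt ε) G ∧ ∀ u, G u ∈ weightDom e fun p => wt p ^ 4 := by
  have hb : ∀ p, |regSqrt ε p| ≤ 1 + 1 / ε := by
    intro p
    have h := (abs_div_le_of_pos hε (s := (wt p : ℝ) ^ 4) (by positivity)).2.1
    have h2 : |regSqrt ε p| ^ 2 ≤ 1 / ε := by
      rw [sq, ← abs_mul, regSqrt_mul_self]
      exact h
    have h3 : 0 < 1 / ε := by positivity
    nlinarith [sq_nonneg (|regSqrt ε p| - 1), abs_nonneg (regSqrt ε p)]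
  obtain ⟨G, hG⟩ := exists_isMul e hb
  refine ⟨G, hG, fun u => ?_⟩
  rw [mem_weightDom]
  refine Summable.of_nonneg_of_le (fun p => by positivity) (fun p => ?_)
    ((summable_sq e u).mul_left ((1 / ε) ^ 2))
  have h := (abs_div_le_of_pos hε (s := (wt p : ℝ) ^ 4) (by positivity)).2.2
  rw [hG, norm_mul, mul_pow, ← mul_assoc, Complex.norm_real, Real.norm_eq_abs, sq_abs, sq (regSqrt ε p),
    regSqrt_mul_self]
  refine mul_le_mul_of_nonneg_right (le_trans (le_of_eq ?_) ((le_abs_self _).trans h))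
    (by positivity)
  rw [reg]
  push_cast
  ring

end NumberOperator

/-! ### Pairs of mutually adjoint maximal operators. -/

section Pairs

variable {H : Type*} [NormedAddCommGroup H] [InnerProductSpace ℂ H]
  (e : HilbertBasis (ℕ × ℕ) ℂ H)

/-- Mutually adjoint coefficient maps, defined on all vectors with square summable image
under the fourth power of the weight. -/
structure AdjointPair (L L' : CoeffMap) : Prop where
  adj : FormalAdj L L'
  adj' : FormalAdj L' L
  cut : ∃ s t, IntertwinesCut L s t
  cut' : ∃ s t, IntertwinesCut L' s t
  dom : weightDom e (fun p => wt p ^ 4) ≤ maxDom e L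
  dom' : weightDom e (fun p => wt p ^ 4) ≤ maxDom e L'

variable {e}

lemma AdjointPair.symm {L L' : CoeffMap} (h : AdjointPair e L L') : AdjointPair e L' L :=
  ⟨h.adj', h.adj, h.cut', h.cut, h.dom', h.dom⟩

lemma AdjointPair.smul {L L' : CoeffMap} (h : AdjointPair e L L') (z : ℂ) :
    AdjointPair e (z • L) ((starRingEnd ℂ) z • L') where
  adj := h.adj.smul z
  adj' := by simpa using h.adj'.smul ((starRingEnd ℂ) z)
  cut := by obtain ⟨s, t, hst⟩ := h.cut; exact ⟨s, t, hst.smul z⟩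
  cut' := by obtain ⟨s, t, hst⟩ := h.cut'; exact ⟨s, t, hst.smul _⟩
  dom := fun _ hu => maxDom_smul e (h.dom hu) z
  dom' := fun _ hu => maxDom_smul e (h.dom' hu) _

lemma AdjointPair.neg {L L' : CoeffMap} (h : AdjointPair e L L') : AdjointPair e (-L) (-L') := by
  have := h.smul (-1)
  rwa [map_neg, map_one, neg_one_smul_coeffMap, neg_one_smul_coeffMap] at this

variable [CompleteSpace H]

lemma AdjointPair.adjoint_eq {L L' : CoeffMap} (h : AdjointPair e L L') :
    (maxOp e L).adjoint = maxOp e L' := by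
  obtain ⟨s, t, hst⟩ := h.cut
  exact maxOp_adjoint e h.adj hst

lemma AdjointPair.isClosed {L L' : CoeffMap} (h : AdjointPair e L L') : (maxOp e L).IsClosed := by
  obtain ⟨s, t, hst⟩ := h.cut'
  exact maxOp_isClosed e h.adj' hst

omit [CompleteSpace H] in
lemma AdjointPair.tendsto {L L' : CoeffMap} (h : AdjointPair e L L') {u : H}
    (hu : u ∈ maxDom e L) :
    Tendsto (fun n => ap (maxOp e L) (trunc e n u)) atTop (𝓝 (ap (maxOp e L) u)) := by
  obtain ⟨s, t, hst⟩ := h.cut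
  exact tendsto_ap_trunc e h.adj hst hu

lemma AdjointPair.hasCore {L L' : CoeffMap} (h : AdjointPair e L L') :
    (maxOp e L).HasCore (spanBasis e) :=
  hasCore_of_tendsto h.isClosed (spanBasis_le_maxDom e h.adj) fun u hu =>
    ⟨fun n => trunc e n u, fun n => trunc_mem e n u, tendsto_trunc e u, h.tendsto hu⟩

omit [CompleteSpace H] in
lemma adjointPair_coeffA : AdjointPair e coeffA coeffAdag where
  adj := formalAdj_coeffA
  adj' := formalAdj_coeffAdag
  cut := ⟨_, _, intertwinesCut_coeffA⟩
  cut' := ⟨_, _, intertwinesCut_coeffAdag⟩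
  dom := (weightDom_wt_le_fst e).trans (weightDom_le_coeffA e)
  dom' := (weightDom_wt_le_fst e).trans (weightDom_le_coeffAdag e)

omit [CompleteSpace H] in
lemma adjointPair_coeffB : AdjointPair e coeffB coeffBdag where
  adj := formalAdj_coeffB
  adj' := formalAdj_coeffBdag
  cut := ⟨_, _, intertwinesCut_coeffB⟩
  cut' := ⟨_, _, intertwinesCut_coeffBdag⟩
  dom := (weightDom_wt_le_snd e).trans (weightDom_le_coeffB e)
  dom' := (weightDom_wt_le_snd e).trans (weightDom_le_coeffBdag e)

omit [CompleteSpace H] in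
lemma adjointPair_coeffK (P : Params) : AdjointPair e (coeffK P) (coeffKstar P) where
  adj := formalAdj_coeffK P
  adj' := formalAdj_coeffKstar P
  cut := ⟨_, _, intertwinesCut_coeffK P⟩
  cut' := ⟨_, _, intertwinesCut_coeffKstar P⟩
  dom := weightDom_le_coeffK P e
  dom' := weightDom_le_coeffKstar P e

end Pairs

/-! ### The eight channels and their total rate. -/

section ChannelOperators

variable (P : Params)

/-- The amplitudes of the eight channels. -/
def amplitude : Fin 8 → ℂ := ![P.β 0, P.α 0, P.α 1, P.β 1, P.β 2, P.α 2, P.β 3, P.α 3]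

/-- The ladder operators of the eight channels. -/
def ladder : Fin 8 → CoeffMap :=
  ![coeffB, coeffA, coeffA, coeffB, coeffB, coeffA, coeffBdag, coeffAdag]

/-- The adjoints of the ladder operators of the eight channels. -/
def ladderAdj : Fin 8 → CoeffMap :=
  ![coeffBdag, coeffAdag, coeffAdag, coeffBdag, coeffBdag, coeffAdag, coeffB, coeffA]

/-- The coefficient map of `R_k`. -/
def coeffR (k : Fin 8) : CoeffMap := amplitude P k • ladder k

/-- The coefficient map of `R_k*`. -/
def coeffRstar (k : Fin 8) : CoeffMap := (starRingEnd ℂ) (amplitude P k) • ladderAdj k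

/-- The diagonal entries of `R_k* R_k`, up to the amplitude. -/
def occupation : Fin 8 → ℕ × ℕ → ℝ :=
  ![fun p => p.2, fun p => p.1, fun p => p.1, fun p => p.2, fun p => p.2, fun p => p.1,
    fun p => p.2 + 1, fun p => p.1 + 1]

/-- The change of the weight under the ladder operators. -/
def weightShift : Fin 8 → ℕ → ℕ :=
  ![(· - 2), (· - 1), (· - 1), (· - 2), (· - 2), (· - 1), (· + 2), (· + 1)]

/-- The change of the weight under the adjoints of the ladder operators. -/
def weightShiftAdj : Fin 8 → ℕ → ℕ :=
  ![(· + 2), (· + 1), (· + 1), (· + 2), (· + 2), (· + 1), (· - 2), (· - 1)]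

lemma isChannel_ladder (k : Fin 8) :
    IsChannel (ladder k) (ladderAdj k) (occupation k) (weightShift k) (weightShiftAdj k) 20000 := by
  fin_cases k
  · exact isChannel_coeffB
  · exact isChannel_coeffA
  · exact isChannel_coeffA
  · exact isChannel_coeffB
  · exact isChannel_coeffB
  · exact isChannel_coeffA
  · exact isChannel_coeffBdag
  · exact isChannel_coeffAdag

lemma isChannel_coeffR (k : Fin 8) :
    IsChannel (coeffR P k) (coeffRstar P k) (fun p => ‖amplitude P k‖ ^ 2 * occupation k p)
      (weightShift k) (weightShiftAdj k) ((1 + ‖amplitude P k‖ ^ 2) * 20000) :=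
  (isChannel_ladder k).smul _

/-- The four constraints on the amplitudes enter only here. The gain channels contribute n + 1 and m
+ 1, which produces the constant term of the rate. -/
lemma sum_occupation (p : ℕ × ℕ) :
    ∑ k, ‖amplitude P k‖ ^ 2 * occupation k p = rate P p := by
  simp only [Fin.sum_univ_succ, amplitude, occupation, Fin.sum_univ_zero]
  simp only [Matrix.cons_val_zero, Matrix.cons_val_succ]
  unfold rate
  linear_combination (p.1 : ℝ) * P.α_loss + ((p.1 : ℝ) + 1) * P.α_gain + (p.2 : ℝ) * P.β_loss
    + ((p.2 : ℝ) + 1) * P.β_gain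

variable {H : Type*} [NormedAddCommGroup H] [InnerProductSpace ℂ H]
  (e : HilbertBasis (ℕ × ℕ) ℂ H)

lemma adjointPair_ladder (k : Fin 8) : AdjointPair e (ladder k) (ladderAdj k) := by
  fin_cases k
  · exact adjointPair_coeffB
  · exact adjointPair_coeffA
  · exact adjointPair_coeffA
  · exact adjointPair_coeffB
  · exact adjointPair_coeffB
  · exact adjointPair_coeffA
  · exact adjointPair_coeffB.symm
  · exact adjointPair_coeffA.symm

lemma adjointPair_coeffR (k : Fin 8) : AdjointPair e (coeffR P k) (coeffRstar P k) :=
  (adjointPair_ladder e k).smul _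

lemma opR_eq (k : Fin 8) : opR e P k = maxOp e (coeffR P k) := by
  rw [coeffR, ← scal_maxOp]
  fin_cases k
  · exact congrArg (scal _) (opB_eq e)
  · exact congrArg (scal _) (opA_eq e)
  · exact congrArg (scal _) (opA_eq e)
  · exact congrArg (scal _) (opB_eq e)
  · exact congrArg (scal _) (opB_eq e)
  · exact congrArg (scal _) (opA_eq e)
  · exact congrArg (scal _) (opBdag_eq e)
  · exact congrArg (scal _) (opAdag_eq e)

lemma weightDom_inf_le_coeffRstar (k : Fin 8) :
    weightDom e (fun p => p.1) ⊓ weightDom e (fun p => p.2) ≤ maxDom e (coeffRstar P k) := by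
  rintro u ⟨h1, h2⟩
  refine maxDom_smul e ?_ _
  fin_cases k
  · exact weightDom_le_coeffBdag e h2
  · exact weightDom_le_coeffAdag e h1
  · exact weightDom_le_coeffAdag e h1
  · exact weightDom_le_coeffBdag e h2
  · exact weightDom_le_coeffBdag e h2
  · exact weightDom_le_coeffAdag e h1
  · exact weightDom_le_coeffB e h2
  · exact weightDom_le_coeffA e h1

end ChannelOperators

/-! ### Dissipation and the form inequality on the span. -/

section Energy

variable {H : Type*} [NormedAddCommGroup H] [InnerProductSpace ℂ H] [CompleteSpace H]
  {e : HilbertBasis (ℕ × ℕ) ℂ H} (P : Params)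

/-- The left-hand form is that of the self-adjoint combination F K + K* F, which is diagonal. Taking
`f = 1` gives plain dissipation, taking `f = reg ε` the regularized one. -/
lemma hasSum_rate {f : ℕ → ℝ} {F : H →L[ℂ] H} (hF : IsMul e (fun p => f (wt p)) F) {u : H}
    (hu : u ∈ spanBasis e) :
    HasSum (fun p => -(f (wt p) * rate P p) * ‖e.repr u p‖ ^ 2)
      (2 * (⟪u, F (ap (maxOp e (coeffK P)) u)⟫_ℂ).re) := by
  have hKu := spanBasis_le_maxDom e (formalAdj_coeffK P) hu
  have hFu := spanBasis_le_maxDom e (formalAdj_coeffKstar P) (hF.mem_spanBasis hu)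
  have h1 : ⟪u, ap (maxOp e (coeffKstar P)) (F u)⟫_ℂ
      = (starRingEnd ℂ) ⟪u, F (ap (maxOp e (coeffK P)) u)⟫_ℂ := by
    rw [← inner_ap_left (formalAdj_coeffK P) (intertwinesCut_coeffK P) hKu hFu, ← hF.inner_left,
      inner_conj_symm]
  have h2 : 2 * (⟪u, F (ap (maxOp e (coeffK P)) u)⟫_ℂ).re
      = (⟪u, F (ap (maxOp e (coeffK P)) u) + ap (maxOp e (coeffKstar P)) (F u)⟫_ℂ).re := by
    rw [inner_add_right, h1, Complex.add_re, Complex.conj_re, two_mul]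
  rw [h2]
  refine hasSum_re_inner fun p => ?_
  have h3 : (e.repr (F u) : ℕ × ℕ → ℂ) = fun q => (f (wt q) : ℂ) * e.repr u q :=
    funext fun q => hF u q
  rw [map_add, lp.coeFn_add, Pi.add_apply, hF, repr_ap_maxOp e hKu, repr_ap_maxOp e hFu, h3,
    coeffK_add_coeffKstar]

/-- L* F L is diagonal: F is evaluated at the shifted weight and multiplied by the occupation
number. -/
lemma hasSum_square {L L' : CoeffMap} {N : ℕ × ℕ → ℝ} {σ τ : ℕ → ℕ} {c : ℝ}
    (h : IsChannel L L' N σ τ c) {f : ℕ → ℝ} {F : H →L[ℂ] H}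
    (hF : IsMul e (fun p => f (wt p)) F) {u : H} (hu : u ∈ spanBasis e) :
    HasSum (fun p => N p * f (σ (wt p)) * ‖e.repr u p‖ ^ 2)
      (⟪ap (maxOp e L) u, F (ap (maxOp e L) u)⟫_ℂ).re := by
  obtain ⟨s, t, hst⟩ := h.cut
  have hLu := spanBasis_le_maxDom e h.adj hu
  have hFu := spanBasis_le_maxDom e h.adj' (hF.mem_spanBasis (ap_mem_spanBasis h.adj hst hu))
  rw [inner_ap_left h.adj hst hLu hFu]
  refine hasSum_re_inner fun p => ?_
  have h3 : (e.repr (F (ap (maxOp e L) u)) : ℕ × ℕ → ℂ)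
      = fun q => (f (wt q) : ℂ) * L (e.repr u) q :=
    funext fun q => by rw [hF, repr_ap_maxOp e hLu]
  rw [repr_ap_maxOp e hFu, h3, h.square]

/-- The domain of `K` is contained in the form domains of both number operators. -/
lemma maxDom_coeffK_le :
    maxDom e (coeffK P) ≤ weightDom e (fun p => p.1) ⊓ weightDom e (fun p => p.2) := by
  intro u hu
  have hF : IsMul e (fun p => (fun _ : ℕ => (1 : ℝ)) (wt p)) (1 : H →L[ℂ] H) := isMul_one
  have hrate0 : ∀ p, 0 ≤ rate P p := fun p => by
    have := P.κ_pos; have := P.nbar_nonneg; have := P.κp_pos; have := P.nbarp_nonneg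
    unfold rate; positivity
  have hlim := (Filter.Tendsto.inner (𝕜 := ℂ) (tendsto_trunc e u) ((adjointPair_coeffK P).tendsto hu))
  obtain ⟨B, hB⟩ := (((Complex.continuous_re.tendsto _).comp hlim).const_mul (-2)).bddAbove_range
  -- A finite partial sum is bounded by the dissipation of a truncation containing its indices, and
  -- these dissipations are bounded since they converge along the truncations of a vector in Dom K.
  have hsum : Summable fun p => rate P p * ‖e.repr u p‖ ^ 2 := by
    refine summable_of_sum_le (c := B) (fun p => mul_nonneg (hrate0 p) (by positivity)) fun s => ?_
    have h1 := (hasSum_rate P (f := fun _ => 1) hF (trunc_mem e (s.sup wt) u)).neg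
    have h2 := sum_le_hasSum s (fun p _ => ?_) h1
    · refine le_trans (le_of_eq (Finset.sum_congr rfl fun p hp => ?_)) (h2.trans
        ((le_of_eq ?_).trans (hB ⟨s.sup wt, rfl⟩)))
      · rw [repr_trunc, cut, if_pos (Finset.le_sup hp)]
        ring
      · rw [one_apply_eq_self]
        simp only [Function.comp_apply]
        ring
    · rw [one_mul, neg_mul, neg_neg]
      exact mul_nonneg (hrate0 p) (by positivity)
  have hκ := P.κ_pos
  have hκp := P.κp_pos
  have hn := P.nbar_nonneg
  have hnp := P.nbarp_nonneg
  constructor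
  · refine Summable.of_nonneg_of_le (fun p => by positivity) (fun p => ?_)
      (hsum.mul_left (2 * P.κ)⁻¹)
    rw [← mul_assoc]
    refine mul_le_mul_of_nonneg_right ?_ (by positivity)
    rw [le_inv_mul_iff₀ (by positivity)]
    unfold rate
    have : 0 ≤ P.κp * P.nbarp + P.κ * P.nbar + 2 * P.κ * P.nbar * p.1
        + P.κp * (2 * P.nbarp + 1) * p.2 := by positivity
    nlinarith
  · refine Summable.of_nonneg_of_le (fun p => by positivity) (fun p => ?_)
      (hsum.mul_left (2 * P.κp)⁻¹)
    rw [← mul_assoc]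
    refine mul_le_mul_of_nonneg_right ?_ (by positivity)
    rw [le_inv_mul_iff₀ (by positivity)]
    unfold rate
    have : 0 ≤ P.κp * P.nbarp + P.κ * P.nbar + 2 * P.κp * P.nbarp * p.2
        + P.κ * (2 * P.nbar + 1) * p.1 := by positivity
    nlinarith

lemma dissipation {u : H} (hu : u ∈ spanBasis e) :
    2 * (⟪ap (maxOp e (coeffK P)) u, u⟫_ℂ).re
      = -∑ k, ‖ap (maxOp e (coeffR P k)) u‖ ^ 2 := by
  have hF : IsMul e (fun p => (fun _ : ℕ => (1 : ℝ)) (wt p)) (1 : H →L[ℂ] H) := isMul_one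
  have h1 := hasSum_rate P (f := fun _ => 1) hF hu
  have h2 := (hasSum_sum fun k (_ : k ∈ Finset.univ) =>
    hasSum_square (isChannel_coeffR P k) (f := fun _ => 1) hF hu).neg
  have h3 := h1.unique (h2.congr_fun fun p => ?_)
  · rw [one_apply_eq_self] at h3
    rw [← inner_conj_symm, Complex.conj_re, h3]
    congr 1
    refine Finset.sum_congr rfl fun k _ => ?_
    exact inner_self_eq_norm_sq (𝕜 := ℂ) _
  · simp only [mul_one, one_mul]
    rw [← Finset.sum_mul, sum_occupation, neg_mul]

lemma dissipation_adj {u : H} (hu : u ∈ spanBasis e) :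
    2 * (⟪ap (maxOp e (coeffKstar P)) u, u⟫_ℂ).re
      = -∑ k, ‖ap (maxOp e (coeffR P k)) u‖ ^ 2 := by
  rw [← dissipation P hu, ← inner_conj_symm, Complex.conj_re,
    ← inner_ap_left (formalAdj_coeffK P) (intertwinesCut_coeffK P)
      (spanBasis_le_maxDom e (formalAdj_coeffK P) hu)
      (spanBasis_le_maxDom e (formalAdj_coeffKstar P) hu)]

/-- The commutator multiplies the coefficients of L u by a difference δ of regularized weights. Then
2 |δ| |x| |y| ≤ |δ| |x|² + |δ| |y|² splits the pairing: the part in `v` is absorbed by `bound_comm`,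
and the part in L u becomes the sum `A` over the coefficients of `u`. -/
lemma commutator_le {L L' : CoeffMap} {N : ℕ × ℕ → ℝ} {σ τ : ℕ → ℕ} {c : ℝ}
    (h : IsChannel L L' N σ τ c) {ε : ℝ} (hε : 0 < ε) {F : H →L[ℂ] H}
    (hF : IsMul e (fun p => reg ε (wt p)) F) {u v : H} (hu : u ∈ spanBasis e) :
    ∃ A, HasSum (fun p => N p * |reg ε (σ (wt p)) - reg ε (τ (σ (wt p)))| * ‖e.repr u p‖ ^ 2) A ∧
      2 * (⟪v, F (ap (maxOp e L) u) - ap (maxOp e L) (F u)⟫_ℂ).re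
        ≤ c * ((⟪v, F v⟫_ℂ).re + ‖v‖ ^ 2) + A := by
  have hLu := spanBasis_le_maxDom e h.adj hu
  have hFu := spanBasis_le_maxDom e h.adj (hF.mem_spanBasis hu)
  have hbdd : ∀ p, |(fun k => |reg ε k - reg ε (τ k)|) (wt p)| ≤ c * (1 / ε + 1) := fun p => by
    rw [abs_abs]
    refine (h.bound_comm ε hε (wt p)).trans (mul_le_mul_of_nonneg_left ?_ h.const_nonneg)
    have := (abs_div_le_of_pos hε (s := (wt p : ℝ) ^ 4) (by positivity)).2.1
    have := (le_abs_self _).trans this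
    unfold reg
    linarith
  -- Multiplication by |δ| is made a bounded operator so that its form at L u can be summed in two
  -- ways: over the coefficients of L u, and through L* G L over those of `u`.
  obtain ⟨G, hG⟩ := exists_isMul e hbdd
  have hA := hasSum_square h (f := fun k => |reg ε k - reg ε (τ k)|) hG hu
  refine ⟨_, hA, ?_⟩
  have hA' := hasSum_re_inner (e := e) (hG (ap (maxOp e L) u))
  have hF' := ((hasSum_re_inner (e := e) (hF v)).add (hasSum_norm_sq (e := e) v)).mul_left c
  have hI := (Complex.hasSum_re (inner_eq_hasSum (e := e) v
    (F (ap (maxOp e L) u) - ap (maxOp e L) (F u)))).mul_left 2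
  refine hasSum_le (fun p => ?_) hI (hF'.add hA')
  have h3 : (e.repr (F u) : ℕ × ℕ → ℂ) = fun q => (reg ε (wt q) : ℂ) * e.repr u q :=
    funext fun q => hF u q
  have h4 : e.repr (F (ap (maxOp e L) u) - ap (maxOp e L) (F u)) p
      = ((reg ε (wt p) - reg ε (τ (wt p)) : ℝ) : ℂ) * e.repr (ap (maxOp e L) u) p := by
    rw [map_sub, lp.coeFn_sub, Pi.sub_apply, hF, repr_ap_maxOp e hFu, h3, h.comm,
      repr_ap_maxOp e hLu]
    push_cast
    ring
  rw [h4]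
  beta_reduce
  have h5 := h.bound_comm ε hε (wt p)
  generalize e.repr (ap (maxOp e L) u) p = y
  generalize e.repr v p = x
  generalize reg ε (wt p) - reg ε (τ (wt p)) = δ at *
  have h6 : ((starRingEnd ℂ) x * ((δ : ℂ) * y)).re ≤ |δ| * (‖x‖ * ‖y‖) := by
    refine (Complex.re_le_norm _).trans (le_of_eq ?_)
    rw [norm_mul, norm_mul, RCLike.norm_conj, Complex.norm_real, Real.norm_eq_abs]
    ring
  have h7 : |δ| * ‖x‖ ^ 2 ≤ c * (reg ε (wt p) + 1) * ‖x‖ ^ 2 :=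
    mul_le_mul_of_nonneg_right h5 (by positivity)
  nlinarith [mul_nonneg (abs_nonneg δ) (sq_nonneg (‖x‖ - ‖y‖))]

/-- The sum of the constants of the channels. -/
def channelConst : ℝ := ∑ k, (1 + ‖amplitude P k‖ ^ 2) * 20000

lemma channelConst_nonneg : 0 ≤ channelConst P := Finset.sum_nonneg fun k _ => by positivity

/-- On the coefficients of `u` the loss term is the total rate times the regularized weight, which
cancels the gain terms up to the shift of the weight. The factor 2 adds the shift error and the
commutator error. -/
lemma form_le_of_mem_span {ε : ℝ} (hε : 0 < ε) {F : H →L[ℂ] H}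
    (hF : IsMul e (fun p => reg ε (wt p)) F) {u : H} (hu : u ∈ spanBasis e) (v : Fin 8 → H) :
    2 * (⟪u, F (ap (maxOp e (coeffK P)) u)⟫_ℂ).re
      + ∑ k, ((⟪ap (maxOp e (coeffR P k)) u, F (ap (maxOp e (coeffR P k)) u)⟫_ℂ).re
        + 2 * (⟪v k, F (ap (maxOp e (coeffR P k)) u)
          - ap (maxOp e (coeffR P k)) (F u)⟫_ℂ).re)
      ≤ 2 * channelConst P * ((⟪u, F u⟫_ℂ).re + ‖u‖ ^ 2)
        + ∑ k, 2 * channelConst P * ((⟪v k, F (v k)⟫_ℂ).re + ‖v k‖ ^ 2) := by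
  choose A hA hcomm using fun k => commutator_le (isChannel_coeffR P k) hε hF (v := v k) hu
  have hS := fun k => hasSum_square (isChannel_coeffR P k) (f := reg ε) hF hu
  have h1 := (hasSum_rate P (f := reg ε) hF hu).add
    (hasSum_sum fun k (_ : k ∈ Finset.univ) => (hS k).add (hA k))
  have h2 := ((hasSum_re_inner (e := e) (hF u)).add (hasSum_norm_sq (e := e) u)).mul_left
    (2 * channelConst P)
  have h3 := hasSum_le (fun p => ?_) h1 h2
  · have h4 : ∀ k, (1 + ‖amplitude P k‖ ^ 2) * 20000 * ((⟪v k, F (v k)⟫_ℂ).re + ‖v k‖ ^ 2)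
        ≤ 2 * channelConst P * ((⟪v k, F (v k)⟫_ℂ).re + ‖v k‖ ^ 2) := fun k => by
      have h5 : (1 + ‖amplitude P k‖ ^ 2) * 20000 ≤ channelConst P :=
        Finset.single_le_sum (f := fun k => (1 + ‖amplitude P k‖ ^ 2) * 20000)
          (fun k _ => by positivity) (Finset.mem_univ k)
      have h6 : 0 ≤ (⟪v k, F (v k)⟫_ℂ).re :=
        (hasSum_re_inner (e := e) (hF (v k))).nonneg fun p =>
          mul_nonneg (reg_nonneg _) (by positivity)
      refine mul_le_mul_of_nonneg_right ?_ (by positivity)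
      linarith [channelConst_nonneg P]
    have h7 := Finset.sum_le_sum fun k (_ : k ∈ Finset.univ) => (hcomm k).trans
      (add_le_add_left (h4 k) (A k))
    rw [Finset.sum_add_distrib] at h7 h3 ⊢
    linarith
  · have h4 : ∀ k, ‖amplitude P k‖ ^ 2 * occupation k p * reg ε (weightShift k (wt p))
        + ‖amplitude P k‖ ^ 2 * occupation k p
          * |reg ε (weightShift k (wt p)) - reg ε (weightShiftAdj k (weightShift k (wt p)))|
        ≤ reg ε (wt p) * (‖amplitude P k‖ ^ 2 * occupation k p)
          + 2 * ((1 + ‖amplitude P k‖ ^ 2) * 20000 * (reg ε (wt p) + 1)) := fun k => by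
      have h5 := (isChannel_coeffR P k).bound_shift ε hε p
      have h6 := (isChannel_coeffR P k).bound_comm_shift ε hε p
      have h7 := (isChannel_coeffR P k).nonneg p
      have h8 := mul_le_mul_of_nonneg_left
        (le_abs_self (reg ε (weightShift k (wt p)) - reg ε (wt p))) h7
      nlinarith
    have h9 := Finset.sum_le_sum fun k (_ : k ∈ Finset.univ) => h4 k
    rw [Finset.sum_add_distrib (f := fun k => reg ε (wt p) * _), ← Finset.mul_sum,
      sum_occupation, ← Finset.mul_sum, ← Finset.sum_mul] at h9
    simp only [← add_mul, ← Finset.sum_mul]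
    have h10 := mul_le_mul_of_nonneg_right h9 (sq_nonneg ‖e.repr u p‖)
    unfold channelConst
    nlinarith

end Energy

/-! ### The matrix F and verification of all conditions. -/

section Assembly

variable {H : Type*} [NormedAddCommGroup H] [InnerProductSpace ℂ H]

/-- As the scattering block vanishes, only the time component and its couplings with single channels
survive. For each channel the last two brackets will become a commutator and its conjugate. -/
lemma sum_blockMatrix {d : ℕ} (K : H →ₗ.[ℂ] H) (R N : Fin d → (H →ₗ.[ℂ] H)) (B : H →L[ℂ] H)
    (u : Fin (d + 1) → H) (F : Fin (d + 1) → Fin (d + 1) → (H →ₗ.[ℂ] H))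
    (hF : F = blockMatrix K R N fun _ _ => 0) :
    ∑ i, ∑ j, (⟪u i, B (ap (F i j) (u j))⟫_ℂ + ⟪ap (F j i) (u i), B (u j)⟫_ℂ
        + ∑ k : Fin d, ⟪ap (F k.succ i) (u i), B (ap (F k.succ j) (u j))⟫_ℂ)
      = ⟪u 0, B (ap K (u 0))⟫_ℂ + ⟪ap K (u 0), B (u 0)⟫_ℂ
        + ∑ k, (⟪ap (R k) (u 0), B (ap (R k) (u 0))⟫_ℂ
          + (⟪u 0, B (ap (N k) (u k.succ))⟫_ℂ + ⟪ap (R k) (u 0), B (u k.succ)⟫_ℂ)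
          + (⟪u k.succ, B (ap (R k) (u 0))⟫_ℂ + ⟪ap (N k) (u k.succ), B (u 0)⟫_ℂ)) := by
  subst hF
  have h00 : blockMatrix K R N (fun _ _ => 0) 0 0 = K := rfl
  have h0s : ∀ k : Fin d, blockMatrix K R N (fun _ _ => 0) 0 k.succ = N k := fun _ => rfl
  have hs0 : ∀ k : Fin d, blockMatrix K R N (fun _ _ => 0) k.succ 0 = R k := fun _ => rfl
  have hss : ∀ k l : Fin d, blockMatrix K R N (fun _ _ => 0) k.succ l.succ = 0 := fun _ _ => rfl
  simp only [Fin.sum_univ_succ, h00, h0s, hs0, hss, ap_zero, map_zero, inner_zero_left,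
    inner_zero_right, Finset.sum_const_zero, add_zero, Finset.sum_add_distrib]
  ring

variable [CompleteSpace H] (e : HilbertBasis (ℕ × ℕ) ℂ H) (P : Params)

lemma neg_adjoint_opR (k : Fin 8) : -(opR e P k).adjoint = maxOp e (-coeffRstar P k) := by
  rw [opR_eq, (adjointPair_coeffR P e k).adjoint_eq, neg_maxOp]

lemma oscMatrix_eq : oscMatrix e P = blockMatrix (maxOp e (coeffK P))
    (fun k => maxOp e (coeffR P k)) (fun k => maxOp e (-coeffRstar P k)) fun _ _ => 0 := by
  rw [oscMatrix, opK_eq, funext (opR_eq P e), ← funext (neg_adjoint_opR e P),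
    funext (opR_eq P e)]

lemma oscMatrix_zero_zero : oscMatrix e P 0 0 = maxOp e (coeffK P) := rfl

lemma oscMatrix_succ_zero (k : Fin 8) : oscMatrix e P k.succ 0 = maxOp e (coeffR P k) :=
  opR_eq P e k

lemma oscMatrix_zero_succ (k : Fin 8) : oscMatrix e P 0 k.succ = maxOp e (-coeffRstar P k) :=
  neg_adjoint_opR e P k

lemma oscMatrix_succ_succ (k l : Fin 8) : oscMatrix e P k.succ l.succ = 0 := rfl

omit [CompleteSpace H] in
lemma adjointPair_zero : AdjointPair e 0 0 where
  adj := fun _ => ⟨0, rfl, fun _ => rfl⟩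
  adj' := fun _ => ⟨0, rfl, fun _ => rfl⟩
  cut := ⟨0, 0, fun n u => by ext p; simp [cut]⟩
  cut' := ⟨0, 0, fun n u => by ext p; simp [cut]⟩
  dom := fun _ _ => zero_memℓp
  dom' := fun _ _ => zero_memℓp

lemma oscMatrix_entry (i j : Fin 9) :
    ∃ L L', oscMatrix e P i j = maxOp e L ∧ AdjointPair e L L' := by
  refine Fin.cases ?_ (fun i => ?_) i <;> refine Fin.cases ?_ (fun j => ?_) j
  · exact ⟨_, _, oscMatrix_zero_zero e P, adjointPair_coeffK P⟩
  · exact ⟨_, _, oscMatrix_zero_succ e P j, (adjointPair_coeffR P e j).symm.neg⟩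
  · exact ⟨_, _, oscMatrix_succ_zero e P i, adjointPair_coeffR P e i⟩
  · exact ⟨_, _, (oscMatrix_succ_succ e P i j).trans (zero_eq_maxOp e), adjointPair_zero e⟩

variable {e}

/-- Every entry of F converges along truncations and F is bounded, so both sides are limits of their
values at truncations, with constants independent of the level. -/
lemma form_le {ε : ℝ} (hε : 0 < ε) {F : H →L[ℂ] H} (hF : IsMul e (fun p => reg ε (wt p)) F)
    (u : Fin 9 → H) (hu : ∀ i, u i ∈ matrixDomain (oscMatrix e P)) :
    (∑ i, ∑ j, (⟪u i, F (ap (oscMatrix e P i j) (u j))⟫_ℂ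
        + ⟪ap (oscMatrix e P j i) (u i), F (u j)⟫_ℂ
        + ∑ k : Fin 8, ⟪ap (oscMatrix e P k.succ i) (u i),
          F (ap (oscMatrix e P k.succ j) (u j))⟫_ℂ)).re
      ≤ ∑ i, (2 * channelConst P * (⟪u i, F (u i)⟫_ℂ).re + 2 * channelConst P * ‖u i‖ ^ 2) := by
  have hdom : ∀ i j k, u k ∈ (oscMatrix e P i j).domain := fun i j k => by
    have := hu k
    rw [matrixDomain, Submodule.mem_iInf] at this
    exact (Submodule.mem_iInf _).1 (this i) j
  have hap : ∀ i j k, Tendsto (fun n => ap (oscMatrix e P i j) (trunc e n (u k))) atTop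
      (𝓝 (ap (oscMatrix e P i j) (u k))) := fun i j k => by
    obtain ⟨L, L', hL, hpair⟩ := oscMatrix_entry e P i j
    have := hdom i j k
    rw [hL] at this ⊢
    exact hpair.tendsto this
  have htr : ∀ k, Tendsto (fun n => trunc e n (u k)) atTop (𝓝 (u k)) := fun k => tendsto_trunc e _
  have hcomp : ∀ {x : ℕ → H} {y : H}, Tendsto x atTop (𝓝 y) →
      Tendsto (fun n => F (x n)) atTop (𝓝 (F y)) := fun h => (F.continuous.tendsto _).comp h
  have hin : ∀ {x x' : ℕ → H} {y y' : H}, Tendsto x atTop (𝓝 y) → Tendsto x' atTop (𝓝 y') →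
      Tendsto (fun n => ⟪x n, x' n⟫_ℂ) atTop (𝓝 ⟪y, y'⟫_ℂ) := fun h h' => h.inner h'
  refine le_of_tendsto_of_tendsto'
    ((Complex.continuous_re.tendsto _).comp (tendsto_finsetSum _ fun i _ =>
      tendsto_finsetSum _ fun j _ => ((hin (htr i) (hcomp (hap i j j))).add
        (hin (hap j i i) (hcomp (htr j)))).add (tendsto_finsetSum _ fun k _ =>
          hin (hap k.succ i i) (hcomp (hap k.succ j j)))))
    (tendsto_finsetSum _ fun i _ =>
      (((Complex.continuous_re.tendsto _).comp (hin (htr i) (hcomp (htr i)))).const_mul _).add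
        (((htr i).norm.pow 2).const_mul _)) fun n => ?_
  have hs : ∀ i, trunc e n (u i) ∈ spanBasis e := fun i => trunc_mem e n _
  simp only [Function.comp_apply]
  rw [sum_blockMatrix _ _ _ F (fun i => trunc e n (u i)) _ (oscMatrix_eq e P)]
  have key := form_le_of_mem_span P hε hF (hs 0) fun k => trunc e n (u k.succ)
  have hconj : ∀ x y : H, (⟪x, F y⟫_ℂ).re = (⟪y, F x⟫_ℂ).re := fun x y => by
    rw [← hF.inner_left, ← inner_conj_symm, Complex.conj_re]
  refine le_trans (le_of_eq ?_) (key.trans (le_of_eq ?_))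
  · rw [Complex.add_re, Complex.re_sum]
    congr 1
    · rw [Complex.add_re, hconj (ap _ _), two_mul]
    · refine Finset.sum_congr rfl fun k _ => ?_
      obtain ⟨s, t, hst⟩ := (adjointPair_coeffR P e k).cut'
      have h1 : ⟪ap (maxOp e (-coeffRstar P k)) (trunc e n (u k.succ)), F (trunc e n (u 0))⟫_ℂ
          = -⟪trunc e n (u k.succ), ap (maxOp e (coeffR P k)) (F (trunc e n (u 0)))⟫_ℂ := by
        rw [← neg_maxOp, ap_neg, inner_neg_left, inner_ap_left (adjointPair_coeffR P e k).adj' hst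
          (spanBasis_le_maxDom e (adjointPair_coeffR P e k).adj' (hs k.succ))
          (spanBasis_le_maxDom e (adjointPair_coeffR P e k).adj (hF.mem_spanBasis (hs 0)))]
      have h2 : (⟪trunc e n (u 0), F (ap (maxOp e (-coeffRstar P k)) (trunc e n (u k.succ)))⟫_ℂ).re
          = (⟪ap (maxOp e (-coeffRstar P k)) (trunc e n (u k.succ)), F (trunc e n (u 0))⟫_ℂ).re :=
        hconj _ _
      rw [inner_sub_right]
      simp only [Complex.add_re, Complex.sub_re]
      rw [h2, h1, hconj (ap _ _) (trunc e n (u k.succ)), Complex.neg_re]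
      ring
  · rw [Fin.sum_univ_succ (n := 8)]
    simp only [mul_add]

lemma ap_adjoint_oscMatrix_zero_succ (k : Fin 8) (u : H) :
    ap ((oscMatrix e P 0 k.succ).adjoint) u = -ap (maxOp e (coeffR P k)) u := by
  rw [oscMatrix_zero_succ, (adjointPair_coeffR P e k).symm.neg.adjoint_eq, ← neg_maxOp, ap_neg]

lemma adjoint_one_eq : (1 : H →L[ℂ] H).adjoint = 1 := by
  rw [← ContinuousLinearMap.star_eq_adjoint, star_one]

theorem hypothesisC_oscMatrix :
    HypothesisC (oscMatrix e P) (fun i j => if i = j then 1 else 0) (spanBasis e) (spanBasis e)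
      (powOp (opN e) 4) where
  closed i j := by
    obtain ⟨L, L', hL, hpair⟩ := oscMatrix_entry e P i j
    rw [hL]
    exact hpair.isClosed
  scattering i j := by
    rw [oscMatrix_succ_succ, sub_self]
    rfl
  unitary_left i j := by
    rw [Finset.sum_eq_single i]
    · by_cases h : i = j <;> simp [h, adjoint_one_eq]
    · intro k _ hk
      simp [hk]
    · simp
  unitary_right i j := by
    rw [Finset.sum_eq_single i]
    · rcases eq_or_ne i j with rfl | h
      · simp [adjoint_one_eq]
      · simp [h, h.symm]
    · intro k _ hk
      simp [hk.symm]
    · simp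
  dense_D := spanBasis_dense e
  core_K := (adjointPair_coeffK P).hasCore
  core_R k := by
    rw [oscMatrix_succ_zero]
    exact (adjointPair_coeffR P e k).hasCore
  core_N k := by
    rw [oscMatrix_zero_succ]
    exact (adjointPair_coeffR P e k).symm.neg.hasCore
  dense_Dt := spanBasis_dense e
  core_K_adj := by
    rw [oscMatrix_zero_zero, (adjointPair_coeffK P).adjoint_eq]
    exact (adjointPair_coeffK P).symm.hasCore
  core_R_adj k := by
    rw [oscMatrix_succ_zero, (adjointPair_coeffR P e k).adjoint_eq]
    exact (adjointPair_coeffR P e k).symm.hasCore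
  core_N_adj k := by
    rw [oscMatrix_zero_succ, (adjointPair_coeffR P e k).symm.neg.adjoint_eq]
    exact (adjointPair_coeffR P e k).neg.hasCore
  dom_N_adj k := by
    rw [Set.union_self, oscMatrix_zero_succ, (adjointPair_coeffR P e k).symm.neg.adjoint_eq]
    exact (adjointPair_coeffR P e k).neg.hasCore.le_domain
  dom_R k := by
    rw [Set.union_self, oscMatrix_succ_zero]
    exact (adjointPair_coeffR P e k).hasCore.le_domain
  dom_N k := by
    rw [oscMatrix_zero_succ, oscMatrix_zero_zero]
    -- Dom K lies in the form domains of both number operators, where all ladder operators are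
    -- defined.
    exact fun u hu => maxDom_neg e (weightDom_inf_le_coeffRstar P e k (maxDom_coeffK_le P hu))
  dom_S k u hu i := by
    rw [oscMatrix_succ_zero, (adjointPair_coeffR P e k).adjoint_eq]
    have h := weightDom_inf_le_coeffRstar P e k (maxDom_coeffK_le P hu)
    by_cases hki : k = i
    · rw [if_pos hki]
      exact h
    · rw [if_neg hki]
      exact (maxOp e (coeffRstar P k)).domain.zero_mem
  generator := by
    rw [oscMatrix_zero_zero]
    refine generates_maxOp e (formalAdj_coeffK P) (intertwinesCut_coeffK P) fun u hu => ?_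
    have h1 := dissipation P hu
    have h2 : 0 ≤ ∑ k, ‖ap (maxOp e (coeffR P k)) u‖ ^ 2 :=
      Finset.sum_nonneg fun k _ => by positivity
    linarith
  generator_adj := by
    rw [oscMatrix_zero_zero, (adjointPair_coeffK P).adjoint_eq]
    refine generates_maxOp e (formalAdj_coeffKstar P) (intertwinesCut_coeffKstar P) fun u hu => ?_
    have h1 := dissipation_adj P hu
    have h2 : 0 ≤ ∑ k, ‖ap (maxOp e (coeffR P k)) u‖ ^ 2 :=
      Finset.sum_nonneg fun k _ => by positivity
    linarith
  dissipative u hu := by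
    simp only [oscMatrix_zero_zero, oscMatrix_succ_zero]
    exact dissipation P hu
  dissipative_adj u hu := by
    simp only [ap_adjoint_oscMatrix_zero_succ, oscMatrix_zero_zero,
      (adjointPair_coeffK P).adjoint_eq, norm_neg]
    exact dissipation_adj P hu
  N_adj_eq u hu k := by
    rw [ap_adjoint_oscMatrix_zero_succ, Finset.sum_eq_single k]
    · rw [if_pos rfl, adjoint_one_eq, oscMatrix_succ_zero, one_apply_eq_self]
    · intro l _ hl
      simp [hl]
    · simp
  selfAdjoint_C := by
    rw [powOp_opN]
    exact isSelfAdjoint_diag e fun p => wt p ^ 4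
  positive_C := by
    rw [powOp_opN]
    exact isPositiveOp_diag e fun p => wt p ^ 4
  dom_sqrt_C := by
    refine ⟨_, isSquareRoot_powOp e, fun u hu => ?_⟩
    have hu' : u ∈ weightDom e fun p => wt p ^ 4 := by
      have := (mem_maxDom_diagMap_nat e (w := fun p => wt p ^ 2)).1 hu
      simpa only [← pow_mul] using this
    rw [matrixDomain, Submodule.mem_iInf]
    intro i
    rw [Submodule.mem_iInf]
    intro j
    obtain ⟨L, L', hL, hpair⟩ := oscMatrix_entry e P i j
    rw [hL]
    exact hpair.dom hu'
  fagnola_wills := by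
    -- The estimates hold for every ε > 0, so δ = 1 is an arbitrary choice.
    refine ⟨1, 2 * channelConst P, 2 * channelConst P, one_pos,
      mul_nonneg zero_le_two (channelConst_nonneg P), mul_nonneg zero_le_two (channelConst_nonneg P),
      fun ε hε _ => ?_⟩
    obtain ⟨F, hF, hreg⟩ := exists_isMul_reg e hε
    obtain ⟨G, hG, hGdom⟩ := exists_isMul_regSqrt e hε
    have hsqrt : CFC.sqrt F = G := hF.sqrt_eq hG (fun p => by unfold regSqrt; positivity)
      (regSqrt_mul_self ε)
    refine ⟨F, hreg, hF.nonneg fun p => reg_nonneg _, ⟨spanBasis e, spanBasis_dense e, le_rfl,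
      fun u hu => ?_, fun i j => ?_⟩, form_le P hε hF⟩
    · rw [hsqrt]
      exact hG.mem_spanBasis hu
    · obtain ⟨L, L', hL, hpair⟩ := oscMatrix_entry e P i j
      rw [hL, hpair.adjoint_eq, hsqrt]
      -- The adjoint entry is closed and defined on the whole range of the root, so the composition
      -- is bounded by the closed graph theorem.
      obtain ⟨A, hA⟩ := exists_clm_of_isClosed hpair.symm.isClosed G fun u =>
        hpair.dom' (hGdom u)
      refine ⟨‖A‖, fun u _ => ⟨hpair.dom' (hGdom u), ?_⟩⟩
      rw [← hA]
      exact A.le_opNorm u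

end Assembly

end ParamOsc

end

theorem mainTheorem3 (P : ParamOsc.Params) :
    ParamOsc.HypothesisC
      (ParamOsc.oscMatrix ParamOsc.tensorBasis P)
      (fun i j => if i = j then 1 else 0)
      (ParamOsc.spanBasis ParamOsc.tensorBasis)
      (ParamOsc.spanBasis ParamOsc.tensorBasis)
      (ParamOsc.powOp (ParamOsc.opN ParamOsc.tensorBasis) 4) :=
  ParamOsc.hypothesisC_oscMatrix P
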